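/- **Setting.** Fix $n,d,H,K\ge 1$. For $\Theta=[A,B]^\top\in\mathbb R^{(n+d)\times n}$ consider the system $x_{h+1}=Ax_h+Bu_h+w_h$, $1\le h\le H$, with cost $\sum_{h=1}^H (x_h^\top Qx_h+u_h^\top Ru_h)$, where $Q,R$ are symmetric positive definite. It is run for $K$ episodes with true parameter $\Theta_*=[A_*,B_*]^\top$, initial states $x_{k,1}$ and noise $w_{k,h}$. Let $J_1^{\pi}(\Theta,x)$ be the expected cost of an episode of the system $\Theta$ started in $x$ under the closed-loop policy $\pi$, $J_1^*(\Theta,x)=\inf_\pi J_1^\pi(\Theta,x)$ (in episode $k$, with the noise law of that episode), $P_{H+1}(\Theta)=0$, $$P_h=Q+A^\top P_{h+1}A-A^\top P_{h+1}B(R+B^\top P_{h+1}B)^{-1}B^\top P_{h+1}A,\qquad K_h=-(R+B^\top P_{h+1}B)^{-1}B^\top P_{h+1}A .$$ Let $\mathcal S=\{\Theta:\|\Theta\|_F\le1,\ [A,B]\text{ controllable}\}$, and write $\|M\|$ for the spectral norm and $\|M\|_N=\sqrt{\operatorname{trace}(M^\top NM)}$. **Boundedness.** $\Theta_*\in\mathcal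 S$; $\|A_*\|\le C_A<1$, $\|B_*\|\le C_B<1$, $\|Q\|,\|R\|\le C$; $\|x_{k,1}\|\le 1$; the noise $w_{k,h}$ is independent of everything that is determined before it is drawn (earlier noise, initial states, regularizers, played parameters), has mean zero, and $\|w_{k,h}\|\le C_w$ with $0<C_w<1$; $\|K_h(\Theta)\|\le\gamma$ for all $\Theta\in\mathcal S$ and $1\le h\le H$, and $C_A+\gamma C_B+C_w\le 1$. **OFU-RL with changing regularizers.** At the start of episode $k$, let $Z_k$ and $X_k^{\rm next}$ be the matrices with rows $z_{k',h}^\top=[x_{k',h}^\top,u_{k',h}^\top]$ and $x_{k',h+1}^\top$, $k'<k$, $1\le h\le H$. Given random matrices $H_k\in\mathbb R^{(n+d)\times(n+d)}$, $L_k\in\mathbb R^{(n+d)\times n}$ available at that time, put $V_k=Z_k^\top Z_k+H_k$, $U_k=Z_k^\top X_k^{\rm next}+L_k$, $\hat\Theta_k=V_k^{-1}U_k$, and, for constants $\lambda_{\max},\nu$ and $\lambda_{\min}>0$, $$\mathcal C_k(\alpha)=\{\Theta:\|\Theta-\hat\Theta_k\|_{V_k}\le\beta_k(\alpha)\},\quad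 \beta_k(\alpha)=C_w\sqrt{2\ln\tfrac2\alpha+n\ln\det(I+\lambda_{\min}^{-1}Z_k^\top Z_k)}+\sqrt{\lambda_{\max}}+\nu .$$ Whenever $\mathcal C_k(\alpha)\cap\mathcal S\neq\emptyset$, the algorithm picks $\widetilde\Theta_k$ in this set with $J_1^*(\widetilde\Theta_k,x_{k,1})\le J_1^*(\Theta,x_{k,1})+\varepsilon$ for all $\Theta\in\mathcal C_k(\alpha)\cap\mathcal S$, where $0\le\varepsilon\le 1/\sqrt K$ is a tolerance ($\varepsilon=0$ is the exact argmin). It plays the policy $\pi_k$, $u_{k,h}=K_h(\widetilde\Theta_k)x_{k,h}$. Its regret is $\mathcal R(K)=\sum_{k=1}^K\big(J_1^{\pi_k}(\Theta_*,x_{k,1})-J_1^*(\Theta_*,x_{k,1})\big)$. **Theorem (Regret under changing regularizers).** There is a constant $c>0$ that depends only on $C,C_A,C_B,C_w,\gamma$ such that, in this setting, the following holds for every $\alpha\in(0,1]$ and $\delta\ge0$. If with probability at least $1-\delta$, for all $k\le K$, $H_k$ is positive definite and $$\|H_k\|\le\lambda_{\max},\qquad \|H_k^{-1}\|\le 1/\lambda_{\min},\qquad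 \|L_k\|_{H_k^{-1}}\le\nu,$$ then with probability at least $1-\alpha-\delta$, $$\mathcal R(K)\le c\,H\sqrt K\big(\sqrt H+n(n+d)\psi+\ln(1/\alpha)\big)+c\,H\sqrt K\,(\sqrt{\lambda_{\max}}+\nu)\sqrt{n(n+d)\psi},\qquad \psi=\ln\Big(1+\frac{HK}{(n+d)\lambda_{\min}}\Big).$$ (In particular the probability is at least $1-\alpha$ if the regularizer bounds always hold, and at least $1-\alpha'$ if they hold with probability $1-\alpha'/2$ and the algorithm is run with $\alpha=\alpha'/2$.) -/

import Mathlib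

open MeasureTheory ProbabilityTheory
open scoped Matrix

noncomputable section

namespace LQControl

/-! ### Matrix norms -/

open scoped Matrix.Norms.L2Operator in
/-- The spectral norm (operator norm for the Euclidean norms) of a real matrix. -/
def opNorm {m n : ℕ} (M : Matrix (Fin m) (Fin n) ℝ) : ℝ := ‖M‖

open scoped Matrix.Norms.L2Operator in
/-- The spectral norm of a matrix whose rows and columns are indexed by state and control
coordinates together. -/
def opNormZ {n d : ℕ} (M : Matrix (Fin n ⊕ Fin d) (Fin n ⊕ Fin d) ℝ) : ℝ := ‖M‖

/-- The weighted norm given by `‖A‖_M ^ 2 = trace (Aᵀ M A)`. -/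
def weightedNorm {ι κ : Type*} [Fintype ι] [Fintype κ]
    (M : Matrix ι ι ℝ) (A : Matrix ι κ ℝ) : ℝ :=
  √(Matrix.trace (Aᵀ * M * A))

/-- The Frobenius norm `√ (trace (Aᵀ A))`. -/
def frobNorm {ι κ : Type*} [Fintype ι] [Fintype κ] (A : Matrix ι κ ℝ) : ℝ :=
  √(Matrix.trace (Aᵀ * A))

/-! ### Linear quadratic systems -/

/-- States (and noise vectors), with the Euclidean norm. -/
abbrev State (n : ℕ) := EuclideanSpace ℝ (Fin n)

/-- Controls, with the Euclidean norm. -/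
abbrev Control (d : ℕ) := EuclideanSpace ℝ (Fin d)

/-- Parameters `Θ = [A, B]ᵀ`, of size `(n + d) × n`. -/
abbrev Param (n d : ℕ) := Matrix (Fin n ⊕ Fin d) (Fin n) ℝ

/-- The matrix `A` of `Θ = [A, B]ᵀ`. -/
def dynA {n d : ℕ} (Θ : Param n d) : Matrix (Fin n) (Fin n) ℝ := Θ.toRows₁ᵀ

/-- The matrix `B` of `Θ = [A, B]ᵀ`. -/
def dynB {n d : ℕ} (Θ : Param n d) : Matrix (Fin n) (Fin d) ℝ := Θ.toRows₂ᵀ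

/-- Controllability of `[A, B]`: the Kalman matrix `[B, A B, …, A ^ (n - 1) B]` has rank `n`. -/
def Controllable {n d : ℕ} (Θ : Param n d) : Prop :=
  (Matrix.of fun (i : Fin n) (q : Fin n × Fin d) =>
    ((dynA Θ) ^ (q.1 : ℕ) * dynB Θ) i q.2).rank = n

/-- The set `𝒮` of controllable parameters of Frobenius norm at most one. -/
def paramSet (n d : ℕ) : Set (Param n d) := {Θ | frobNorm Θ ≤ 1 ∧ Controllable Θ}

/-- A linear quadratic system: cost matrices `Q`, `R` and true parameter `Θ_*`. -/
structure LQSystem (n d : ℕ) where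
  Q : Matrix (Fin n) (Fin n) ℝ
  R : Matrix (Fin d) (Fin d) ℝ
  Θstar : Param n d

variable {n d : ℕ}

/-- The cost `xᵀ Q x + uᵀ R u` of one step. -/
def LQSystem.stageCost (S : LQSystem n d) (x : State n) (u : Control d) : ℝ :=
  x.ofLp ⬝ᵥ (S.Q *ᵥ x.ofLp) + u.ofLp ⬝ᵥ (S.R *ᵥ u.ofLp)

/-- A closed-loop policy; `π h x` is the control in state `x` at step `h`. Steps are counted from
`0`, so an episode of horizon `H` has the steps `0, …, H - 1`. -/
abbrev Policy (n d : ℕ) := ℕ → State n → Control d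

/-- The states `x_{h + 1} = A x_h + B π_h(x_h) + w_h` of the system with parameter `Θ` under the
policy `π`, started in `x`, for the realization `w` of the noise. -/
def trajectory (Θ : Param n d) (π : Policy n d) (x : State n) (w : ℕ → State n) : ℕ → State n
  | 0 => x
  | h + 1 =>
      Matrix.toEuclideanLin (dynA Θ) (trajectory Θ π x w h)
        + Matrix.toEuclideanLin (dynB Θ) (π h (trajectory Θ π x w h)) + w h

/-- The total cost of an episode for the realization `w` of the noise. -/
def LQSystem.episodeCost (S : LQSystem n d) (H : ℕ) (Θ : Param n d) (π : Policy n d) (x : State n)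
    (w : ℕ → State n) : ℝ :=
  ∑ h ∈ Finset.range H, S.stageCost (trajectory Θ π x w h) (π h (trajectory Θ π x w h))

section Cost

variable {Ω : Type*} [MeasurableSpace Ω]

/-- The expected cost `J_1^π(Θ, x)` of an episode with noise `w`. The costs are nonnegative (`Q`
and `R` will be positive definite), so the expectation is taken in `[0, ∞]`. -/
def LQSystem.expCost (S : LQSystem n d) (P : Measure Ω) (w : ℕ → Ω → State n) (H : ℕ)
    (Θ : Param n d) (π : Policy n d) (x : State n) : ENNReal :=
  ∫⁻ ω, ENNReal.ofReal (S.episodeCost H Θ π x (fun h => w h ω)) ∂P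

/-- The optimal expected cost `J_1^*(Θ, x)`: the infimum over all measurable policies. -/
def LQSystem.optCost (S : LQSystem n d) (P : Measure Ω) (w : ℕ → Ω → State n) (H : ℕ)
    (Θ : Param n d) (x : State n) : ENNReal :=
  ⨅ π : {π : Policy n d // ∀ h, Measurable (π h)}, S.expCost P w H Θ π.1 x

end Cost

/-- Riccati iteration, indexed by the number `m` of remaining steps: with steps counted from `0`,
the matrix `P_h(Θ)` of horizon `H` is `S.riccati Θ (H - h)`. -/
def LQSystem.riccati (S : LQSystem n d) (Θ : Param n d) : ℕ → Matrix (Fin n) (Fin n) ℝ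
  | 0 => 0
  | m + 1 =>
      S.Q + (dynA Θ)ᵀ * S.riccati Θ m * dynA Θ
        - (dynA Θ)ᵀ * S.riccati Θ m * dynB Θ * (S.R + (dynB Θ)ᵀ * S.riccati Θ m * dynB Θ)⁻¹
          * (dynB Θ)ᵀ * S.riccati Θ m * dynA Θ

/-- The gain `K_h(Θ) = -(R + Bᵀ P_{h+1}(Θ) B)⁻¹ Bᵀ P_{h+1}(Θ) A`. -/
def LQSystem.gain (S : LQSystem n d) (H : ℕ) (Θ : Param n d) (h : ℕ) : Matrix (Fin d) (Fin n) ℝ :=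
  -((S.R + (dynB Θ)ᵀ * S.riccati Θ (H - (h + 1)) * dynB Θ)⁻¹
      * (dynB Θ)ᵀ * S.riccati Θ (H - (h + 1)) * dynA Θ)

/-- The linear policy `π_h(x) = K_h(Θ) x`. -/
def LQSystem.gainPolicy (S : LQSystem n d) (H : ℕ) (Θ : Param n d) : Policy n d :=
  fun h x => Matrix.toEuclideanLin (S.gain H Θ h) x

/-- The boundedness assumptions on the system (not on the noise and the initial states). -/
structure LQSystem.Bounded (S : LQSystem n d) (H : ℕ) (C CA CB Cw γ : ℝ) : Prop where
  posDef_Q : S.Q.PosDef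
  posDef_R : S.R.PosDef
  star_mem : S.Θstar ∈ paramSet n d
  norm_A_le : opNorm (dynA S.Θstar) ≤ CA
  CA_lt_one : CA < 1
  norm_B_le : opNorm (dynB S.Θstar) ≤ CB
  CB_lt_one : CB < 1
  norm_Q_le : opNorm S.Q ≤ C
  norm_R_le : opNorm S.R ≤ C
  Cw_pos : 0 < Cw
  Cw_lt_one : Cw < 1
  gain_le : ∀ Θ ∈ paramSet n d, ∀ h < H, opNorm (S.gain H Θ h) ≤ γ
  sum_le_one : CA + γ * CB + Cw ≤ 1

/-- The logarithmic factor `ψ = ln (1 + H K / ((n + d) lamMin))`. -/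
def logFactor (n d H K : ℕ) (lamMin : ℝ) : ℝ :=
  Real.log (1 + (H : ℝ) * K / (((n : ℝ) + d) * lamMin))

/-! ### Interaction over several episodes -/

/-- The random data of an interaction. Episodes `k` and steps `h` are counted from `0`: initial
states `x_{k,1}`, noise `w_{k,h}`, regularizers `H_k`, `L_k`, and parameters `Θ̃_k` whose policy is
played in episode `k`. -/
structure Interaction (n d : ℕ) (Ω : Type*) where
  init : ℕ → Ω → State n
  noise : ℕ → ℕ → Ω → State n
  regH : ℕ → Ω → Matrix (Fin n ⊕ Fin d) (Fin n ⊕ Fin d) ℝ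
  regL : ℕ → Ω → Matrix (Fin n ⊕ Fin d) (Fin n) ℝ
  param : ℕ → Ω → Param n d

namespace Interaction

variable {Ω : Type*} (I : Interaction n d Ω) (S : LQSystem n d) (H : ℕ)

/-- The policy `π_k`. -/
def policy (k : ℕ) (ω : Ω) : Policy n d := S.gainPolicy H (I.param k ω)

/-- The state `x_{k,h}` of the true system. -/
def state (k h : ℕ) (ω : Ω) : State n :=
  trajectory S.Θstar (I.policy S H k ω) (I.init k ω) (fun i => I.noise k i ω) h

/-- The control `u_{k,h} = π_{k,h}(x_{k,h})`. -/
def control (k h : ℕ) (ω : Ω) : Control d := I.policy S H k ω h (I.state S H k h ω)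

/-- The matrix `Z_k` whose rows are the vectors `z_{k',h} = [x_{k',h}; u_{k',h}]` of the episodes
before `k`. -/
def Z (k : ℕ) (ω : Ω) : Matrix (Fin k × Fin H) (Fin n ⊕ Fin d) ℝ :=
  Matrix.of fun p => Sum.elim (I.state S H p.1 p.2 ω).ofLp (I.control S H p.1 p.2 ω).ofLp

/-- The matrix whose rows are the next states `x_{k',h+1}` of the episodes before `k`. -/
def Xnext (k : ℕ) (ω : Ω) : Matrix (Fin k × Fin H) (Fin n) ℝ :=
  Matrix.of fun p => (I.state S H p.1 (p.2 + 1) ω).ofLp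

/-- `V_k = Z_kᵀ Z_k + H_k`. -/
def V (k : ℕ) (ω : Ω) : Matrix (Fin n ⊕ Fin d) (Fin n ⊕ Fin d) ℝ :=
  (I.Z S H k ω)ᵀ * I.Z S H k ω + I.regH k ω

/-- `U_k = Z_kᵀ X_k^next + L_k`. -/
def U (k : ℕ) (ω : Ω) : Matrix (Fin n ⊕ Fin d) (Fin n) ℝ :=
  (I.Z S H k ω)ᵀ * I.Xnext S H k ω + I.regL k ω

/-- The estimate `Θ̂_k = V_k⁻¹ U_k`. -/
def estimate (k : ℕ) (ω : Ω) : Param n d := (I.V S H k ω)⁻¹ * I.U S H k ω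

/-- The radius `β_k(α)`. -/
def radius (Cw lamMax lamMin ν α : ℝ) (k : ℕ) (ω : Ω) : ℝ :=
  Cw * √(2 * Real.log (2 / α)
      + n * Real.log (1 + lamMin⁻¹ • ((I.Z S H k ω)ᵀ * I.Z S H k ω)).det)
    + √lamMax + ν

/-- The confidence set `𝒞_k(α)`. -/
def confSet (Cw lamMax lamMin ν α : ℝ) (k : ℕ) (ω : Ω) : Set (Param n d) :=
  {Θ | weightedNorm (I.V S H k ω) (Θ - I.estimate S H k ω)
    ≤ I.radius S H Cw lamMax lamMin ν α k ω}

/-- The bounds on the regularizers of the first `K` episodes, for the outcome `ω`. -/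
def RegularAt (K : ℕ) (lamMax lamMin ν : ℝ) (ω : Ω) : Prop :=
  ∀ k < K, (I.regH k ω).PosDef ∧ opNormZ (I.regH k ω) ≤ lamMax ∧
    opNormZ (I.regH k ω)⁻¹ ≤ 1 / lamMin ∧ weightedNorm (I.regH k ω)⁻¹ (I.regL k ω) ≤ ν

variable [mΩ : MeasurableSpace Ω]

/-- Stochastic structure of an interaction: `ℱ (k * H + h)` is the information available just
before the noise `w_{k,h}` is drawn. Initial states, regularizers and played parameters of an
episode are determined by the information at its start, and may otherwise depend on the past and
on further randomness in any way. -/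
structure Adapted (P : Measure Ω) (ℱ : Filtration ℕ mΩ) (K : ℕ) (Cw : ℝ) : Prop where
  init_measurable : ∀ k < K, Measurable[ℱ (k * H)] (I.init k)
  regH_measurable : ∀ k < K, ∀ i j, Measurable[ℱ (k * H)] (fun ω => I.regH k ω i j)
  regL_measurable : ∀ k < K, ∀ i j, Measurable[ℱ (k * H)] (fun ω => I.regL k ω i j)
  param_measurable : ∀ k < K, ∀ i j, Measurable[ℱ (k * H)] (fun ω => I.param k ω i j)
  noise_measurable : ∀ k < K, ∀ h < H, Measurable[ℱ (k * H + h + 1)] (I.noise k h)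
  noise_indep : ∀ k < K, ∀ h < H,
    Indep (MeasurableSpace.comap (I.noise k h) inferInstance) (ℱ (k * H + h)) P
  noise_mean : ∀ k < K, ∀ h < H, ∫ ω, I.noise k h ω ∂P = 0
  noise_le : ∀ k < K, ∀ h < H, ∀ᵐ ω ∂P, ‖I.noise k h ω‖ ≤ Cw
  init_le : ∀ k < K, ∀ᵐ ω ∂P, ‖I.init k ω‖ ≤ 1

/-- Optimistic choice: in each of the first `K` episodes, unless `𝒞_k(α) ∩ 𝒮` is empty, the
played parameter `Θ̃_k` lies in it and minimizes `J_1^*(·, x_{k,1})` over it up to the tolerance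
`ε` (exactly, if `ε = 0`). -/
def Optimistic (P : Measure Ω) (K : ℕ) (Cw lamMax lamMin ν α ε : ℝ) : Prop :=
  ∀ᵐ ω ∂P, ∀ k < K,
    (I.confSet S H Cw lamMax lamMin ν α k ω ∩ paramSet n d).Nonempty →
      I.param k ω ∈ I.confSet S H Cw lamMax lamMin ν α k ω ∩ paramSet n d ∧
      ∀ Θ ∈ I.confSet S H Cw lamMax lamMin ν α k ω ∩ paramSet n d,
        S.optCost P (I.noise k) H (I.param k ω) (I.init k ω)
          ≤ S.optCost P (I.noise k) H Θ (I.init k ω) + ENNReal.ofReal ε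

/-- The cumulative regret `∑_k (J_1^{π_k}(Θ_*, x_{k,1}) - J_1^*(Θ_*, x_{k,1}))` of the first `K`
episodes. -/
def regret (P : Measure Ω) (K : ℕ) (ω : Ω) : ℝ :=
  ∑ k ∈ Finset.range K,
    ((S.expCost P (I.noise k) H S.Θstar (I.policy S H k ω) (I.init k ω)).toReal
      - (S.optCost P (I.noise k) H S.Θstar (I.init k ω)).toReal)

end Interaction

end LQControl

end

/-!
The proof is optimism with confidence ellipsoids. Its one delicate point is the dependence on the
horizon: the model `Θ̃` played in an episode need not be stable, so its optimal cost-to-go `P_m(Θ̃)`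
is only known to be of order `m`, whereas the true system under the gains of `Θ̃` contracts by
`1 - C_w`, since `C_A + γ C_B ≤ 1 - C_w`.

*One episode.* Let `T` be the closed loop of the true system and `T̃` that of the model, both under
the gains of `Θ̃`. The mixed cost `N_m(x, y)` pairs, over `m` remaining steps, the state of `T̃`
started in `x` with the state of `T` started in `y`, in the polarized stage cost. By Cauchy-Schwarz
it is at most the geometric mean of the model's cost-to-go at `x`, of order `H ‖x‖²`, and of the
true cost-to-go at `y`, of order `‖y‖²`; so a perturbation of the first argument costs a factor `√H`
and not `H` (`two_mul_modelMixedCost_le`). With the true cost-to-go `G_m`, the potential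
`2 N_m - G_m` lies below the model's cost-to-go, and along the true system it decreases by the stage
cost up to `2 N(T x - T̃ x, T x)`. Telescoping gives `expCost_star_toReal_le`: the cost of the true
system exceeds the optimal cost of the model, which is bounded below by `le_expCost`, by at most a
constant times `√H` times the expected sum of the prediction errors `‖T x - T̃ x‖`. By optimism this
bounds the regret of the episode (`episode_regret_le`).

*Confidence.* As the noise is bounded, `exp` of half of
`tr (Sᵀ V⁻¹ S) / C_w² - log (det V / det V₀)`, with `V` the regularized Gram matrix and `S` the
correlation matrix of regressors and noise, is a supermartingale: one step is a rank one update, to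
which Hoeffding's lemma applies. Ville's inequality makes this uniform in time
(`measure_exists_selfNormLog_le`), and the bounds on the regularizers transfer it to the confidence
sets (`star_mem_confSet`).

*Summation.* The expected prediction errors are compared with the realized ones by a multiplicative
concentration inequality (`measure_sum_integral_freeze_gt_le`), which loses a factor `2` and a term
of the size of one episode. The realized errors are summed by the elliptical potential argument
(`sum_error_le`); since the parameter is frozen during an episode, the episodes over which the Gram
determinant more than doubles are few and are bounded trivially. With the factor `√H` of
the first step, both additional terms are of order `H√H` up to logarithms, hence absorbed when
`H ≤ K`. If `K < H`, the trivial bound on the cost of an episode suffices.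
-/

noncomputable section

namespace LQControl

/-! ### Quadratic forms and rank one updates -/

section MatrixInequalities

variable {ι κ : Type*} [Fintype ι] [Fintype κ]

/-- The quadratic form `xᵀ M x` of a square matrix. -/
def quad (M : Matrix ι ι ℝ) (x : ι → ℝ) : ℝ := x ⬝ᵥ M *ᵥ x

lemma quad_nonneg {M : Matrix ι ι ℝ} (hM : M.PosSemidef) (x : ι → ℝ) : 0 ≤ quad M x := by
  simpa [quad] using hM.dotProduct_mulVec_nonneg x

lemma quad_add_matrix (M N : Matrix ι ι ℝ) (x : ι → ℝ) :
    quad (M + N) x = quad M x + quad N x := by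
  simp [quad, Matrix.add_mulVec]

lemma quad_vecMulVec (z x : ι → ℝ) : quad (Matrix.vecMulVec z z) x = (x ⬝ᵥ z) ^ 2 := by
  rw [quad, Matrix.vecMulVec_mulVec, dotProduct_smul, MulOpposite.smul_eq_mul_unop,
    MulOpposite.unop_op, dotProduct_comm z x, sq]

lemma dotProduct_mulVec_symm {M : Matrix ι ι ℝ} (hM : M.IsHermitian) (x y : ι → ℝ) :
    x ⬝ᵥ M *ᵥ y = y ⬝ᵥ M *ᵥ x := by
  have hT : Mᵀ = M := by simpa using hM.eq
  rw [Matrix.dotProduct_mulVec, ← Matrix.mulVec_transpose, hT, dotProduct_comm]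

/-- Cauchy-Schwarz for the form of a positive semidefinite matrix. -/
lemma sq_dotProduct_mulVec_le {M : Matrix ι ι ℝ} (hM : M.PosSemidef) (x y : ι → ℝ) :
    (x ⬝ᵥ M *ᵥ y) ^ 2 ≤ quad M x * quad M y := by
  classical
  have h := LinearMap.BilinForm.apply_mul_apply_le_of_forall_zero_le (Matrix.toBilin' M)
    (fun v => by rw [Matrix.toBilin'_apply']; exact quad_nonneg hM v) x y
  simp only [Matrix.toBilin'_apply'] at h
  rw [dotProduct_mulVec_symm hM.isHermitian y x, ← sq] at h
  exact h

lemma posDef_add_vecMulVec {V : Matrix ι ι ℝ} (hV : V.PosDef) (z : ι → ℝ) :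
    (V + Matrix.vecMulVec z z).PosDef :=
  hV.add_posSemidef (by simpa using Matrix.posSemidef_vecMulVec_self_star z)

variable [DecidableEq ι]

lemma mulVec_inv_mulVec {V : Matrix ι ι ℝ} (hV : V.PosDef) (z : ι → ℝ) :
    V *ᵥ (V⁻¹ *ᵥ z) = z := by
  rw [Matrix.mulVec_mulVec, Matrix.mul_nonsing_inv _ ((Matrix.isUnit_iff_isUnit_det _).1 hV.isUnit),
    Matrix.one_mulVec]

/-- Cauchy-Schwarz for the dual pair of norms given by `V` and `V⁻¹`. -/
lemma sq_dotProduct_le_quad_mul_quad_inv {V : Matrix ι ι ℝ} (hV : V.PosDef) (x z : ι → ℝ) :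
    (x ⬝ᵥ z) ^ 2 ≤ quad V x * quad V⁻¹ z := by
  have h := sq_dotProduct_mulVec_le hV.posSemidef x (V⁻¹ *ᵥ z)
  rw [mulVec_inv_mulVec hV] at h
  have : quad V (V⁻¹ *ᵥ z) = quad V⁻¹ z := by
    rw [quad, quad, mulVec_inv_mulVec hV, dotProduct_comm]
  rwa [this] at h

/-- Inversion reverses the order of positive definite matrices. -/
lemma quad_inv_le_of_quad_le {V V' : Matrix ι ι ℝ} (hV : V.PosDef) (hV' : V'.PosDef) {c : ℝ}
    (hle : ∀ x, quad V' x ≤ c * quad V x) (z : ι → ℝ) :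
    quad V⁻¹ z ≤ c * quad V'⁻¹ z := by
  have h1 := sq_dotProduct_le_quad_mul_quad_inv hV' (V⁻¹ *ᵥ z) z
  have h2 : quad V (V⁻¹ *ᵥ z) = quad V⁻¹ z := by
    rw [quad, quad, mulVec_inv_mulVec hV, dotProduct_comm]
  have h3 : (V⁻¹ *ᵥ z) ⬝ᵥ z = quad V⁻¹ z := by rw [quad, dotProduct_comm]
  have h0 := quad_nonneg hV.posSemidef.inv z
  have h0' := quad_nonneg hV'.posSemidef.inv z
  have h4 := hle (V⁻¹ *ᵥ z)
  rw [h2] at h4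
  rw [h3] at h1
  rcases h0.eq_or_lt with h | h
  · have h5 := quad_nonneg hV'.posSemidef (V⁻¹ *ᵥ z)
    by_cases hz : z = 0
    · simp [hz, quad]
    · have := hV.inv.dotProduct_mulVec_pos hz
      simp only [star_trivial] at this
      exact absurd h (ne_of_lt this)
  · have h6 : quad V⁻¹ z ^ 2 ≤ (c * quad V⁻¹ z) * quad V'⁻¹ z :=
      h1.trans (mul_le_mul_of_nonneg_right h4 h0')
    nlinarith

lemma det_add_vecMulVec {V : Matrix ι ι ℝ} (hV : V.PosDef) (z : ι → ℝ) :
    (V + Matrix.vecMulVec z z).det = V.det * (1 + quad V⁻¹ z) := by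
  rw [Matrix.vecMulVec_eq Unit, Matrix.det_add_replicateCol_mul_replicateRow
    ((Matrix.isUnit_iff_isUnit_det _).1 hV.isUnit)]
  congr 1
  rw [Matrix.det_unique, Matrix.add_apply, Matrix.one_apply_eq, quad]
  congr 1
  rw [Matrix.mul_assoc, Matrix.mul_apply]
  rfl

/-- A rank one update `V + z zᵀ` is at most `1 + zᵀ V⁻¹ z` times `V`. -/
lemma quad_inv_le_mul_quad_inv_add_vecMulVec {V : Matrix ι ι ℝ} (hV : V.PosDef) (z y : ι → ℝ) :
    quad V⁻¹ y ≤ (1 + quad V⁻¹ z) * quad (V + Matrix.vecMulVec z z)⁻¹ y := by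
  refine quad_inv_le_of_quad_le hV (posDef_add_vecMulVec hV z) (fun x => ?_) y
  rw [quad_add_matrix, quad_vecMulVec]
  have := sq_dotProduct_le_quad_mul_quad_inv hV x z
  nlinarith

/-- How `trace (Sᵀ V⁻¹ S)` changes when `z zᵀ` is added to `V` and `z wᵀ` to `S`; here
`a = Sᵀ V⁻¹ z`. -/
lemma trace_inv_rank_one_update {V : Matrix ι ι ℝ} (hV : V.PosDef) (S : Matrix ι κ ℝ)
    (z : ι → ℝ) (w : κ → ℝ) :
    ((S + Matrix.vecMulVec z w)ᵀ * (V + Matrix.vecMulVec z z)⁻¹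
        * (S + Matrix.vecMulVec z w)).trace =
      (Sᵀ * V⁻¹ * S).trace
        + (2 * (((V⁻¹ *ᵥ z) ᵥ* S) ⬝ᵥ w) - ((V⁻¹ *ᵥ z) ᵥ* S) ⬝ᵥ ((V⁻¹ *ᵥ z) ᵥ* S)
            + quad V⁻¹ z * (w ⬝ᵥ w)) / (1 + quad V⁻¹ z) := by
  set u := V⁻¹ *ᵥ z with hu
  set a := u ᵥ* S with ha
  set q := quad V⁻¹ z with hq
  have hq0 : 0 ≤ q := quad_nonneg hV.posSemidef.inv z
  have hq1 : (1 + q) ≠ 0 := by positivity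
  set b : κ → ℝ := (1 + q)⁻¹ • (w - a) with hb
  have hdet := (Matrix.isUnit_iff_isUnit_det _).1 hV.isUnit
  have hV' := posDef_add_vecMulVec hV z
  have hdet' := (Matrix.isUnit_iff_isUnit_det _).1 hV'.isUnit
  have hzu : z ⬝ᵥ u = q := rfl
  have hzY : z ᵥ* (V⁻¹ * S) = a := by
    rw [← Matrix.vecMul_vecMul]
    congr 1
    rw [hu, ← Matrix.mulVec_transpose]
    congr 1
    simpa using hV.inv.isHermitian.eq
  -- `V'⁻¹ S' = V⁻¹ S + u bᵀ`, by multiplication with `V'`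
  have key : (V + Matrix.vecMulVec z z)⁻¹ * (S + Matrix.vecMulVec z w)
      = V⁻¹ * S + Matrix.vecMulVec u b := by
    have : (V + Matrix.vecMulVec z z) * (V⁻¹ * S + Matrix.vecMulVec u b)
        = S + Matrix.vecMulVec z w := by
      rw [Matrix.add_mul, Matrix.mul_add, Matrix.mul_add, ← Matrix.mul_assoc,
        Matrix.mul_nonsing_inv _ hdet, Matrix.one_mul, Matrix.mul_vecMulVec, hu,
        mulVec_inv_mulVec hV, ← hu, Matrix.vecMulVec_mul, hzY, Matrix.vecMulVec_mul_vecMulVec,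
        hzu, add_assoc, ← Matrix.vecMulVec_add, ← Matrix.vecMulVec_add]
      congr 2
      ext i
      simp only [hb, Pi.add_apply, Pi.smul_apply, Pi.sub_apply, smul_eq_mul]
      field_simp
      ring
    rw [← this, ← Matrix.mul_assoc, Matrix.nonsing_inv_mul _ hdet', Matrix.one_mul]
  rw [Matrix.mul_assoc, key, Matrix.transpose_add, Matrix.transpose_vecMulVec, Matrix.add_mul,
    Matrix.mul_add, Matrix.mul_add, Matrix.trace_add, Matrix.trace_add, Matrix.trace_add,
    Matrix.mul_vecMulVec, Matrix.vecMulVec_mul, hzY, Matrix.vecMulVec_mul_vecMulVec, hzu,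
    Matrix.trace_vecMulVec, Matrix.trace_vecMulVec, Matrix.trace_vecMulVec, Matrix.mulVec_transpose,
    ← ha, ← Matrix.mul_assoc, hb]
  simp only [dotProduct_smul, smul_eq_mul, dotProduct_sub]
  rw [dotProduct_comm w a]
  field_simp
  ring

/-- The arithmetic-geometric mean inequality for the eigenvalues. -/
lemma log_det_le_card_mul_log {M : Matrix ι ι ℝ} (hM : M.PosDef) {c : ℝ} (hc : 0 < c)
    (htr : M.trace ≤ Fintype.card ι * c) : Real.log M.det ≤ Fintype.card ι * Real.log c := by
  have hpos : ∀ i, 0 < hM.isHermitian.eigenvalues i := hM.eigenvalues_pos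
  have hdet := hM.isHermitian.det_eq_prod_eigenvalues
  have htr' := hM.isHermitian.trace_eq_sum_eigenvalues
  simp only [RCLike.ofReal_real_eq_id, id_eq] at hdet htr'
  rw [hdet, Real.log_prod (fun i _ => (hpos i).ne')]
  have h1 : ∀ i ∈ Finset.univ, Real.log (hM.isHermitian.eigenvalues i)
      ≤ Real.log c + (hM.isHermitian.eigenvalues i / c - 1) := by
    intro i _
    have := Real.log_le_sub_one_of_pos (div_pos (hpos i) hc)
    rw [Real.log_div (hpos i).ne' hc.ne'] at this
    linarith
  refine (Finset.sum_le_sum h1).trans ?_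
  rw [Finset.sum_add_distrib, Finset.sum_sub_distrib, ← Finset.sum_div, ← htr']
  simp only [Finset.sum_const, Finset.card_univ, nsmul_eq_mul, mul_one]
  have : M.trace / c ≤ Fintype.card ι := by rw [div_le_iff₀ hc]; exact htr
  linarith

end MatrixInequalities

/-! ### The weighted norm -/

section WeightedNorm

variable {ι κ : Type*} [Fintype ι] [Fintype κ]

lemma trace_transpose_mul_mul_eq_sum_quad (M : Matrix ι ι ℝ) (A : Matrix ι κ ℝ) :
    (Aᵀ * M * A).trace = ∑ j, quad M (fun i => A i j) := by
  simp only [Matrix.trace, Matrix.diag, quad]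
  refine Finset.sum_congr rfl fun j _ => ?_
  rw [Matrix.mul_assoc, Matrix.mul_apply]
  rfl

lemma trace_transpose_mul_mul_nonneg {M : Matrix ι ι ℝ} (hM : M.PosSemidef) (A : Matrix ι κ ℝ) :
    0 ≤ (Aᵀ * M * A).trace := by
  rw [trace_transpose_mul_mul_eq_sum_quad]
  exact Finset.sum_nonneg fun j _ => quad_nonneg hM _

lemma weightedNorm_sq {M : Matrix ι ι ℝ} (hM : M.PosSemidef) (A : Matrix ι κ ℝ) :
    weightedNorm M A ^ 2 = ∑ j, quad M (fun i => A i j) := by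
  rw [weightedNorm, Real.sq_sqrt (trace_transpose_mul_mul_nonneg hM A),
    trace_transpose_mul_mul_eq_sum_quad]

lemma weightedNorm_nonneg (M : Matrix ι ι ℝ) (A : Matrix ι κ ℝ) : 0 ≤ weightedNorm M A :=
  Real.sqrt_nonneg _

lemma weightedNorm_neg (M : Matrix ι ι ℝ) (A : Matrix ι κ ℝ) :
    weightedNorm M (-A) = weightedNorm M A := by
  simp [weightedNorm]

lemma weightedNorm_add_le {M : Matrix ι ι ℝ} (hM : M.PosSemidef) (A B : Matrix ι κ ℝ) :
    weightedNorm M (A + B) ≤ weightedNorm M A + weightedNorm M B := by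
  classical
  have hT : Mᵀ = M := by simpa using hM.isHermitian.eq
  have hcs : (Aᵀ * M * B).trace ^ 2 ≤ (Aᵀ * M * A).trace * (Bᵀ * M * B).trace := by
    let F : LinearMap.BilinForm ℝ (Matrix ι κ ℝ) :=
      LinearMap.mk₂ ℝ (fun A B => (Aᵀ * M * B).trace)
        (by intros; simp [Matrix.add_mul]) (by intros; simp)
        (by intros; simp [Matrix.mul_add]) (by intros; simp)
    have h := LinearMap.BilinForm.apply_mul_apply_le_of_forall_zero_le F
      (fun A => trace_transpose_mul_mul_nonneg hM A) A B
    change (Aᵀ * M * B).trace * (Bᵀ * M * A).trace ≤ _ at h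
    have hsymm : (Bᵀ * M * A).trace = (Aᵀ * M * B).trace := by
      rw [← Matrix.trace_transpose]
      simp [Matrix.transpose_mul, hT, Matrix.mul_assoc]
    rwa [hsymm, ← sq] at h
  have hsymm : (Bᵀ * M * A).trace = (Aᵀ * M * B).trace := by
    rw [← Matrix.trace_transpose]
    simp [Matrix.transpose_mul, hT, Matrix.mul_assoc]
  have hA := trace_transpose_mul_mul_nonneg hM A
  have hB := trace_transpose_mul_mul_nonneg hM B
  unfold weightedNorm
  apply Real.sqrt_le_iff.2
  refine ⟨by positivity, ?_⟩
  have e : ((A + B)ᵀ * M * (A + B)).trace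
      = (Aᵀ * M * A).trace + 2 * (Aᵀ * M * B).trace + (Bᵀ * M * B).trace := by
    simp only [Matrix.transpose_add, Matrix.add_mul, Matrix.mul_add, Matrix.trace_add, hsymm]
    ring
  rw [e, add_sq, Real.sq_sqrt hA, Real.sq_sqrt hB]
  have h2 : (Aᵀ * M * B).trace ≤ √((Aᵀ * M * A).trace) * √((Bᵀ * M * B).trace) := by
    rw [← Real.sqrt_mul hA]
    exact Real.le_sqrt_of_sq_le hcs
  linarith

lemma weightedNorm_le_of_quad_le {M N : Matrix ι ι ℝ}
    (h : ∀ x, quad M x ≤ quad N x) (A : Matrix ι κ ℝ) : weightedNorm M A ≤ weightedNorm N A := by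
  unfold weightedNorm
  refine Real.sqrt_le_sqrt ?_
  rw [trace_transpose_mul_mul_eq_sum_quad, trace_transpose_mul_mul_eq_sum_quad]
  exact Finset.sum_le_sum fun j _ => h _

variable [DecidableEq ι]

lemma weightedNorm_inv_mul {V : Matrix ι ι ℝ} (hV : V.PosDef) (Y : Matrix ι κ ℝ) :
    weightedNorm V (V⁻¹ * Y) = weightedNorm V⁻¹ Y := by
  have hT : (V⁻¹)ᵀ = V⁻¹ := by simpa using hV.inv.isHermitian.eq
  unfold weightedNorm
  congr 2
  rw [Matrix.transpose_mul, hT, Matrix.mul_assoc, Matrix.mul_assoc, ← Matrix.mul_assoc V,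
    Matrix.mul_nonsing_inv _ ((Matrix.isUnit_iff_isUnit_det _).1 hV.isUnit), Matrix.one_mul,
    Matrix.mul_assoc]

lemma weightedNorm_inv_self_mul {V : Matrix ι ι ℝ} (hV : V.PosDef) (Y : Matrix ι κ ℝ) :
    weightedNorm V⁻¹ (V * Y) = weightedNorm V Y := by
  rw [← weightedNorm_inv_mul hV, ← Matrix.mul_assoc,
    Matrix.nonsing_inv_mul _ ((Matrix.isUnit_iff_isUnit_det _).1 hV.isUnit), Matrix.one_mul]

/-- `‖Aᵀ z‖ ≤ ‖A‖_V ‖z‖_{V⁻¹}`, squared. -/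
lemma sum_sq_dotProduct_le {V : Matrix ι ι ℝ} (hV : V.PosDef) (A : Matrix ι κ ℝ) (z : ι → ℝ) :
    ∑ j, ((fun i => A i j) ⬝ᵥ z) ^ 2 ≤ weightedNorm V A ^ 2 * quad V⁻¹ z := by
  rw [weightedNorm_sq hV.posSemidef, Finset.sum_mul]
  exact Finset.sum_le_sum fun j _ => sq_dotProduct_le_quad_mul_quad_inv hV _ _

end WeightedNorm

/-! ### Operator and Frobenius norms of system matrices -/

section OperatorNorm

open scoped Matrix.Norms.L2Operator in
lemma norm_toEuclideanLin_le {m n : ℕ} (M : Matrix (Fin m) (Fin n) ℝ)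
    (x : EuclideanSpace ℝ (Fin n)) : ‖Matrix.toEuclideanLin M x‖ ≤ opNorm M * ‖x‖ :=
  Matrix.l2_opNorm_mulVec M x

lemma dotProduct_ofLp_self {ι : Type*} [Fintype ι] (x : EuclideanSpace ℝ ι) :
    x.ofLp ⬝ᵥ x.ofLp = ‖x‖ ^ 2 := by
  rw [EuclideanSpace.real_norm_sq_eq]
  simp [dotProduct, sq]

lemma dotProduct_ofLp {ι : Type*} [Fintype ι] (x y : EuclideanSpace ℝ ι) :
    x.ofLp ⬝ᵥ y.ofLp = inner ℝ x y := by
  simp [PiLp.inner_apply, dotProduct, mul_comm]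

lemma quad_le_opNorm {n : ℕ} (M : Matrix (Fin n) (Fin n) ℝ) (x : EuclideanSpace ℝ (Fin n)) :
    quad M x.ofLp ≤ opNorm M * ‖x‖ ^ 2 := by
  have h : quad M x.ofLp = inner ℝ x (Matrix.toEuclideanLin M x) := by
    rw [← dotProduct_ofLp]; rfl
  rw [h]
  refine (real_inner_le_norm _ _).trans ?_
  have := norm_toEuclideanLin_le M x
  have h0 := norm_nonneg x
  nlinarith

open scoped Matrix.Norms.L2Operator in
lemma quad_le_opNormZ {n d : ℕ} (M : Matrix (Fin n ⊕ Fin d) (Fin n ⊕ Fin d) ℝ)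
    (x : Fin n ⊕ Fin d → ℝ) : quad M x ≤ opNormZ M * (x ⬝ᵥ x) := by
  set y : EuclideanSpace ℝ (Fin n ⊕ Fin d) := WithLp.toLp 2 x
  have h : quad M x = inner ℝ y (Matrix.toEuclideanLin M y) := by
    rw [← dotProduct_ofLp]; rfl
  have h2 : x ⬝ᵥ x = ‖y‖ ^ 2 := dotProduct_ofLp_self y
  rw [h, h2]
  refine (real_inner_le_norm _ _).trans ?_
  have : ‖Matrix.toEuclideanLin M y‖ ≤ ‖M‖ * ‖y‖ := Matrix.l2_opNorm_mulVec M y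
  have h0 := norm_nonneg y
  unfold opNormZ
  nlinarith

lemma opNorm_nonneg {m n : ℕ} (M : Matrix (Fin m) (Fin n) ℝ) : 0 ≤ opNorm M := by
  open scoped Matrix.Norms.L2Operator in exact norm_nonneg M

lemma frobNorm_sq {ι κ : Type*} [Fintype ι] [Fintype κ] (A : Matrix ι κ ℝ) :
    frobNorm A ^ 2 = ∑ j, ∑ i, A i j ^ 2 := by
  classical
  have h : frobNorm A = weightedNorm 1 A := by simp [frobNorm, weightedNorm]
  rw [h, weightedNorm_sq Matrix.PosSemidef.one]
  simp [quad, dotProduct, sq]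

lemma frobNorm_nonneg {ι κ : Type*} [Fintype ι] [Fintype κ] (A : Matrix ι κ ℝ) :
    0 ≤ frobNorm A := Real.sqrt_nonneg _

lemma frobNorm_sub_le {ι κ : Type*} [Fintype ι] [Fintype κ] (A B : Matrix ι κ ℝ) :
    frobNorm (A - B) ≤ frobNorm A + frobNorm B := by
  classical
  have h : ∀ A : Matrix ι κ ℝ, frobNorm A = weightedNorm 1 A := by simp [frobNorm, weightedNorm]
  rw [h, h, h, sub_eq_add_neg, ← weightedNorm_neg 1 B]
  exact weightedNorm_add_le Matrix.PosSemidef.one _ _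

/-- The state-control vector `z = [x; u]`. -/
def joinVec {n d : ℕ} (x : State n) (u : Control d) : Fin n ⊕ Fin d → ℝ := Sum.elim x.ofLp u.ofLp

lemma joinVec_dotProduct_self {n d : ℕ} (x : State n) (u : Control d) :
    joinVec x u ⬝ᵥ joinVec x u = ‖x‖ ^ 2 + ‖u‖ ^ 2 := by
  rw [← dotProduct_ofLp_self, ← dotProduct_ofLp_self]
  simp [joinVec, dotProduct]

/-- The noiseless dynamics `A x + B u` are `Θᵀ z`. -/
lemma dyn_apply {n d : ℕ} (Θ : Param n d) (x : State n) (u : Control d) (j : Fin n) :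
    (Matrix.toEuclideanLin (dynA Θ) x + Matrix.toEuclideanLin (dynB Θ) u).ofLp j
      = (fun i => Θ i j) ⬝ᵥ joinVec x u := by
  simp [joinVec, dotProduct, Matrix.toLpLin_apply, Matrix.mulVec, dynA, dynB,
    Matrix.toRows₁, Matrix.toRows₂]

lemma norm_sq_dyn_sub {n d : ℕ} (Θ Θ' : Param n d) (x : State n) (u : Control d) :
    ‖(Matrix.toEuclideanLin (dynA Θ) x + Matrix.toEuclideanLin (dynB Θ) u)
      - (Matrix.toEuclideanLin (dynA Θ') x + Matrix.toEuclideanLin (dynB Θ') u)‖ ^ 2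
      = ∑ j, ((fun i => (Θ - Θ') i j) ⬝ᵥ joinVec x u) ^ 2 := by
  rw [EuclideanSpace.real_norm_sq_eq]
  refine Finset.sum_congr rfl fun j _ => ?_
  rw [PiLp.sub_apply, dyn_apply, dyn_apply, ← sub_dotProduct]
  rfl

lemma sum_sq_dotProduct_le_frobNorm {ι κ : Type*} [Fintype ι] [Fintype κ]
    (A : Matrix ι κ ℝ) (z : ι → ℝ) :
    ∑ j, ((fun i => A i j) ⬝ᵥ z) ^ 2 ≤ frobNorm A ^ 2 * (z ⬝ᵥ z) := by
  rw [frobNorm_sq, Finset.sum_mul]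
  refine Finset.sum_le_sum fun j _ => ?_
  have := Finset.sum_mul_sq_le_sq_mul_sq Finset.univ (fun i => A i j) z
  simpa [dotProduct, sq] using this

/-- The spectral norm of `A` is at most the Frobenius norm of `Θ`. -/
lemma norm_dynA_le {n d : ℕ} {Θ : Param n d} (h : frobNorm Θ ≤ 1) (x : State n) :
    ‖Matrix.toEuclideanLin (dynA Θ) x‖ ≤ ‖x‖ := by
  refine le_of_sq_le_sq ?_ (norm_nonneg x)
  have h1 : ‖Matrix.toEuclideanLin (dynA Θ) x‖ ^ 2
      = ∑ j, ((fun i => Θ i j) ⬝ᵥ joinVec x (0 : Control d)) ^ 2 := by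
    rw [EuclideanSpace.real_norm_sq_eq]
    refine Finset.sum_congr rfl fun j _ => ?_
    rw [← dyn_apply]; simp
  rw [h1]
  refine (sum_sq_dotProduct_le_frobNorm _ _).trans ?_
  rw [joinVec_dotProduct_self]
  have := frobNorm_nonneg Θ
  have h2 : frobNorm Θ ^ 2 ≤ 1 := by nlinarith
  simp only [norm_zero]
  nlinarith [sq_nonneg ‖x‖]

end OperatorNorm

/-! ### The mixed cost of two linear systems -/

section MixedCost

variable {E : Type*} [AddCommGroup E] [Module ℝ E]

/-- The mixed cost of two linear systems: with `m` steps remaining, the sum over these steps of the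
stage form `F` between the state of the system `S` started in the first argument and the state of
the system `T` started in the second. For `S = T` this is the polarized cost-to-go. -/
def mixedCost (F : ℕ → LinearMap.BilinForm ℝ E) (S T : ℕ → E →ₗ[ℝ] E) :
    ℕ → LinearMap.BilinForm ℝ E
  | 0 => 0
  | m + 1 => F m + (mixedCost F S T m).compl₁₂ (S m) (T m)

variable {F : ℕ → LinearMap.BilinForm ℝ E} {S T : ℕ → E →ₗ[ℝ] E}

@[simp] lemma mixedCost_zero (x y : E) : mixedCost F S T 0 x y = 0 := rfl

lemma mixedCost_succ (m : ℕ) (x y : E) :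
    mixedCost F S T (m + 1) x y = F m x y + mixedCost F S T m (S m x) (T m y) := rfl

/-- Cauchy-Schwarz over all remaining steps: the mixed cost is controlled by the costs of both
systems. -/
lemma two_mul_mixedCost_le (hF : ∀ m x, 0 ≤ F m x x) (hsymm : ∀ m x y, F m x y = F m y x)
    {s : ℝ} (hs : 0 < s) (m : ℕ) (x y : E) :
    2 * mixedCost F S T m x y ≤ s * mixedCost F S S m x x + s⁻¹ * mixedCost F T T m y y := by
  induction m generalizing x y with
  | zero => simp
  | succ m ih =>
    simp only [mixedCost_succ]
    have h := hF m (s • x - y)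
    simp only [map_sub, map_smul, LinearMap.sub_apply, LinearMap.smul_apply, smul_eq_mul,
      hsymm m y x] at h
    have h2 : 2 * F m x y ≤ s * F m x x + s⁻¹ * F m y y := by
      have h3 : 0 ≤ s⁻¹ * (s * (s * F m x x - F m x y) - (s * F m x y - F m y y)) :=
        mul_nonneg (inv_nonneg.2 hs.le) h
      have h4 : s⁻¹ * (s * (s * F m x x - F m x y) - (s * F m x y - F m y y))
          = s * F m x x + s⁻¹ * F m y y - 2 * F m x y := by
        field_simp; ring
      linarith
    linarith [ih (S m x) (T m y)]

/-- The quadratic form `2 N - P` of the mixed cost `N` and the cost `P` of `T`. It lies below the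
cost-to-go of `S`, and along the system `T` it changes by the stage cost, up to an error that is
linear in the difference of the two systems. -/
def potential (F : ℕ → LinearMap.BilinForm ℝ E) (S T : ℕ → E →ₗ[ℝ] E) (m : ℕ) :
    LinearMap.BilinForm ℝ E :=
  (2 : ℝ) • mixedCost F S T m - mixedCost F T T m

lemma potential_apply (m : ℕ) (x y : E) :
    potential F S T m x y = 2 * mixedCost F S T m x y - mixedCost F T T m x y := rfl

lemma potential_le (hF : ∀ m x, 0 ≤ F m x x) (hsymm : ∀ m x y, F m x y = F m y x) (m : ℕ) (x : E) :
    potential F S T m x x ≤ mixedCost F S S m x x := by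
  have := two_mul_mixedCost_le (S := S) (T := T) hF hsymm one_pos m x x
  rw [potential_apply]
  simp only [inv_one, one_mul] at this
  linarith

lemma potential_succ (m : ℕ) (x : E) :
    potential F S T (m + 1) x x = F m x x + potential F S T m (T m x) (T m x)
      - 2 * mixedCost F S T m (T m x - S m x) (T m x) := by
  simp only [potential_apply, mixedCost_succ, map_sub, LinearMap.sub_apply]
  ring

end MixedCost

/-! ### The Riccati iteration -/

section Riccati

variable {n d : ℕ} (S : LQSystem n d) (Θ : Param n d)

/-- The gain when `m + 1` steps remain. -/
def LQSystem.gainAt (m : ℕ) : Matrix (Fin d) (Fin n) ℝ :=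
  -((S.R + (dynB Θ)ᵀ * S.riccati Θ m * dynB Θ)⁻¹ * (dynB Θ)ᵀ * S.riccati Θ m * dynA Θ)

lemma gain_eq_gainAt (H h : ℕ) : S.gain H Θ h = S.gainAt Θ (H - (h + 1)) := rfl

lemma quad_transpose_mul_mul {ι κ : Type*} [Fintype ι] [Fintype κ] (M : Matrix ι ι ℝ)
    (A : Matrix ι κ ℝ) (x : κ → ℝ) : quad (Aᵀ * M * A) x = quad M (A *ᵥ x) := by
  rw [quad, quad, ← Matrix.mulVec_mulVec, ← Matrix.mulVec_mulVec, Matrix.dotProduct_mulVec,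
    ← Matrix.mulVec_transpose, Matrix.transpose_transpose]

/-- Completion of the square in one step of the Riccati iteration. -/
lemma riccati_step_matrix {Q P : Matrix (Fin n) (Fin n) ℝ} {R : Matrix (Fin d) (Fin d) ℝ}
    (A : Matrix (Fin n) (Fin n) ℝ) (B : Matrix (Fin n) (Fin d) ℝ)
    (hP : P.PosSemidef) (hR : R.PosDef) (x : Fin n → ℝ) (u : Fin d → ℝ) :
    quad Q x + quad R u + quad P (A *ᵥ x + B *ᵥ u)
      = quad (Q + Aᵀ * P * A - Aᵀ * P * B * (R + Bᵀ * P * B)⁻¹ * Bᵀ * P * A) x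
        + quad (R + Bᵀ * P * B) (u - (-((R + Bᵀ * P * B)⁻¹ * Bᵀ * P * A)) *ᵥ x) := by
  have hG : (R + Bᵀ * P * B).PosDef :=
    hR.add_posSemidef (by simpa using hP.conjTranspose_mul_mul_same B)
  set G := R + Bᵀ * P * B with hGdef
  set f : Fin d → ℝ := (Bᵀ * P * A) *ᵥ x with hf
  set g : Fin d → ℝ := G⁻¹ *ᵥ f with hg
  have hPT : Pᵀ = P := by simpa using hP.isHermitian.eq
  have hGg : G *ᵥ g = f := mulVec_inv_mulVec hG f
  have e1 : u - (-(G⁻¹ * Bᵀ * P * A)) *ᵥ x = u + g := by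
    rw [Matrix.neg_mulVec, sub_neg_eq_add, hg, hf, Matrix.mulVec_mulVec]
    simp [Matrix.mul_assoc]
  have e2 : quad G (u + g) = quad G u + 2 * (u ⬝ᵥ f) + g ⬝ᵥ f := by
    simp only [quad, Matrix.mulVec_add, add_dotProduct, dotProduct_add, hGg]
    rw [dotProduct_mulVec_symm hG.isHermitian g u, hGg]
    ring
  have e3 : quad G u = quad R u + quad P (B *ᵥ u) := by
    rw [hGdef, quad_add_matrix, quad_transpose_mul_mul]
  have e4 : quad (Q + Aᵀ * P * A - Aᵀ * P * B * G⁻¹ * Bᵀ * P * A) x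
      = quad Q x + quad P (A *ᵥ x) - g ⬝ᵥ f := by
    have : quad (Q + Aᵀ * P * A - Aᵀ * P * B * G⁻¹ * Bᵀ * P * A) x
        = quad (Q + Aᵀ * P * A) x - x ⬝ᵥ ((Aᵀ * P * B * G⁻¹ * Bᵀ * P * A) *ᵥ x) := by
      simp [quad, Matrix.sub_mulVec]
    rw [this, quad_add_matrix, quad_transpose_mul_mul]
    congr 1
    have e5 : Aᵀ * P * B * G⁻¹ * Bᵀ * P * A = (Bᵀ * P * A)ᵀ * (G⁻¹ * (Bᵀ * P * A)) := by
      simp [Matrix.transpose_mul, hPT, Matrix.mul_assoc]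
    rw [e5, ← Matrix.mulVec_mulVec, ← Matrix.mulVec_mulVec, ← hf, ← hg, Matrix.dotProduct_mulVec,
      ← Matrix.mulVec_transpose, Matrix.transpose_transpose, ← hf, dotProduct_comm]
  have e6 : quad P (A *ᵥ x + B *ᵥ u) = quad P (A *ᵥ x) + 2 * (u ⬝ᵥ f) + quad P (B *ᵥ u) := by
    have e7 : (B *ᵥ u) ⬝ᵥ P *ᵥ (A *ᵥ x) = u ⬝ᵥ f := by
      rw [hf, ← Matrix.mulVec_mulVec, ← Matrix.mulVec_mulVec, Matrix.dotProduct_mulVec u,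
        ← Matrix.mulVec_transpose, Matrix.transpose_transpose]
    simp only [quad, Matrix.mulVec_add, add_dotProduct, dotProduct_add]
    rw [dotProduct_mulVec_symm hP.isHermitian (A *ᵥ x) (B *ᵥ u), e7]
    ring
  rw [e1, e2, e3, e4, e6]
  ring

variable {S}

lemma riccati_posSemidef (hQ : S.Q.PosDef) (hR : S.R.PosDef) (m : ℕ) :
    (S.riccati Θ m).PosSemidef := by
  induction m with
  | zero => exact Matrix.PosSemidef.zero
  | succ m ih =>
    have hG : (S.R + (dynB Θ)ᵀ * S.riccati Θ m * dynB Θ).PosDef :=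
      hR.add_posSemidef (by simpa using ih.conjTranspose_mul_mul_same (dynB Θ))
    have hPT : (S.riccati Θ m)ᵀ = S.riccati Θ m := by simpa using ih.isHermitian.eq
    have hQT : S.Qᵀ = S.Q := by simpa using hQ.isHermitian.eq
    have hGT := hG.inv.isHermitian.eq
    rw [Matrix.conjTranspose_eq_transpose_of_trivial] at hGT
    simp only [Matrix.mul_assoc] at hGT
    refine Matrix.PosSemidef.of_dotProduct_mulVec_nonneg ?_ fun x => ?_
    · rw [Matrix.IsHermitian, Matrix.conjTranspose_eq_transpose_of_trivial, LQSystem.riccati]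
      simp only [Matrix.transpose_sub, Matrix.transpose_add, Matrix.transpose_mul, hGT, hPT, hQT,
        Matrix.transpose_transpose, Matrix.mul_assoc]
    · have h := riccati_step_matrix (Q := S.Q) (dynA Θ) (dynB Θ) ih hR x
        ((-((S.R + (dynB Θ)ᵀ * S.riccati Θ m * dynB Θ)⁻¹ * (dynB Θ)ᵀ * S.riccati Θ m * dynA Θ))
          *ᵥ x)
      rw [sub_self] at h
      have h0 : quad (S.R + (dynB Θ)ᵀ * S.riccati Θ m * dynB Θ) 0 = 0 := by simp [quad]
      rw [h0, add_zero] at h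
      rw [star_trivial]
      change 0 ≤ quad (S.riccati Θ (m + 1)) x
      rw [LQSystem.riccati, ← h]
      have := quad_nonneg hQ.posSemidef x
      have := quad_nonneg hR.posSemidef ((-((S.R + (dynB Θ)ᵀ * S.riccati Θ m * dynB Θ)⁻¹
        * (dynB Θ)ᵀ * S.riccati Θ m * dynA Θ)) *ᵥ x)
      have := quad_nonneg ih (dynA Θ *ᵥ x + dynB Θ *ᵥ ((-((S.R + (dynB Θ)ᵀ * S.riccati Θ m
        * dynB Θ)⁻¹ * (dynB Θ)ᵀ * S.riccati Θ m * dynA Θ)) *ᵥ x))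
      linarith

lemma riccati_step (hQ : S.Q.PosDef) (hR : S.R.PosDef) (m : ℕ) (x : State n) (u : Control d) :
    S.stageCost x u + quad (S.riccati Θ m)
        (Matrix.toEuclideanLin (dynA Θ) x + Matrix.toEuclideanLin (dynB Θ) u).ofLp
      = quad (S.riccati Θ (m + 1)) x.ofLp
        + quad (S.R + (dynB Θ)ᵀ * S.riccati Θ m * dynB Θ)
            (u - Matrix.toEuclideanLin (S.gainAt Θ m) x).ofLp :=
  riccati_step_matrix (dynA Θ) (dynB Θ) (riccati_posSemidef Θ hQ hR m) hR x.ofLp u.ofLp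

/-- The Bellman inequality for the Riccati matrices. -/
lemma riccati_succ_le (hQ : S.Q.PosDef) (hR : S.R.PosDef) (m : ℕ) (x : State n) (u : Control d) :
    quad (S.riccati Θ (m + 1)) x.ofLp ≤ S.stageCost x u + quad (S.riccati Θ m)
        (Matrix.toEuclideanLin (dynA Θ) x + Matrix.toEuclideanLin (dynB Θ) u).ofLp := by
  rw [riccati_step Θ hQ hR]
  have hG : (S.R + (dynB Θ)ᵀ * S.riccati Θ m * dynB Θ).PosDef :=
      hR.add_posSemidef
        (by simpa using (riccati_posSemidef Θ hQ hR m).conjTranspose_mul_mul_same (dynB Θ))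
  exact le_add_of_nonneg_right (quad_nonneg hG.posSemidef _)

/-- The cost of playing no control bounds the optimal cost. -/
lemma riccati_le (hQ : S.Q.PosDef) (hR : S.R.PosDef) {C : ℝ} (hC : opNorm S.Q ≤ C)
    (hΘ : frobNorm Θ ≤ 1) (m : ℕ) (x : State n) :
    quad (S.riccati Θ m) x.ofLp ≤ m * C * ‖x‖ ^ 2 := by
  induction m generalizing x with
  | zero => simp [quad, LQSystem.riccati]
  | succ m ih =>
    refine (riccati_succ_le Θ hQ hR m x 0).trans ?_
    have hC0 : 0 ≤ C := (opNorm_nonneg _).trans hC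
    have h1 : S.stageCost x 0 ≤ C * ‖x‖ ^ 2 := by
      have := quad_le_opNorm S.Q x
      have h2 : S.stageCost x 0 = quad S.Q x.ofLp := by simp [LQSystem.stageCost, quad]
      rw [h2]
      nlinarith [sq_nonneg ‖x‖]
    have h2 := ih (Matrix.toEuclideanLin (dynA Θ) x)
    have h3 := norm_dynA_le hΘ x
    rw [map_zero, add_zero]
    have h4 : ‖Matrix.toEuclideanLin (dynA Θ) x‖ ^ 2 ≤ ‖x‖ ^ 2 := by gcongr
    have h5 : (m : ℝ) * C * ‖Matrix.toEuclideanLin (dynA Θ) x‖ ^ 2 ≤ m * C * ‖x‖ ^ 2 := by gcongr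
    push_cast
    linarith

/-- The closed-loop map `A + B K`. -/
def closedLoop (Θ : Param n d) (K : Matrix (Fin d) (Fin n) ℝ) : State n →ₗ[ℝ] State n :=
  Matrix.toEuclideanLin (dynA Θ) + Matrix.toEuclideanLin (dynB Θ) ∘ₗ Matrix.toEuclideanLin K

lemma closedLoop_apply (K : Matrix (Fin d) (Fin n) ℝ) (x : State n) :
    closedLoop Θ K x = Matrix.toEuclideanLin (dynA Θ) x
      + Matrix.toEuclideanLin (dynB Θ) (Matrix.toEuclideanLin K x) := rfl

/-- The bilinear form of a matrix. -/
def matForm {n : ℕ} (M : Matrix (Fin n) (Fin n) ℝ) : LinearMap.BilinForm ℝ (State n) :=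
  LinearMap.mk₂ ℝ (fun x y => x.ofLp ⬝ᵥ M *ᵥ y.ofLp) (by simp) (by simp)
    (by simp [Matrix.mulVec_add]) (by simp [Matrix.mulVec_smul])

variable (S)

/-- The polarized stage cost of the control `u = K x`, where `K` is the gain of `Θ` when `m + 1`
steps remain. -/
def LQSystem.stageForm (m : ℕ) : LinearMap.BilinForm ℝ (State n) :=
  matForm S.Q + (matForm S.R).compl₁₂ (Matrix.toEuclideanLin (S.gainAt Θ m))
    (Matrix.toEuclideanLin (S.gainAt Θ m))

lemma stageForm_self (m : ℕ) (x : State n) :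
    S.stageForm Θ m x x = S.stageCost x (Matrix.toEuclideanLin (S.gainAt Θ m) x) := rfl

variable {S}

lemma stageForm_comm (hQ : S.Q.PosDef) (hR : S.R.PosDef) (m : ℕ) (x y : State n) :
    S.stageForm Θ m x y = S.stageForm Θ m y x :=
  congr_arg₂ (· + ·) (dotProduct_mulVec_symm hQ.isHermitian _ _)
    (dotProduct_mulVec_symm hR.isHermitian _ _)

lemma stageCost_nonneg (hQ : S.Q.PosDef) (hR : S.R.PosDef) (x : State n) (u : Control d) :
    0 ≤ S.stageCost x u :=
  add_nonneg (quad_nonneg hQ.posSemidef _) (quad_nonneg hR.posSemidef _)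

/-- The Riccati matrix is the cost of the closed loop with the Riccati gains. -/
lemma mixedCost_closedLoop_self (hQ : S.Q.PosDef) (hR : S.R.PosDef) (m : ℕ) (x : State n) :
    mixedCost (S.stageForm Θ) (fun m => closedLoop Θ (S.gainAt Θ m))
      (fun m => closedLoop Θ (S.gainAt Θ m)) m x x = quad (S.riccati Θ m) x.ofLp := by
  induction m generalizing x with
  | zero => simp [quad, LQSystem.riccati]
  | succ m ih =>
    rw [mixedCost_succ, ih, stageForm_self, closedLoop_apply, riccati_step Θ hQ hR]
    simp [quad]

lemma stageCost_le {C γ : ℝ} (hQ : opNorm S.Q ≤ C) (hR : opNorm S.R ≤ C)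
    {x : State n} {u : Control d} (hu : ‖u‖ ≤ γ * ‖x‖) :
    S.stageCost x u ≤ C * (1 + γ ^ 2) * ‖x‖ ^ 2 := by
  have hC0 : 0 ≤ C := (opNorm_nonneg _).trans hQ
  have h1 : quad S.Q x.ofLp ≤ C * ‖x‖ ^ 2 := (quad_le_opNorm S.Q x).trans (by gcongr)
  have h2 : quad S.R u.ofLp ≤ C * ‖u‖ ^ 2 := (quad_le_opNorm S.R u).trans (by gcongr)
  have h3 : ‖u‖ ^ 2 ≤ (γ * ‖x‖) ^ 2 := by gcongr
  have h4 : C * ‖u‖ ^ 2 ≤ C * (γ * ‖x‖) ^ 2 := by gcongr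
  change quad S.Q x.ofLp + quad S.R u.ofLp ≤ _
  linarith [h1, h2, h4, mul_pow γ ‖x‖ 2]

end Riccati

/-! ### Measurability of matrix operations -/

section MeasurableEntries

variable {α ι κ τ : Type*} [MeasurableSpace α]

/-- Measurability of a matrix-valued function, entry by entry. -/
def MeasurableEntries (M : α → Matrix ι κ ℝ) : Prop := ∀ i j, Measurable fun ω => M ω i j

namespace MeasurableEntries

lemma const (M : Matrix ι κ ℝ) : MeasurableEntries fun _ : α => M := fun _ _ => measurable_const

lemma add {M N : α → Matrix ι κ ℝ} (hM : MeasurableEntries M) (hN : MeasurableEntries N) :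
    MeasurableEntries fun ω => M ω + N ω := fun i j => (hM i j).add (hN i j)

lemma sub {M N : α → Matrix ι κ ℝ} (hM : MeasurableEntries M) (hN : MeasurableEntries N) :
    MeasurableEntries fun ω => M ω - N ω := fun i j => (hM i j).sub (hN i j)

lemma neg {M : α → Matrix ι κ ℝ} (hM : MeasurableEntries M) :
    MeasurableEntries fun ω => -M ω := fun i j => (hM i j).neg

lemma transpose {M : α → Matrix ι κ ℝ} (hM : MeasurableEntries M) :
    MeasurableEntries fun ω => (M ω)ᵀ := fun i j => hM j i

lemma mul [Fintype κ] {M : α → Matrix ι κ ℝ} {N : α → Matrix κ τ ℝ} (hM : MeasurableEntries M)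
    (hN : MeasurableEntries N) : MeasurableEntries fun ω => M ω * N ω := by
  intro i j
  simp only [Matrix.mul_apply]
  exact Finset.measurable_sum _ fun k _ => (hM i k).mul (hN k j)

lemma mulVec [Fintype κ] {M : α → Matrix ι κ ℝ} {v : α → κ → ℝ} (hM : MeasurableEntries M)
    (hv : Measurable v) : Measurable fun ω => M ω *ᵥ v ω := by
  refine measurable_pi_lambda _ fun i => ?_
  simp only [Matrix.mulVec, dotProduct]
  exact Finset.measurable_sum _ fun k _ => (hM i k).mul ((measurable_pi_apply k).comp hv)

lemma vecMul [Fintype ι] {M : α → Matrix ι κ ℝ} {v : α → ι → ℝ} (hM : MeasurableEntries M)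
    (hv : Measurable v) : Measurable fun ω => v ω ᵥ* M ω := by
  refine measurable_pi_lambda _ fun i => ?_
  simp only [Matrix.vecMul, dotProduct]
  exact Finset.measurable_sum _ fun k _ => ((measurable_pi_apply k).comp hv).mul (hM k i)

lemma vecMulVec {u : α → ι → ℝ} {v : α → κ → ℝ} (hu : Measurable u) (hv : Measurable v) :
    MeasurableEntries fun ω => Matrix.vecMulVec (u ω) (v ω) := fun i j =>
  ((measurable_pi_apply i).comp hu).mul ((measurable_pi_apply j).comp hv)

lemma sum {σ : Type*} {s : Finset σ} {M : σ → α → Matrix ι κ ℝ}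
    (hM : ∀ k ∈ s, MeasurableEntries (M k)) : MeasurableEntries fun ω => ∑ k ∈ s, M k ω := by
  intro i j
  simp only [Matrix.sum_apply]
  exact Finset.measurable_sum _ fun k hk => hM k hk i j

lemma trace [Fintype ι] {M : α → Matrix ι ι ℝ} (hM : MeasurableEntries M) :
    Measurable fun ω => (M ω).trace := Finset.measurable_sum _ fun i _ => hM i i

lemma det [Fintype ι] [DecidableEq ι] {M : α → Matrix ι ι ℝ} (hM : MeasurableEntries M) :
    Measurable fun ω => (M ω).det := by
  simp only [Matrix.det_apply]
  refine Finset.measurable_sum _ fun σ _ => ?_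
  exact (Finset.measurable_prod _ fun i _ => hM _ _).const_smul _

lemma inv [Fintype ι] [DecidableEq ι] {M : α → Matrix ι ι ℝ} (hM : MeasurableEntries M) :
    MeasurableEntries fun ω => (M ω)⁻¹ := by
  intro i j
  simp only [Matrix.inv_def, Ring.inverse_eq_inv', Matrix.smul_apply, smul_eq_mul,
    Matrix.adjugate_apply]
  refine hM.det.inv.mul (det fun a b => ?_)
  by_cases h : a = j
  · subst h; simp
  · simp only [Matrix.updateRow_ne h]; exact hM a b

end MeasurableEntries

lemma measurable_dotProduct [Fintype ι] {u v : α → ι → ℝ} (hu : Measurable u) (hv : Measurable v) :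
    Measurable fun ω => u ω ⬝ᵥ v ω :=
  Finset.measurable_sum _ fun i _ =>
    ((measurable_pi_apply i).comp hu).mul ((measurable_pi_apply i).comp hv)

lemma measurable_quad [Fintype ι] {M : α → Matrix ι ι ℝ} {v : α → ι → ℝ}
    (hM : MeasurableEntries M) (hv : Measurable v) : Measurable fun ω => quad (M ω) (v ω) :=
  measurable_dotProduct hv (hM.mulVec hv)

lemma measurable_toEuclideanLin {m n : ℕ} {M : α → Matrix (Fin m) (Fin n) ℝ}
    {v : α → EuclideanSpace ℝ (Fin n)} (hM : MeasurableEntries M) (hv : Measurable v) :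
    Measurable fun ω => Matrix.toEuclideanLin (M ω) (v ω) :=
  (MeasurableEquiv.toLp 2 _).measurable.comp
    (hM.mulVec ((WithLp.measurable_ofLp 2 _).comp hv))

end MeasurableEntries

/-! ### Truncated noise sequences -/

section TruncSeq

variable {Ω E : Type*}

/-- The first `j` terms of a sequence of random variables, followed by zeros. -/
def truncSeq [Zero E] (w : ℕ → Ω → E) (j : ℕ) (ω : Ω) : ℕ → E := fun i => if i < j then w i ω else 0

lemma measurable_truncSeq [MeasurableSpace Ω] [MeasurableSpace E] [Zero E] {w : ℕ → Ω → E}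
    {j : ℕ}
    (hw : ∀ i < j, Measurable (w i)) : Measurable (truncSeq w j) := by
  refine measurable_pi_lambda _ fun i => ?_
  unfold truncSeq
  by_cases h : i < j
  · simpa [h] using hw i h
  · simp [h]

end TruncSeq

/-! ### Independent noise and a maximal inequality -/

section Freezing

variable {Ω α E E' : Type*} [mΩ : MeasurableSpace Ω] {P : Measure Ω}
  [MeasurableSpace α] [MeasurableSpace E] [MeasurableSpace E']

lemma lintegral_indepFun_prod [IsProbabilityMeasure P] {X : Ω → α} {W : Ω → E}
    (hX : Measurable X) (hW : Measurable W)
    (h : IndepFun X W P) {g : α × E → ENNReal} (hg : Measurable g) :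
    ∫⁻ ω, g (X ω, W ω) ∂P = ∫⁻ ω, ∫⁻ ω', g (X ω, W ω') ∂P ∂P := by
  have hmap := (indepFun_iff_map_prod_eq_prod_map_map hX.aemeasurable hW.aemeasurable).1 h
  have : IsProbabilityMeasure (P.map W) := Measure.isProbabilityMeasure_map hW.aemeasurable
  rw [← lintegral_map (f := g) hg (hX.prodMk hW), hmap, lintegral_prod _ hg.aemeasurable,
    lintegral_map hg.lintegral_prod_right' hX]
  refine lintegral_congr fun ω => ?_
  exact lintegral_map (f := fun y => g (X ω, y)) (hg.comp measurable_prodMk_left) hW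

/-- Freezing: noise `W` that is independent of the information `m` may be averaged out separately,
with everything that is determined by `m` held fixed. -/
lemma lintegral_freeze [IsProbabilityMeasure P] {m : MeasurableSpace Ω} (hm : m ≤ mΩ)
    {W : Ω → E} (hW : Measurable[mΩ] W)
    (hind : Indep (MeasurableSpace.comap W inferInstance) m P) {g : Ω × E → ENNReal}
    (hg : Measurable[m.prod inferInstance] g) :
    ∫⁻ ω, g (ω, W ω) ∂P = ∫⁻ ω, ∫⁻ ω', g (ω, W ω') ∂P ∂P := by
  have hX : @Measurable Ω Ω mΩ m id := measurable_id'' hm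
  have hI : @IndepFun Ω Ω E mΩ m inferInstance id W P := by
    refine (@IndepFun_iff_Indep Ω Ω E mΩ m _ id W P).2 ?_
    rw [MeasurableSpace.comap_id]
    exact hind.symm
  exact @lintegral_indepFun_prod Ω Ω E mΩ P m _ _ id W hX hW hI g hg

lemma indepFun_of_indep_comap {m : MeasurableSpace Ω} {W : Ω → E}
    (hind : Indep (MeasurableSpace.comap W inferInstance) m P) {X : Ω → α}
    (hX : Measurable[m] X) : IndepFun X W P := by
  rw [IndepFun_iff_Indep]
  exact (indep_of_indep_of_le_right hind hX.comap_le).symm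

lemma IndepFun.prodMk_right_of_indepFun [IsProbabilityMeasure P] {X : Ω → α} {W : Ω → E}
    {W' : Ω → E'} (hX : Measurable X)
    (hW : Measurable W) (hW' : Measurable W') (h : IndepFun X W P)
    (h' : IndepFun (fun ω => (X ω, W ω)) W' P) : IndepFun X (fun ω => (W ω, W' ω)) P := by
  have h2 : IndepFun W W' P := h'.comp measurable_snd measurable_id
  rw [indepFun_iff_map_prod_eq_prod_map_map hX.aemeasurable (hW.prodMk hW').aemeasurable,
    (indepFun_iff_map_prod_eq_prod_map_map hW.aemeasurable hW'.aemeasurable).1 h2]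
  have e1 := (indepFun_iff_map_prod_eq_prod_map_map hX.aemeasurable hW.aemeasurable).1 h
  have e2 := (indepFun_iff_map_prod_eq_prod_map_map (hX.prodMk hW).aemeasurable
    hW'.aemeasurable).1 h'
  have := Measure.isProbabilityMeasure_map (μ := P) hX.aemeasurable
  have := Measure.isProbabilityMeasure_map (μ := P) hW.aemeasurable
  have := Measure.isProbabilityMeasure_map (μ := P) hW'.aemeasurable
  rw [← Measure.prodAssoc_prod, ← e1, ← e2,
    Measure.map_map MeasurableEquiv.prodAssoc.measurable ((hX.prodMk hW).prodMk hW')]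
  rfl

/-- If each `w i` is independent of the information before it, then a whole block of noise is
independent of the information before the block. -/
lemma indep_comap_truncSeq [IsProbabilityMeasure P] [Zero E] {w : ℕ → Ω → E}
    {𝒢 : ℕ → MeasurableSpace Ω}
    (hmono : Monotone 𝒢) (hle : ∀ i, 𝒢 i ≤ mΩ) {H : ℕ}
    (hw : ∀ i < H, Measurable[𝒢 (i + 1)] (w i))
    (hind : ∀ i < H, Indep (MeasurableSpace.comap (w i) inferInstance) (𝒢 i) P) (j : ℕ)
    (hj : j ≤ H) : Indep (MeasurableSpace.comap (truncSeq w j) inferInstance) (𝒢 0) P := by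
  induction j with
  | zero =>
    have h0 : truncSeq w 0 = fun _ => (0 : ℕ → E) := by ext ω i; simp [truncSeq]
    rw [h0, MeasurableSpace.comap_const]
    exact (indep_bot_left _)
  | succ j ih =>
    have ih := ih (by omega)
    have hmT : Measurable[𝒢 j] (truncSeq w j) :=
      @measurable_truncSeq _ _ (𝒢 j) _ _ _ _ fun i hi =>
        (hw i (by omega)).mono (hmono (by omega)) le_rfl
    have hX : @Measurable Ω Ω mΩ (𝒢 0) id := measurable_id'' (hle 0)
    have h1 : @IndepFun Ω Ω (ℕ → E) mΩ (𝒢 0) inferInstance id (truncSeq w j) P := by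
      refine (@IndepFun_iff_Indep Ω Ω (ℕ → E) mΩ (𝒢 0) _ id _ P).2 ?_
      rw [MeasurableSpace.comap_id]
      exact ih.symm
    have h2 : @IndepFun Ω (Ω × (ℕ → E)) E mΩ ((𝒢 0).prod inferInstance) inferInstance
        (fun ω => (id ω, truncSeq w j ω)) (w j) P := by
      refine @indepFun_of_indep_comap Ω (Ω × (ℕ → E)) E mΩ P ((𝒢 0).prod inferInstance) _
        (𝒢 j) (w j) (hind j (by omega)) _ ?_
      exact @Measurable.prodMk _ (𝒢 j) _ _ (𝒢 0) _ _ _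
        (measurable_id'' (hmono (Nat.zero_le j))) hmT
    have h3 := @IndepFun.prodMk_right_of_indepFun Ω Ω (ℕ → E) E mΩ P (𝒢 0) _ _ _ id
      (truncSeq w j) (w j) hX (hmT.mono (hle j) le_rfl)
      ((hw j (by omega)).mono (hle _) le_rfl) h1 h2
    -- appending one term to the truncated sequence is a measurable operation on pairs
    have hup : Measurable fun p : (ℕ → E) × E => (fun i => if i = j then p.2 else p.1 i) := by
      refine measurable_pi_lambda _ fun i => ?_
      by_cases h : i = j
      · simpa [h] using measurable_snd
      · simp only [h, if_false]
        exact (measurable_pi_apply i).comp measurable_fst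
    have h4 := @IndepFun.comp Ω Ω ((ℕ → E) × E) Ω (ℕ → E) mΩ P _ _ (𝒢 0) _ (𝒢 0) _ id _ h3
      (@measurable_id Ω (𝒢 0)) hup
    have h4 := (@IndepFun_iff_Indep Ω Ω (ℕ → E) mΩ (𝒢 0) _ _ _ P).1 h4
    have h5 : ((fun p : (ℕ → E) × E => (fun i => if i = j then p.2 else p.1 i))
        ∘ fun ω => (truncSeq w j ω, w j ω)) = truncSeq w (j + 1) := by
      ext ω i
      by_cases h : i = j
      · subst h; simp [truncSeq]
      · have : i < j + 1 ↔ i < j := by omega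
        simp [truncSeq, h, this]
    rw [h5] at h4
    have h6 : MeasurableSpace.comap (id ∘ id) (𝒢 0) = 𝒢 0 := MeasurableSpace.comap_id
    rw [h6] at h4
    exact h4.symm

/-- Ville's maximal inequality for a nonnegative process that does not increase in expectation
on any event known in advance, stated without a division by `c`. The last summand of `main` carries
the part of the process that has not yet reached `c`. -/
lemma measure_exists_le_mul_le_one (ℱ : Filtration ℕ mΩ) {M : ℕ → Ω → ENNReal} {T : ℕ}
    (hM : ∀ t ≤ T, Measurable[ℱ t] (M t)) (h0 : ∫⁻ ω, M 0 ω ∂P ≤ 1)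
    (hstep : ∀ t < T, ∀ A, MeasurableSet[ℱ t] A → ∫⁻ ω in A, M (t + 1) ω ∂P ≤ ∫⁻ ω in A, M t ω ∂P)
    (c : ENNReal) : c * P {ω | ∃ t ≤ T, c ≤ M t ω} ≤ 1 := by
  have hBmeas : ∀ t ≤ T, MeasurableSet[ℱ t] {ω | ∃ s < t, c ≤ M s ω} := by
    intro t ht
    have : {ω | ∃ s < t, c ≤ M s ω} = ⋃ s ∈ Finset.range t, {ω | c ≤ M s ω} := by
      ext; simp
    rw [this]
    refine Finset.measurableSet_biUnion _ fun s hs => ?_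
    have hs : s < t := Finset.mem_range.1 hs
    exact ℱ.mono hs.le _ (hM s (by omega) measurableSet_Ici)
  have main : ∀ t ≤ T + 1, ∀ s, s + 1 = t →
      c * P {ω | ∃ r < s, c ≤ M r ω} + ∫⁻ ω in {ω | ∃ r < s, c ≤ M r ω}ᶜ, M s ω ∂P ≤ 1 := by
    intro t ht s hst
    induction s generalizing t with
    | zero => simpa using h0
    | succ s ih =>
      have ih := ih (s + 1) (by omega) rfl
      refine le_trans ?_ ih
      set B := {ω | ∃ r < s, c ≤ M r ω} with hB
      -- the outcomes at which the level is reached for the first time at `s`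
      set D := Bᶜ ∩ {ω | c ≤ M s ω} with hD
      have hBs : MeasurableSet[ℱ s] B := hBmeas s (by omega)
      have hDs : MeasurableSet[ℱ s] D := hBs.compl.inter
        (hM s (by omega) measurableSet_Ici)
      have hB' : {ω | ∃ r < s + 1, c ≤ M r ω} = B ∪ D := by
        ext ω
        simp only [hB, hD, Set.mem_ofPred_eq, Set.mem_union, Set.mem_inter_iff, Set.mem_compl_iff]
        constructor
        · rintro ⟨r, hr, hc⟩
          by_cases h : ∃ r < s, c ≤ M r ω
          · exact Or.inl h
          · right
            refine ⟨h, ?_⟩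
            have : r = s := by
              by_contra hne
              exact h ⟨r, by omega, hc⟩
            rwa [← this]
        · rintro (⟨r, hr, hc⟩ | ⟨-, hc⟩)
          · exact ⟨r, by omega, hc⟩
          · exact ⟨s, by omega, hc⟩
      rw [hB']
      have hc1 : c * P D ≤ ∫⁻ ω in D, M s ω ∂P := by
        rw [← setLIntegral_const]
        exact setLIntegral_mono' (ℱ.le s _ hDs) fun ω hω => hω.2
      have h2 : ∫⁻ ω in (B ∪ D)ᶜ, M (s + 1) ω ∂P ≤ ∫⁻ ω in (B ∪ D)ᶜ, M s ω ∂P :=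
        hstep s (by omega) _ (hBs.union hDs).compl
      have h3 : ∫⁻ ω in Bᶜ, M s ω ∂P
          = ∫⁻ ω in D, M s ω ∂P + ∫⁻ ω in (B ∪ D)ᶜ, M s ω ∂P := by
        rw [← lintegral_union (ℱ.le s _ (hBs.union hDs).compl)]
        · congr 2
          ext ω
          simp only [hD, Set.mem_union, Set.mem_compl_iff, Set.mem_inter_iff, not_or, not_and]
          tauto
        · rw [Set.disjoint_left]
          intro ω h1 h2
          exact h2 (Or.inr h1)
      calc c * P (B ∪ D) + ∫⁻ ω in (B ∪ D)ᶜ, M (s + 1) ω ∂P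
          ≤ c * (P B + P D) + ∫⁻ ω in (B ∪ D)ᶜ, M s ω ∂P := by
            gcongr
            exact measure_union_le _ _
        _ ≤ c * P B + (∫⁻ ω in D, M s ω ∂P + ∫⁻ ω in (B ∪ D)ᶜ, M s ω ∂P) := by
            rw [mul_add, add_assoc]
            gcongr
        _ = _ := by rw [h3]
  have hfin := main (T + 1) le_rfl T rfl
  refine le_trans ?_ hfin
  set B := {ω | ∃ r < T, c ≤ M r ω} with hB
  have hBT := ℱ.le T _ (hBmeas T le_rfl)
  have hset : {ω | ∃ t ≤ T, c ≤ M t ω} ⊆ B ∪ (Bᶜ ∩ {ω | c ≤ M T ω}) := by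
    rintro ω ⟨t, ht, hc⟩
    by_cases h : ω ∈ B
    · exact Or.inl h
    · right
      refine ⟨h, ?_⟩
      have : t = T := by
        by_contra hne
        exact h ⟨t, by omega, hc⟩
      rwa [Set.mem_ofPred_eq, ← this]
  have hmT : MeasurableSet {ω | c ≤ M T ω} :=
    measurableSet_le measurable_const ((hM T le_rfl).mono (ℱ.le T) le_rfl)
  calc c * P {ω | ∃ t ≤ T, c ≤ M t ω} ≤ c * (P B + P (Bᶜ ∩ {ω | c ≤ M T ω})) := by
        gcongr
        exact (measure_mono hset).trans (measure_union_le _ _)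
    _ ≤ c * P B + ∫⁻ ω in Bᶜ, M T ω ∂P := by
        rw [mul_add]
        gcongr
        rw [← setLIntegral_const]
        calc ∫⁻ ω in Bᶜ ∩ {ω | c ≤ M T ω}, c ∂P
            ≤ ∫⁻ ω in Bᶜ ∩ {ω | c ≤ M T ω}, M T ω ∂P :=
              setLIntegral_mono' (hBT.compl.inter hmT) fun ω hω => hω.2
          _ ≤ _ := lintegral_mono_set Set.inter_subset_left

end Freezing

/-! ### Gram matrices and the self-normalized process -/

section Gram

variable {ι κ : Type*}

/-- The correlation matrix `∑ i < t, z_i w_iᵀ`. -/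
def crossGram (z : ℕ → ι → ℝ) (w : ℕ → κ → ℝ) (t : ℕ) : Matrix ι κ ℝ :=
  ∑ i ∈ Finset.range t, Matrix.vecMulVec (z i) (w i)

lemma measurableEntries_crossGram {α : Type*} [MeasurableSpace α] {z : ℕ → α → ι → ℝ}
    {w : ℕ → α → κ → ℝ} {t : ℕ} (hz : ∀ i < t, Measurable (z i)) (hw : ∀ i < t, Measurable (w i)) :
    MeasurableEntries fun ω => crossGram (fun i => z i ω) (fun i => w i ω) t :=
  MeasurableEntries.sum fun i hi =>
    MeasurableEntries.vecMulVec (hz i (Finset.mem_range.1 hi)) (hw i (Finset.mem_range.1 hi))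

variable [DecidableEq ι]

/-- The regularized Gram matrix `lam • 1 + ∑ i < t, z_i z_iᵀ`. -/
def gram (lam : ℝ) (z : ℕ → ι → ℝ) (t : ℕ) : Matrix ι ι ℝ :=
  lam • 1 + ∑ i ∈ Finset.range t, Matrix.vecMulVec (z i) (z i)

lemma gram_succ (lam : ℝ) (z : ℕ → ι → ℝ) (t : ℕ) :
    gram lam z (t + 1) = gram lam z t + Matrix.vecMulVec (z t) (z t) := by
  rw [gram, gram, Finset.sum_range_succ, add_assoc]

lemma measurableEntries_gram {α : Type*} [MeasurableSpace α] {z : ℕ → α → ι → ℝ} {t : ℕ}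
    (lam : ℝ) (hz : ∀ i < t, Measurable (z i)) :
    MeasurableEntries fun ω => gram lam (fun i => z i ω) t :=
  (MeasurableEntries.const _).add (MeasurableEntries.sum fun i hi =>
    MeasurableEntries.vecMulVec (hz i (Finset.mem_range.1 hi)) (hz i (Finset.mem_range.1 hi)))

variable [Fintype ι] [Fintype κ]

lemma posDef_gram {lam : ℝ} (hlam : 0 < lam) (z : ℕ → ι → ℝ) (t : ℕ) : (gram lam z t).PosDef := by
  induction t with
  | zero => simpa [gram] using (Matrix.PosDef.one).smul hlam
  | succ t ih => rw [gram_succ]; exact posDef_add_vecMulVec ih _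

/-- `‖z_t‖²` in the norm given by the inverse Gram matrix of the earlier vectors. -/
def leverage (lam : ℝ) (z : ℕ → ι → ℝ) (t : ℕ) : ℝ := quad (gram lam z t)⁻¹ (z t)

lemma leverage_nonneg {lam : ℝ} (hlam : 0 < lam) (z : ℕ → ι → ℝ) (t : ℕ) :
    0 ≤ leverage lam z t := quad_nonneg (posDef_gram hlam z t).posSemidef.inv _

lemma log_det_gram_succ {lam : ℝ} (hlam : 0 < lam) (z : ℕ → ι → ℝ) (t : ℕ) :
    Real.log (gram lam z (t + 1)).det
      = Real.log (gram lam z t).det + Real.log (1 + leverage lam z t) := by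
  have h0 := leverage_nonneg hlam z t
  rw [gram_succ, det_add_vecMulVec (posDef_gram hlam z t), Real.log_mul
    (posDef_gram hlam z t).det_pos.ne' (by unfold leverage at h0; positivity)]
  rfl

/-- The logarithm of the self-normalized process for noise of size `σ`, up to the factor `1 / 2`:
the squared norm of the correlation matrix in the inverse Gram norm, minus the increase of the
logarithm of the Gram determinant. -/
def selfNormLog (σ lam : ℝ) (z : ℕ → ι → ℝ) (w : ℕ → κ → ℝ) (t : ℕ) : ℝ :=
  ((crossGram z w t)ᵀ * (gram lam z t)⁻¹ * crossGram z w t).trace / σ ^ 2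
    - (Real.log (gram lam z t).det - Real.log (gram lam z 0).det)

lemma selfNormLog_zero (σ lam : ℝ) (z : ℕ → ι → ℝ) (w : ℕ → κ → ℝ) :
    selfNormLog σ lam z w 0 = 0 := by simp [selfNormLog, crossGram]

/-- The increment of `selfNormLog` as a function of the new noise `y`, with `a = Sᵀ V⁻¹ z` and
`q = zᵀ V⁻¹ z`. -/
def selfNormIncr (σ : ℝ) (a : κ → ℝ) (q : ℝ) (y : κ → ℝ) : ℝ :=
  (2 * (a ⬝ᵥ y) - a ⬝ᵥ a + q * (y ⬝ᵥ y)) / (1 + q) / σ ^ 2 - Real.log (1 + q)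

lemma selfNormLog_succ {lam : ℝ} (hlam : 0 < lam) (σ : ℝ) (z : ℕ → ι → ℝ) (w : ℕ → κ → ℝ) (t : ℕ) :
    selfNormLog σ lam z w (t + 1) = selfNormLog σ lam z w t
      + selfNormIncr σ (((gram lam z t)⁻¹ *ᵥ z t) ᵥ* crossGram z w t) (leverage lam z t) (w t) := by
  have h1 : crossGram z w (t + 1) = crossGram z w t + Matrix.vecMulVec (z t) (w t) := by
    rw [crossGram, crossGram, Finset.sum_range_succ]
  rw [selfNormLog, log_det_gram_succ hlam, h1, gram_succ,
    trace_inv_rank_one_update (posDef_gram hlam z t), selfNormIncr, selfNormLog, leverage]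
  ring

end Gram

/-! ### The self-normalized inequality -/

section SelfNormalized

variable {Ω : Type*} [mΩ : MeasurableSpace Ω] {P : Measure Ω} [IsProbabilityMeasure P] {n : ℕ}

lemma integrable_of_norm_le {W : Ω → State n} (hW : Measurable W) {σ : ℝ}
    (hb : ∀ᵐ ω ∂P, ‖W ω‖ ≤ σ) : Integrable W P :=
  Integrable.of_bound hW.aestronglyMeasurable σ hb

/-- Hoeffding's lemma for a bounded random vector. -/
lemma lintegral_exp_inner_le {W : Ω → State n} (hW : Measurable W) {σ : ℝ} (hσ : 0 ≤ σ)
    (hb : ∀ᵐ ω ∂P, ‖W ω‖ ≤ σ) (hmean : ∫ ω, W ω ∂P = 0) (v : State n) :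
    ∫⁻ ω, ENNReal.ofReal (Real.exp (inner ℝ v (W ω))) ∂P
      ≤ ENNReal.ofReal (Real.exp (‖v‖ ^ 2 * σ ^ 2 / 2)) := by
  have hmeas : Measurable fun ω => inner ℝ v (W ω) := by fun_prop
  have hbd : ∀ᵐ ω ∂P, inner ℝ v (W ω) ∈ Set.Icc (-(‖v‖ * σ)) (‖v‖ * σ) := by
    filter_upwards [hb] with ω hω
    have h := abs_real_inner_le_norm v (W ω)
    have h2 : ‖v‖ * ‖W ω‖ ≤ ‖v‖ * σ := by gcongr
    exact abs_le.1 (h.trans h2)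
  have hm : ∫ ω, inner ℝ v (W ω) ∂P = 0 := by
    rw [integral_inner (integrable_of_norm_le hW hb), hmean, inner_zero_right]
  have hsub := hasSubgaussianMGF_of_mem_Icc_of_integral_eq_zero hmeas.aemeasurable hbd hm
  have h1 := hsub.mgf_le 1
  have hint := hsub.integrable_exp_mul 1
  simp only [one_mul, mgf] at h1 hint
  rw [← ofReal_integral_eq_lintegral_ofReal hint
    (Filter.Eventually.of_forall fun _ => by positivity)]
  refine ENNReal.ofReal_le_ofReal (h1.trans (Real.exp_le_exp.2 (le_of_eq ?_)))
  have : ‖‖v‖ * σ - -(‖v‖ * σ)‖ = 2 * (‖v‖ * σ) := by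
    rw [sub_neg_eq_add, ← two_mul, Real.norm_of_nonneg (by positivity)]
  push_cast
  rw [this]
  ring

/-- In expectation, the self-normalized process does not increase. As the noise is bounded, the
quadratic term in the increment is at most `q / (1 + q) ≤ log (1 + q)`. -/
lemma lintegral_exp_selfNormIncr_le {W : Ω → State n} (hW : Measurable W) {σ : ℝ} (hσ : 0 < σ)
    (hb : ∀ᵐ ω ∂P, ‖W ω‖ ≤ σ) (hmean : ∫ ω, W ω ∂P = 0) (a : Fin n → ℝ) {q : ℝ} (hq : 0 ≤ q) :
    ∫⁻ ω, ENNReal.ofReal (Real.exp (selfNormIncr σ a q (W ω).ofLp / 2)) ∂P ≤ 1 := by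
  set v : State n := ((1 + q) * σ ^ 2)⁻¹ • WithLp.toLp 2 a with hv
  set A : ℝ := a ⬝ᵥ a with hA
  have hA' : A = ‖(WithLp.toLp 2 a : State n)‖ ^ 2 := dotProduct_ofLp_self (WithLp.toLp 2 a)
  have hA0 : 0 ≤ A := by rw [hA']; positivity
  have hlog : q / (1 + q) ≤ Real.log (1 + q) := by
    have := Real.one_sub_inv_le_log_of_pos (x := 1 + q) (by positivity)
    have h2 : q / (1 + q) = 1 - (1 + q)⁻¹ := by field_simp; ring
    rwa [h2]
  have hbound : ∀ᵐ ω ∂P, ENNReal.ofReal (Real.exp (selfNormIncr σ a q (W ω).ofLp / 2))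
      ≤ ENNReal.ofReal (Real.exp (-(A / (2 * (1 + q) * σ ^ 2))))
        * ENNReal.ofReal (Real.exp (inner ℝ v (W ω))) := by
    filter_upwards [hb] with ω hω
    rw [← ENNReal.ofReal_mul (by positivity), ← Real.exp_add]
    refine ENNReal.ofReal_le_ofReal (Real.exp_le_exp.2 ?_)
    have h1 : inner ℝ v (W ω) = (a ⬝ᵥ (W ω).ofLp) / ((1 + q) * σ ^ 2) := by
      rw [hv, real_inner_smul_left, ← dotProduct_ofLp]
      field_simp
    have h2 : (W ω).ofLp ⬝ᵥ (W ω).ofLp ≤ σ ^ 2 := by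
      rw [dotProduct_ofLp_self]; gcongr
    rw [h1, selfNormIncr]
    have h3 : q * ((W ω).ofLp ⬝ᵥ (W ω).ofLp) / (1 + q) / σ ^ 2 ≤ q / (1 + q) := by
      rw [div_le_iff₀ (by positivity), div_mul_eq_mul_div]
      gcongr
    have h4 : (2 * (a ⬝ᵥ (W ω).ofLp) - a ⬝ᵥ a + q * ((W ω).ofLp ⬝ᵥ (W ω).ofLp)) / (1 + q) / σ ^ 2
        = 2 * (-(A / (2 * (1 + q) * σ ^ 2)) + (a ⬝ᵥ (W ω).ofLp) / ((1 + q) * σ ^ 2))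
          + q * ((W ω).ofLp ⬝ᵥ (W ω).ofLp) / (1 + q) / σ ^ 2 := by
      rw [← hA]; field_simp; ring
    linarith
  refine (lintegral_mono_ae hbound).trans ?_
  rw [lintegral_const_mul _ (by fun_prop)]
  refine (mul_le_mul_right (lintegral_exp_inner_le hW hσ.le hb hmean v) _).trans ?_
  rw [← ENNReal.ofReal_mul (by positivity), ← Real.exp_add, ← ENNReal.ofReal_one]
  refine ENNReal.ofReal_le_ofReal ?_
  rw [Real.exp_le_one_iff]
  have h5 : ‖v‖ ^ 2 * σ ^ 2 / 2 = A / (2 * (1 + q) ^ 2 * σ ^ 2) := by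
    rw [hv, norm_smul, mul_pow, ← hA', Real.norm_of_nonneg (by positivity)]
    field_simp
  have h6 : A / (2 * (1 + q) ^ 2 * σ ^ 2) ≤ A / (2 * (1 + q) * σ ^ 2) := by
    gcongr
    nlinarith
  linarith

variable {ι : Type*} [Fintype ι] [DecidableEq ι]

lemma measurable_selfNormLog {α κ : Type*} [MeasurableSpace α] [Fintype κ] {z : ℕ → α → ι → ℝ}
    {w : ℕ → α → κ → ℝ} {t : ℕ} (σ lam : ℝ) (hz : ∀ i < t, Measurable (z i))
    (hw : ∀ i < t, Measurable (w i)) :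
    Measurable fun ω => selfNormLog σ lam (fun i => z i ω) (fun i => w i ω) t := by
  have hG := measurableEntries_gram lam hz
  have hS := measurableEntries_crossGram hz hw
  have h0 : ∀ x : α, gram lam (fun i => z i x) 0 = lam • 1 := fun x => by simp [gram]
  unfold selfNormLog
  simp only [h0]
  exact (((hS.transpose.mul hG.inv).mul hS).trace.div_const _).sub
    ((Real.measurable_log.comp hG.det).sub measurable_const)

/-- The self-normalized inequality for bounded vector noise, uniformly in time. -/
theorem measure_exists_selfNormLog_le (ℱ : Filtration ℕ mΩ) {T : ℕ} {z : ℕ → Ω → ι → ℝ}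
    {w : ℕ → Ω → State n} {σ lam : ℝ} (hσ : 0 < σ) (hlam : 0 < lam)
    (hz : ∀ t < T, Measurable[ℱ t] (z t)) (hw : ∀ t < T, Measurable[ℱ (t + 1)] (w t))
    (hind : ∀ t < T, Indep (MeasurableSpace.comap (w t) inferInstance) (ℱ t) P)
    (hmean : ∀ t < T, ∫ ω, w t ω ∂P = 0) (hb : ∀ t < T, ∀ᵐ ω ∂P, ‖w t ω‖ ≤ σ)
    {b : ℝ} (hb0 : 0 < b) :
    P {ω | ∃ t ≤ T, 2 * Real.log (1 / b)
      ≤ selfNormLog σ lam (fun i => z i ω) (fun i => (w i ω).ofLp) t} ≤ ENNReal.ofReal b := by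
  set L : ℕ → Ω → ℝ :=
    fun t ω => selfNormLog σ lam (fun i => z i ω) (fun i => (w i ω).ofLp) t with hL
  set M : ℕ → Ω → ENNReal := fun t ω => ENNReal.ofReal (Real.exp (L t ω / 2)) with hM
  have hzm : ∀ t ≤ T, ∀ i < t, Measurable[ℱ t] (z i) := fun t ht i hi =>
    (hz i (by omega)).mono (ℱ.mono (by omega)) le_rfl
  have hwm : ∀ t ≤ T, ∀ i < t, Measurable[ℱ t] (fun ω => (w i ω).ofLp) := fun t ht i hi =>
    (WithLp.measurable_ofLp 2 _).comp ((hw i (by omega)).mono (ℱ.mono (by omega)) le_rfl)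
  have hLm : ∀ t ≤ T, Measurable[ℱ t] (L t) := fun t ht =>
    @measurable_selfNormLog ι _ _ Ω (Fin n) (ℱ t) _ z (fun i ω => (w i ω).ofLp) t σ lam
      (hzm t ht) (hwm t ht)
  have hMm : ∀ t ≤ T, Measurable[ℱ t] (M t) := fun t ht =>
    ENNReal.measurable_ofReal.comp (Real.measurable_exp.comp ((hLm t ht).div_const 2))
  have h0 : ∫⁻ ω, M 0 ω ∂P ≤ 1 := by simp [hM, hL, selfNormLog_zero]
  have hstep : ∀ t < T, ∀ A, MeasurableSet[ℱ t] A →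
      ∫⁻ ω in A, M (t + 1) ω ∂P ≤ ∫⁻ ω in A, M t ω ∂P := by
    intro t ht A hA
    have hG := @measurableEntries_gram ι _ Ω (ℱ t) z t lam (hzm t ht.le)
    have hS := @measurableEntries_crossGram ι (Fin n) Ω (ℱ t) z (fun i ω => (w i ω).ofLp) t
      (hzm t ht.le) (hwm t ht.le)
    set a : Ω → Fin n → ℝ := fun ω => ((gram lam (fun i => z i ω) t)⁻¹ *ᵥ z t ω) ᵥ*
      crossGram (fun i => z i ω) (fun i => (w i ω).ofLp) t with ha
    set q : Ω → ℝ := fun ω => leverage lam (fun i => z i ω) t with hq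
    have ham : Measurable[ℱ t] a :=
      @MeasurableEntries.vecMul Ω ι (Fin n) (ℱ t) _ _ _ hS
        (@MeasurableEntries.mulVec Ω ι ι (ℱ t) _ _ _
          (@MeasurableEntries.inv Ω ι (ℱ t) _ _ _ hG) (hz t ht))
    have hqm : Measurable[ℱ t] q :=
      @measurable_quad Ω ι (ℱ t) _ _ _ (@MeasurableEntries.inv Ω ι (ℱ t) _ _ _ hG) (hz t ht)
    have hsucc : ∀ ω, M (t + 1) ω
        = M t ω * ENNReal.ofReal (Real.exp (selfNormIncr σ (a ω) (q ω) (w t ω).ofLp / 2)) := by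
      intro ω
      simp only [hM, hL]
      rw [selfNormLog_succ hlam, ← ENNReal.ofReal_mul (by positivity), ← Real.exp_add, add_div]
    rw [← lintegral_indicator (ℱ.le t _ hA), ← lintegral_indicator (ℱ.le t _ hA)]
    let g : Ω × State n → ENNReal := fun p => A.indicator (M t) p.1
      * ENNReal.ofReal (Real.exp (selfNormIncr σ (a p.1) (q p.1) p.2.ofLp / 2))
    have hg : Measurable[(ℱ t).prod inferInstance] g := by
      let _ : MeasurableSpace Ω := ℱ t
      have h1 : Measurable fun p : Ω × State n => p.2.ofLp :=
        (WithLp.measurable_ofLp 2 _).comp measurable_snd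
      have h2 : Measurable fun p : Ω × State n => a p.1 := ham.comp measurable_fst
      have h3 : Measurable fun p : Ω × State n => q p.1 := hqm.comp measurable_fst
      have h4 : Measurable fun p : Ω × State n => A.indicator (M t) p.1 :=
        ((hMm t ht.le).indicator hA).comp measurable_fst
      refine h4.mul (ENNReal.measurable_ofReal.comp (Real.measurable_exp.comp (Measurable.div_const
        ?_ 2)))
      unfold selfNormIncr
      exact ((((((measurable_dotProduct h2 h1).const_mul 2).sub (measurable_dotProduct h2 h2)).add
        (h3.mul (measurable_dotProduct h1 h1))).div (h3.const_add 1)).div_const _).sub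
        (Real.measurable_log.comp (h3.const_add 1))
    have hfr := lintegral_freeze (ℱ.le t) ((hw t ht).mono (ℱ.le _) le_rfl) (hind t ht) hg
    calc ∫⁻ ω, A.indicator (M (t + 1)) ω ∂P = ∫⁻ ω, g (ω, w t ω) ∂P := by
          refine lintegral_congr fun ω => ?_
          by_cases h : ω ∈ A
          · simp [g, h, hsucc]
          · simp [g, h]
      _ = ∫⁻ ω, ∫⁻ ω', g (ω, w t ω') ∂P ∂P := hfr
      _ ≤ ∫⁻ ω, A.indicator (M t) ω ∂P := by
          refine lintegral_mono fun ω => ?_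
          simp only [g]
          have hwt : Measurable (w t) := (hw t ht).mono (ℱ.le _) le_rfl
          rw [lintegral_const_mul]
          · calc _ ≤ A.indicator (M t) ω * 1 := by
                  gcongr
                  exact lintegral_exp_selfNormIncr_le hwt hσ (hb t ht) (hmean t ht) (a ω)
                    (leverage_nonneg hlam _ _)
              _ = _ := mul_one _
          · have h1 : Measurable fun ω' => (w t ω').ofLp := (WithLp.measurable_ofLp 2 _).comp hwt
            refine ENNReal.measurable_ofReal.comp (Real.measurable_exp.comp (Measurable.div_const
              ?_ 2))
            unfold selfNormIncr
            exact (((((measurable_dotProduct measurable_const h1).const_mul 2).sub_const _).add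
              ((measurable_dotProduct h1 h1).const_mul _)).div_const _).div_const _ |>.sub_const _
  have hville := measure_exists_le_mul_le_one ℱ hMm h0 hstep (ENNReal.ofReal (1 / b))
  have hset : {ω | ∃ t ≤ T, 2 * Real.log (1 / b) ≤ L t ω}
      = {ω | ∃ t ≤ T, ENNReal.ofReal (1 / b) ≤ M t ω} := by
    ext ω
    refine exists_congr fun t => and_congr_right fun _ => ?_
    simp only [hM]
    rw [ENNReal.ofReal_le_ofReal_iff (by positivity), ← Real.log_le_iff_le_exp (by positivity)]
    constructor <;> intro h <;> linarith
  rw [hset]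
  rw [one_div, ENNReal.ofReal_inv_of_pos hb0] at hville ⊢
  have hbne : ENNReal.ofReal b ≠ 0 := by simpa using hb0
  calc P {ω | ∃ t ≤ T, (ENNReal.ofReal b)⁻¹ ≤ M t ω}
      = ENNReal.ofReal b
          * ((ENNReal.ofReal b)⁻¹ * P {ω | ∃ t ≤ T, (ENNReal.ofReal b)⁻¹ ≤ M t ω}) := by
        rw [← mul_assoc, ENNReal.mul_inv_cancel hbne ENNReal.ofReal_ne_top, one_mul]
    _ ≤ ENNReal.ofReal b * 1 := by gcongr
    _ = _ := mul_one _

end SelfNormalized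

/-! ### Expectations of bounded bilinear forms -/

section BoundedForms

variable {Ω : Type*} [mΩ : MeasurableSpace Ω] {P : Measure Ω} [IsProbabilityMeasure P] {n : ℕ}

lemma continuous_bilinForm (B : LinearMap.BilinForm ℝ (State n)) :
    Continuous fun p : State n × State n => B p.1 p.2 :=
  (LinearMap.toContinuousBilinearMap B).continuous₂

lemma measurable_bilinForm {α : Type*} [MeasurableSpace α] (B : LinearMap.BilinForm ℝ (State n))
    {X Y : α → State n} (hX : Measurable X) (hY : Measurable Y) :
    Measurable fun ω => B (X ω) (Y ω) :=
  (continuous_bilinForm B).measurable.comp (hX.prodMk hY)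

lemma integrable_bilinForm (B : LinearMap.BilinForm ℝ (State n)) {X Y : Ω → State n}
    (hX : Measurable X) (hY : Measurable Y) {a b : ℝ} (ha : ∀ᵐ ω ∂P, ‖X ω‖ ≤ a)
    (hb : ∀ᵐ ω ∂P, ‖Y ω‖ ≤ b) : Integrable (fun ω => B (X ω) (Y ω)) P := by
  refine Integrable.of_bound (measurable_bilinForm B hX hY).aestronglyMeasurable
    (‖LinearMap.toContinuousBilinearMap B‖ * a * b) ?_
  filter_upwards [ha, hb] with ω h1 h2
  refine ((LinearMap.toContinuousBilinearMap B).le_opNorm₂ (X ω) (Y ω)).trans ?_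
  have := norm_nonneg (X ω)
  have : 0 ≤ a := this.trans h1
  gcongr

/-- Independent noise with mean zero adds its own contribution to the expectation of a quadratic
form. -/
lemma integral_bilinForm_add (B : LinearMap.BilinForm ℝ (State n)) {X W : Ω → State n}
    (hX : Measurable X) (hW : Measurable W) {a b : ℝ} (ha : ∀ᵐ ω ∂P, ‖X ω‖ ≤ a)
    (hb : ∀ᵐ ω ∂P, ‖W ω‖ ≤ b) (hind : IndepFun X W P) (hmean : ∫ ω, W ω ∂P = 0) :
    ∫ ω, B (X ω + W ω) (X ω + W ω) ∂P = ∫ ω, B (X ω) (X ω) ∂P + ∫ ω, B (W ω) (W ω) ∂P := by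
  have h1 := integrable_bilinForm (P := P) B hX hX ha ha
  have h2 := integrable_bilinForm (P := P) B hX hW ha hb
  have h3 := integrable_bilinForm (P := P) B hW hX hb ha
  have h4 := integrable_bilinForm (P := P) B hW hW hb hb
  have iX := integrable_of_norm_le hX ha
  have iW := integrable_of_norm_le hW hb
  have e1 : ∫ ω, B (X ω) (W ω) ∂P = 0 := by
    have := hind.integral_bilin iX iW (LinearMap.toContinuousBilinearMap B)
    simpa [hmean] using this
  have e2 : ∫ ω, B (W ω) (X ω) ∂P = 0 := by
    have := hind.symm.integral_bilin iW iX (LinearMap.toContinuousBilinearMap B)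
    simpa [hmean] using this
  have e : ∀ ω, B (X ω + W ω) (X ω + W ω)
      = (B (X ω) (X ω) + B (X ω) (W ω)) + (B (W ω) (X ω) + B (W ω) (W ω)) := by
    intro ω
    simp only [map_add, LinearMap.add_apply]
    ring
  simp only [e]
  have e3 := integral_add (h1.add h2) (h3.add h4)
  simp only [Pi.add_apply] at e3
  rw [e3, integral_add h1 h2, integral_add h3 h4, e1, e2]
  ring

end BoundedForms

/-! ### Measurability of trajectories -/

section Trajectory

variable {n d : ℕ} {S : LQSystem n d}

lemma trajectory_congr (Θ : Param n d) (π : Policy n d) (x : State n) {w w' : ℕ → State n} {h : ℕ}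
    (hw : ∀ i < h, w i = w' i) : trajectory Θ π x w h = trajectory Θ π x w' h := by
  induction h with
  | zero => rfl
  | succ h ih => simp only [trajectory, ih fun i hi => hw i (by omega), hw h (by omega)]

lemma trajectory_gainPolicy_succ (H : ℕ) (Θ Θ' : Param n d) (x : State n) (w : ℕ → State n)
    (h : ℕ) : trajectory Θ (S.gainPolicy H Θ') x w (h + 1)
      = closedLoop Θ (S.gain H Θ' h) (trajectory Θ (S.gainPolicy H Θ') x w h) + w h := rfl

variable {α : Type*} [MeasurableSpace α]

lemma measurable_trajectory (Θ : Param n d) {π : Policy n d} (hπ : ∀ h, Measurable (π h))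
    (x : State n) {w : ℕ → α → State n} {h : ℕ} (hw : ∀ i < h, Measurable (w i)) :
    Measurable fun a => trajectory Θ π x (fun i => w i a) h := by
  induction h with
  | zero => exact measurable_const
  | succ h ih =>
    have ih := ih fun i hi => hw i (by omega)
    exact ((measurable_toEuclideanLin (MeasurableEntries.const _) ih).add
      (measurable_toEuclideanLin (MeasurableEntries.const _) ((hπ h).comp ih))).add
      (hw h (by omega))

lemma measurable_stageCost {x : α → State n} {u : α → Control d} (hx : Measurable x)
    (hu : Measurable u) : Measurable fun a => S.stageCost (x a) (u a) :=
  (measurable_quad (MeasurableEntries.const S.Q) ((WithLp.measurable_ofLp 2 _).comp hx)).add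
    (measurable_quad (MeasurableEntries.const S.R) ((WithLp.measurable_ofLp 2 _).comp hu))

lemma measurableEntries_dynA {p : α → Param n d} (hp : MeasurableEntries p) :
    MeasurableEntries fun a => dynA (p a) := fun _ _ => hp _ _

lemma measurableEntries_dynB {p : α → Param n d} (hp : MeasurableEntries p) :
    MeasurableEntries fun a => dynB (p a) := fun _ _ => hp _ _

lemma measurableEntries_riccati {p : α → Param n d} (hp : MeasurableEntries p) (m : ℕ) :
    MeasurableEntries fun a => S.riccati (p a) m := by
  have hA := measurableEntries_dynA hp
  have hB := measurableEntries_dynB hp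
  induction m with
  | zero => exact MeasurableEntries.const _
  | succ m ih =>
    exact ((MeasurableEntries.const _).add ((hA.transpose.mul ih).mul hA)).sub
      ((((((hA.transpose.mul ih).mul hB).mul ((MeasurableEntries.const _).add
        ((hB.transpose.mul ih).mul hB)).inv).mul hB.transpose).mul ih).mul hA)

lemma measurableEntries_gain {p : α → Param n d} (hp : MeasurableEntries p) (H h : ℕ) :
    MeasurableEntries fun a => S.gain H (p a) h := by
  have hA := measurableEntries_dynA hp
  have hB := measurableEntries_dynB hp
  have hP := measurableEntries_riccati (S := S) hp (H - (h + 1))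
  exact ((((((MeasurableEntries.const _).add
    ((hB.transpose.mul hP).mul hB)).inv).mul hB.transpose).mul hP).mul hA).neg

lemma measurable_closedLoop {p : α → Param n d} {K : α → Matrix (Fin d) (Fin n) ℝ} {x : α → State n}
    (hp : MeasurableEntries p) (hK : MeasurableEntries K) (hx : Measurable x) :
    Measurable fun a => closedLoop (p a) (K a) (x a) :=
  (measurable_toEuclideanLin (measurableEntries_dynA hp) hx).add
    (measurable_toEuclideanLin (measurableEntries_dynB hp) (measurable_toEuclideanLin hK hx))

lemma measurable_trajectory_gainPolicy (Θ : Param n d) (H : ℕ) {p : α → Param n d}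
    (hp : MeasurableEntries p) {x : α → State n} (hx : Measurable x) {w : ℕ → α → State n} {h : ℕ}
    (hw : ∀ i < h, Measurable (w i)) :
    Measurable fun a => trajectory Θ (S.gainPolicy H (p a)) (x a) (fun i => w i a) h := by
  induction h with
  | zero => exact hx
  | succ h ih =>
    have ih := ih fun i hi => hw i (by omega)
    exact (measurable_closedLoop (MeasurableEntries.const _) (measurableEntries_gain hp H h) ih).add
      (hw h (by omega))

/-- The accumulated one-step prediction error of the parameter `Θ`, along a trajectory of the true
system that is controlled by the gains of `Θ`. -/
def predError (S : LQSystem n d) (H : ℕ) (Θ : Param n d) (x : State n) (w : ℕ → State n) : ℝ :=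
  ∑ h ∈ Finset.range H,
    ‖closedLoop S.Θstar (S.gain H Θ h) (trajectory S.Θstar (S.gainPolicy H Θ) x w h)
      - closedLoop Θ (S.gain H Θ h) (trajectory S.Θstar (S.gainPolicy H Θ) x w h)‖

lemma predError_nonneg (H : ℕ) (Θ : Param n d) (x : State n) (w : ℕ → State n) :
    0 ≤ predError S H Θ x w := Finset.sum_nonneg fun _ _ => norm_nonneg _

lemma predError_congr (H : ℕ) (Θ : Param n d) (x : State n) {w w' : ℕ → State n}
    (hw : ∀ i < H, w i = w' i) : predError S H Θ x w = predError S H Θ x w' := by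
  refine Finset.sum_congr rfl fun h hh => ?_
  have : h < H := Finset.mem_range.1 hh
  rw [trajectory_congr S.Θstar (S.gainPolicy H Θ) x (w := w) (w' := w')
    fun i hi => hw i (by omega)]

lemma measurable_predError (H : ℕ) {p : α → Param n d} (hp : MeasurableEntries p)
    {x : α → State n} (hx : Measurable x) {w : ℕ → α → State n} (hw : ∀ i < H, Measurable (w i)) :
    Measurable fun a => predError S H (p a) (x a) (fun i => w i a) := by
  refine Finset.measurable_sum _ fun h hh => ?_
  have hh : h < H := Finset.mem_range.1 hh
  have ht := measurable_trajectory_gainPolicy (S := S) S.Θstar H hp hx (h := h)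
    fun i hi => hw i (by omega)
  have hK := measurableEntries_gain (S := S) hp H h
  exact ((measurable_closedLoop (MeasurableEntries.const _) hK ht).sub
    (measurable_closedLoop hp hK ht)).norm

end Trajectory

/-! ### Bounds for the closed loop -/

section ClosedLoopBounds

variable {n d H : ℕ} {S : LQSystem n d} {C CA CB Cw γ : ℝ}

lemma LQSystem.Bounded.C_nonneg (hS : S.Bounded H C CA CB Cw γ) : 0 ≤ C :=
  (opNorm_nonneg _).trans hS.norm_Q_le

lemma norm_gain_le (hS : S.Bounded H C CA CB Cw γ) {Θ : Param n d} (hΘ : Θ ∈ paramSet n d)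
    {h : ℕ} (hh : h < H) (x : State n) : ‖Matrix.toEuclideanLin (S.gain H Θ h) x‖ ≤ γ * ‖x‖ :=
  (norm_toEuclideanLin_le _ x).trans
    (mul_le_mul_of_nonneg_right (hS.gain_le Θ hΘ h hh) (norm_nonneg x))

/-- Under the gains of any parameter in `paramSet`, the true system contracts by `1 - Cw`. -/
lemma norm_closedLoop_star_le (hS : S.Bounded H C CA CB Cw γ) {Θ : Param n d}
    (hΘ : Θ ∈ paramSet n d) {h : ℕ} (hh : h < H) (x : State n) :
    ‖closedLoop S.Θstar (S.gain H Θ h) x‖ ≤ (1 - Cw) * ‖x‖ := by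
  have h1 : ‖Matrix.toEuclideanLin (dynA S.Θstar) x‖ ≤ CA * ‖x‖ :=
    (norm_toEuclideanLin_le _ x).trans (mul_le_mul_of_nonneg_right hS.norm_A_le (norm_nonneg x))
  have hCB : 0 ≤ CB := (opNorm_nonneg _).trans hS.norm_B_le
  have h2 : ‖Matrix.toEuclideanLin (dynB S.Θstar) (Matrix.toEuclideanLin (S.gain H Θ h) x)‖
      ≤ CB * (γ * ‖x‖) :=
    (norm_toEuclideanLin_le _ _).trans
      (mul_le_mul hS.norm_B_le (norm_gain_le hS hΘ hh x) (norm_nonneg _) hCB)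
  rw [closedLoop_apply]
  refine (norm_add_le _ _).trans ((add_le_add h1 h2).trans ?_)
  have := hS.sum_le_one
  have h0 := norm_nonneg x
  nlinarith

lemma norm_trajectory_star_le (hS : S.Bounded H C CA CB Cw γ) {Θ : Param n d}
    (hΘ : Θ ∈ paramSet n d) {x : State n} (hx : ‖x‖ ≤ 1) {w : ℕ → State n}
    (hw : ∀ h < H, ‖w h‖ ≤ Cw) {h : ℕ} (hh : h ≤ H) :
    ‖trajectory S.Θstar (S.gainPolicy H Θ) x w h‖ ≤ 1 := by
  induction h with
  | zero => exact hx
  | succ h ih =>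
    have ih := ih (by omega)
    rw [trajectory_gainPolicy_succ]
    refine (norm_add_le _ _).trans ?_
    have h1 := norm_closedLoop_star_le hS hΘ (show h < H by omega)
      (trajectory S.Θstar (S.gainPolicy H Θ) x w h)
    have h2 := hw h (by omega)
    have h3 := hS.Cw_lt_one
    nlinarith

lemma norm_closedLoop_sub_sq (Θ Θ' : Param n d) (K : Matrix (Fin d) (Fin n) ℝ) (x : State n) :
    ‖closedLoop Θ K x - closedLoop Θ' K x‖ ^ 2
      = ∑ j, ((fun i => (Θ - Θ') i j) ⬝ᵥ joinVec x (Matrix.toEuclideanLin K x)) ^ 2 :=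
  norm_sq_dyn_sub Θ Θ' x _

lemma joinVec_gain_le (hS : S.Bounded H C CA CB Cw γ) {Θ : Param n d}
    (hΘ : Θ ∈ paramSet n d) {h : ℕ} (hh : h < H) {x : State n} (hx : ‖x‖ ≤ 1) :
    joinVec x (Matrix.toEuclideanLin (S.gain H Θ h) x)
      ⬝ᵥ joinVec x (Matrix.toEuclideanLin (S.gain H Θ h) x) ≤ 1 + γ ^ 2 := by
  rw [joinVec_dotProduct_self]
  have h1 := norm_gain_le hS hΘ hh x
  have h2 : ‖Matrix.toEuclideanLin (S.gain H Θ h) x‖ ^ 2 ≤ (γ * ‖x‖) ^ 2 := by gcongr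
  have h3 : ‖x‖ ^ 2 ≤ 1 := by have := norm_nonneg x; nlinarith
  rw [mul_pow] at h2
  have := sq_nonneg γ
  nlinarith

lemma norm_closedLoop_sub_le (hS : S.Bounded H C CA CB Cw γ) {Θ : Param n d}
    (hΘ : Θ ∈ paramSet n d) {h : ℕ} (hh : h < H) {x : State n} (hx : ‖x‖ ≤ 1) :
    ‖closedLoop S.Θstar (S.gain H Θ h) x - closedLoop Θ (S.gain H Θ h) x‖ ≤ 2 * (1 + γ ^ 2) := by
  refine le_of_sq_le_sq ?_ (by positivity)
  rw [norm_closedLoop_sub_sq]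
  refine (sum_sq_dotProduct_le_frobNorm _ _).trans ?_
  have h1 := joinVec_gain_le hS hΘ hh hx
  have h2 : frobNorm (S.Θstar - Θ) ≤ 2 := by
    have := frobNorm_sub_le S.Θstar Θ
    have := hS.star_mem.1
    have := hΘ.1
    linarith
  have h3 := frobNorm_nonneg (S.Θstar - Θ)
  have h4 : frobNorm (S.Θstar - Θ) ^ 2 ≤ 2 ^ 2 := by gcongr
  have h5 : 0 ≤ γ ^ 2 := sq_nonneg γ
  calc frobNorm (S.Θstar - Θ) ^ 2 * _ ≤ frobNorm (S.Θstar - Θ) ^ 2 * (1 + γ ^ 2) := by gcongr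
    _ ≤ 2 ^ 2 * (1 + γ ^ 2) := by gcongr
    _ ≤ _ := by nlinarith

lemma predError_le (hS : S.Bounded H C CA CB Cw γ) {Θ : Param n d}
    (hΘ : Θ ∈ paramSet n d) {x : State n} (hx : ‖x‖ ≤ 1) {w : ℕ → State n}
    (hw : ∀ h < H, ‖w h‖ ≤ Cw) : predError S H Θ x w ≤ H * (2 * (1 + γ ^ 2)) := by
  have : ∀ h ∈ Finset.range H,
      ‖closedLoop S.Θstar (S.gain H Θ h) (trajectory S.Θstar (S.gainPolicy H Θ) x w h)
        - closedLoop Θ (S.gain H Θ h) (trajectory S.Θstar (S.gainPolicy H Θ) x w h)‖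
      ≤ 2 * (1 + γ ^ 2) := fun h hh =>
    norm_closedLoop_sub_le hS hΘ (Finset.mem_range.1 hh)
      (norm_trajectory_star_le hS hΘ hx hw (Finset.mem_range.1 hh).le)
  simpa [predError] using Finset.sum_le_sum this

lemma stageCost_gain_le (hS : S.Bounded H C CA CB Cw γ) {Θ : Param n d} (hΘ : Θ ∈ paramSet n d)
    {h : ℕ} (hh : h < H) (x : State n) :
    S.stageCost x (Matrix.toEuclideanLin (S.gain H Θ h) x) ≤ C * (1 + γ ^ 2) * ‖x‖ ^ 2 :=
  stageCost_le hS.norm_Q_le hS.norm_R_le (norm_gain_le hS hΘ hh x)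

variable (S) in
/-- The mixed cost between the model `Θ` and the true system, both under the gains of `Θ`. -/
def modelMixedCost (Θ : Param n d) (m : ℕ) : LinearMap.BilinForm ℝ (State n) :=
  mixedCost (S.stageForm Θ) (fun m => closedLoop Θ (S.gainAt Θ m))
    (fun m => closedLoop S.Θstar (S.gainAt Θ m)) m

variable (S) in
/-- The potential that compares the model `Θ` with the true system under the gains of `Θ`. -/
def modelPotential (Θ : Param n d) (m : ℕ) : LinearMap.BilinForm ℝ (State n) :=
  potential (S.stageForm Θ) (fun m => closedLoop Θ (S.gainAt Θ m))
    (fun m => closedLoop S.Θstar (S.gainAt Θ m)) m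

lemma modelPotential_le (hS : S.Bounded H C CA CB Cw γ) (Θ : Param n d) (m : ℕ) (x : State n) :
    modelPotential S Θ m x x ≤ quad (S.riccati Θ m) x.ofLp := by
  rw [← mixedCost_closedLoop_self Θ hS.posDef_Q hS.posDef_R]
  refine potential_le (fun m x => ?_) (fun m x y => ?_) m x
  · rw [stageForm_self]; exact stageCost_nonneg hS.posDef_Q hS.posDef_R _ _
  · exact stageForm_comm Θ hS.posDef_Q hS.posDef_R m x y

/-- The cost of the true system under the gains of `Θ` is bounded independently of the horizon, by
the contraction. -/
lemma trueCost_le (hS : S.Bounded H C CA CB Cw γ) {Θ : Param n d} (hΘ : Θ ∈ paramSet n d)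
    {m : ℕ} (hm : m ≤ H) (x : State n) :
    mixedCost (S.stageForm Θ) (fun m => closedLoop S.Θstar (S.gainAt Θ m))
      (fun m => closedLoop S.Θstar (S.gainAt Θ m)) m x x ≤ C * (1 + γ ^ 2) / Cw * ‖x‖ ^ 2 := by
  have hC := hS.C_nonneg
  have hCw := hS.Cw_pos
  have hCw1 := hS.Cw_lt_one
  induction m generalizing x with
  | zero =>
    rw [mixedCost_zero]
    positivity
  | succ m ih =>
    have hidx : H - (H - (m + 1) + 1) = m := by omega
    have hg : S.gain H Θ (H - (m + 1)) = S.gainAt Θ m := by rw [gain_eq_gainAt, hidx]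
    rw [mixedCost_succ, stageForm_self]
    have h1 := stageCost_gain_le hS hΘ (show H - (m + 1) < H by omega) x
    have h2 := norm_closedLoop_star_le hS hΘ (show H - (m + 1) < H by omega) x
    rw [hg] at h1 h2
    refine (add_le_add h1 (ih (by omega) _)).trans ?_
    have h3 : ‖closedLoop S.Θstar (S.gainAt Θ m) x‖ ^ 2 ≤ ((1 - Cw) * ‖x‖) ^ 2 := by gcongr
    have h4 : C * (1 + γ ^ 2) / Cw * ‖closedLoop S.Θstar (S.gainAt Θ m) x‖ ^ 2
        ≤ C * (1 + γ ^ 2) / Cw * ((1 - Cw) * ‖x‖ ^ 2) := by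
      gcongr
      refine h3.trans ?_
      rw [mul_pow]
      gcongr
      nlinarith
    have h5 : C * (1 + γ ^ 2) / Cw * ‖x‖ ^ 2
        = C * (1 + γ ^ 2) * ‖x‖ ^ 2 + C * (1 + γ ^ 2) / Cw * ((1 - Cw) * ‖x‖ ^ 2) := by
      field_simp; ring
    linarith

/-- The mixed cost is linear in its first argument with a constant of order `√H`: the model's own
cost-to-go may be of order `H`, as the model need not be stable, but the true system's is
bounded. -/
lemma two_mul_modelMixedCost_le (hS : S.Bounded H C CA CB Cw γ) {Θ : Param n d}
    (hΘ : Θ ∈ paramSet n d) {m : ℕ} (hm : m ≤ H) (hH : 0 < H) (y : State n) {x : State n}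
    (hx : ‖x‖ ≤ 1) :
    2 * modelMixedCost S Θ m y x ≤ √(H : ℝ) * (C + C * (1 + γ ^ 2) / Cw) * ‖y‖ := by
  rcases eq_or_ne y 0 with rfl | hy
  · simp
  have hC := hS.C_nonneg
  have hCw := hS.Cw_pos
  have hy0 : 0 < ‖y‖ := norm_pos_iff.2 hy
  have hH0 : 0 < √(H : ℝ) := Real.sqrt_pos.2 (by exact_mod_cast hH)
  have hHH : √(H : ℝ) * √(H : ℝ) = H := Real.mul_self_sqrt (by positivity)
  have h := two_mul_mixedCost_le (F := S.stageForm Θ)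
    (S := fun m => closedLoop Θ (S.gainAt Θ m))
    (T := fun m => closedLoop S.Θstar (S.gainAt Θ m))
    (fun m x => by rw [stageForm_self]; exact stageCost_nonneg hS.posDef_Q hS.posDef_R _ _)
    (fun m x y => stageForm_comm Θ hS.posDef_Q hS.posDef_R m x y)
    -- this weight balances the two costs
    (s := (√(H : ℝ) * ‖y‖)⁻¹) (by positivity) m y x
  rw [mixedCost_closedLoop_self Θ hS.posDef_Q hS.posDef_R, inv_inv] at h
  refine h.trans ?_
  have h1 := riccati_le Θ hS.posDef_Q hS.posDef_R hS.norm_Q_le hΘ.1 m y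
  have h2 := trueCost_le hS hΘ hm x
  have h3 : (√(H : ℝ) * ‖y‖)⁻¹ * quad (S.riccati Θ m) y.ofLp ≤ √(H : ℝ) * C * ‖y‖ := by
    rw [inv_mul_le_iff₀ (by positivity)]
    refine h1.trans ?_
    have : √(H : ℝ) * ‖y‖ * (√(H : ℝ) * C * ‖y‖) = H * C * ‖y‖ ^ 2 := by
      linear_combination (C * ‖y‖ ^ 2) * hHH
    rw [this]
    gcongr
  have h4 : C * (1 + γ ^ 2) / Cw * ‖x‖ ^ 2 ≤ C * (1 + γ ^ 2) / Cw * 1 := by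
    gcongr
    have := norm_nonneg x
    nlinarith
  have h5 := mul_le_mul_of_nonneg_left (h2.trans h4) (by positivity : 0 ≤ √(H : ℝ) * ‖y‖)
  calc _ ≤ √(H : ℝ) * C * ‖y‖ + √(H : ℝ) * ‖y‖ * (C * (1 + γ ^ 2) / Cw * 1) := add_le_add h3 h5
    _ = _ := by ring

end ClosedLoopBounds

/-! ### The cost of an episode -/

section Episode

variable {Ω : Type*} [mΩ : MeasurableSpace Ω] {n d : ℕ}

/-- Bounded centered noise of one episode: `w h` is drawn after the information `𝒢 h` and known at
`𝒢 (h + 1)`. -/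
structure EpisodeNoise (P : Measure Ω) (𝒢 : ℕ → MeasurableSpace Ω) (w : ℕ → Ω → State n) (H : ℕ)
    (Cw : ℝ) : Prop where
  mono : Monotone 𝒢
  le : ∀ i, 𝒢 i ≤ mΩ
  measurable : ∀ h < H, Measurable[𝒢 (h + 1)] (w h)
  indep : ∀ h < H, Indep (MeasurableSpace.comap (w h) inferInstance) (𝒢 h) P
  mean : ∀ h < H, ∫ ω, w h ω ∂P = 0
  bound : ∀ h < H, ∀ᵐ ω ∂P, ‖w h ω‖ ≤ Cw

variable {P : Measure Ω} {𝒢 : ℕ → MeasurableSpace Ω} {w : ℕ → Ω → State n} {H : ℕ} {Cw : ℝ}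
  {S : LQSystem n d}

namespace EpisodeNoise

lemma measurable_before (hw : EpisodeNoise P 𝒢 w H Cw) {h : ℕ} (hh : h ≤ H) :
    ∀ i < h, Measurable[𝒢 h] (w i) := fun i hi =>
  (hw.measurable i (by omega)).mono (hw.mono (by omega)) le_rfl

lemma measurable' (hw : EpisodeNoise P 𝒢 w H Cw) {h : ℕ} (hh : h < H) : Measurable (w h) :=
  (hw.measurable h hh).mono (hw.le _) le_rfl

lemma bound_all (hw : EpisodeNoise P 𝒢 w H Cw) : ∀ᵐ ω ∂P, ∀ h < H, ‖w h ω‖ ≤ Cw := by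
  refine ae_all_iff.2 fun h => ?_
  by_cases hh : h < H
  · filter_upwards [hw.bound h hh] with ω hω _ using hω
  · exact Filter.Eventually.of_forall fun ω h => absurd h hh

end EpisodeNoise

/-- The contribution of the noise from step `h` on to the optimal cost of the system `Θ`. -/
def noiseCost (S : LQSystem n d) (P : Measure Ω) (w : ℕ → Ω → State n) (H : ℕ) (Θ : Param n d)
    (h : ℕ) : ℝ :=
  ∑ i ∈ Finset.Ico h H, ∫ ω, quad (S.riccati Θ (H - (i + 1))) (w i ω).ofLp ∂P

lemma noiseCost_nonneg (hQ : S.Q.PosDef) (hR : S.R.PosDef) (Θ : Param n d) (h : ℕ) :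
    0 ≤ noiseCost S P w H Θ h :=
  Finset.sum_nonneg fun _ _ => integral_nonneg fun _ => quad_nonneg (riccati_posSemidef Θ hQ hR _) _

variable {C CA CB γ : ℝ}

lemma measurable_gainPolicy (S : LQSystem n d) (H : ℕ) (Θ : Param n d) (h : ℕ) :
    Measurable (S.gainPolicy H Θ h) :=
  measurable_toEuclideanLin (MeasurableEntries.const _) measurable_id

lemma ae_episodeCost_le (hS : S.Bounded H C CA CB Cw γ) (hw : EpisodeNoise P 𝒢 w H Cw)
    {Θ : Param n d} (hΘ : Θ ∈ paramSet n d) {x : State n} (hx : ‖x‖ ≤ 1) :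
    ∀ᵐ ω ∂P, S.episodeCost H S.Θstar (S.gainPolicy H Θ) x (fun h => w h ω)
      ≤ H * (C * (1 + γ ^ 2)) := by
  filter_upwards [hw.bound_all] with ω hω
  have : ∀ h ∈ Finset.range H,
      S.stageCost (trajectory S.Θstar (S.gainPolicy H Θ) x (fun h => w h ω) h)
        (S.gainPolicy H Θ h (trajectory S.Θstar (S.gainPolicy H Θ) x (fun h => w h ω) h))
      ≤ C * (1 + γ ^ 2) := by
    intro h hh
    have hh := Finset.mem_range.1 hh
    refine (stageCost_gain_le hS hΘ hh _).trans ?_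
    have h1 := norm_trajectory_star_le hS hΘ hx hω hh.le
    have h2 := norm_nonneg (trajectory S.Θstar (S.gainPolicy H Θ) x (fun h => w h ω) h)
    have h3 := hS.C_nonneg
    have h4 : 0 ≤ C * (1 + γ ^ 2) := by positivity
    exact mul_le_of_le_one_right h4 (pow_le_one₀ h2 h1)
  simpa [LQSystem.episodeCost] using Finset.sum_le_sum this

variable [IsProbabilityMeasure P]

/-- Lower bound on the cost of every policy: the Riccati value plus the cost accumulated so far
does not decrease in expectation. -/
theorem le_expCost (hQ : S.Q.PosDef) (hR : S.R.PosDef) (hw : EpisodeNoise P 𝒢 w H Cw)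
    (Θ : Param n d) {π : Policy n d} (hπ : ∀ h, Measurable (π h)) (x : State n) :
    ENNReal.ofReal (quad (S.riccati Θ H) x.ofLp + noiseCost S P w H Θ 0)
      ≤ S.expCost P w H Θ π x := by
  set X : ℕ → Ω → State n := fun h ω => trajectory Θ π x (fun i => w i ω) h with hX
  set c : ℕ → Ω → ℝ := fun h ω => S.stageCost (X h ω) (π h (X h ω)) with hc
  have hXm : ∀ h ≤ H, Measurable[𝒢 h] (X h) := fun h hh =>
    @measurable_trajectory n d Ω (𝒢 h) Θ π hπ x w h (hw.measurable_before hh)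
  have hcm : ∀ h ≤ H, Measurable[𝒢 h] (c h) := fun h hh =>
    @measurable_stageCost n d S Ω (𝒢 h) _ _ (hXm h hh) ((hπ h).comp (hXm h hh))
  have hc0 : ∀ h ω, 0 ≤ c h ω := fun h ω => stageCost_nonneg hQ hR _ _
  have main : ∀ h ≤ H, ENNReal.ofReal (quad (S.riccati Θ H) x.ofLp + noiseCost S P w H Θ 0)
      ≤ ∫⁻ ω, ENNReal.ofReal (∑ i ∈ Finset.range h, c i ω
          + (quad (S.riccati Θ (H - h)) (X h ω).ofLp + noiseCost S P w H Θ h)) ∂P := by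
    intro h hh
    induction h with
    | zero => simp [hX, trajectory]
    | succ h ih =>
      refine (ih (by omega)).trans ?_
      have hlt : h < H := by omega
      set M := S.riccati Θ (H - (h + 1)) with hM
      have hMpsd : M.PosSemidef := riccati_posSemidef Θ hQ hR _
      set Y : Ω → State n := fun ω => Matrix.toEuclideanLin (dynA Θ) (X h ω)
        + Matrix.toEuclideanLin (dynB Θ) (π h (X h ω)) with hY
      set s : Ω → ℝ := fun ω => ∑ i ∈ Finset.range (h + 1), c i ω with hs
      have hYm : Measurable[𝒢 h] Y :=
        (@measurable_toEuclideanLin Ω (𝒢 h) _ _ _ _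
          (@MeasurableEntries.const Ω _ _ (𝒢 h) _) (hXm h hlt.le)).add
        (@measurable_toEuclideanLin Ω (𝒢 h) _ _ _ _
          (@MeasurableEntries.const Ω _ _ (𝒢 h) _) ((hπ h).comp (hXm h hlt.le)))
      have hsm : Measurable[𝒢 h] s := Finset.measurable_sum _ fun i hi => by
        have : i < h + 1 := Finset.mem_range.1 hi
        exact (hcm i (by omega)).mono (hw.mono (by omega)) le_rfl
      let g : Ω × State n → ENNReal := fun p => ENNReal.ofReal
        (s p.1 + (quad M (Y p.1 + p.2).ofLp + noiseCost S P w H Θ (h + 1)))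
      have hg : Measurable[(𝒢 h).prod inferInstance] g := by
        let _ : MeasurableSpace Ω := 𝒢 h
        have h1 : Measurable fun p : Ω × State n => Y p.1 := hYm.comp measurable_fst
        have h2 : Measurable fun p : Ω × State n => s p.1 := hsm.comp measurable_fst
        exact ENNReal.measurable_ofReal.comp (h2.add ((measurable_quad (MeasurableEntries.const M)
          ((WithLp.measurable_ofLp 2 _).comp (h1.add measurable_snd))).add_const _))
      have hfr := lintegral_freeze (hw.le h) (hw.measurable' hlt) (hw.indep h hlt) hg
      have hRHS : ∫⁻ ω, ENNReal.ofReal (∑ i ∈ Finset.range (h + 1), c i ω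
          + (quad M (X (h + 1) ω).ofLp + noiseCost S P w H Θ (h + 1))) ∂P
          = ∫⁻ ω, g (ω, w h ω) ∂P := rfl
      rw [hRHS, hfr]
      refine lintegral_mono fun ω => ?_
      have hint : Integrable (fun ω' => quad M (Y ω + w h ω').ofLp) P := by
        have hm : Measurable fun ω' => Y ω + w h ω' := (hw.measurable' hlt).const_add (Y ω)
        have hb : ∀ᵐ ω' ∂P, ‖Y ω + w h ω'‖ ≤ ‖Y ω‖ + Cw := by
          filter_upwards [hw.bound h hlt] with ω' h'
          exact (norm_add_le _ _).trans (by gcongr)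
        exact integrable_bilinForm (matForm M) hm hm hb hb
      have hval : ∫ ω', quad M (Y ω + w h ω').ofLp ∂P
          = quad M (Y ω).ofLp + ∫ ω', quad M (w h ω').ofLp ∂P := by
        have := integral_bilinForm_add (P := P) (matForm M) (X := fun _ => Y ω) measurable_const
          (hw.measurable' hlt) (a := ‖Y ω‖) (by simp) (hw.bound h hlt)
          (indepFun_const_left _ _) (hw.mean h hlt)
        rw [integral_const, probReal_univ, one_smul] at this
        exact this
      have hinner : ∫⁻ ω', g (ω, w h ω') ∂P = ENNReal.ofReal (s ω + (quad M (Y ω).ofLp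
          + ∫ ω', quad M (w h ω').ofLp ∂P + noiseCost S P w H Θ (h + 1))) := by
        have hint' : Integrable (fun ω' => s ω + (quad M (Y ω + w h ω').ofLp
            + noiseCost S P w H Θ (h + 1))) P :=
          (integrable_const _).add (hint.add (integrable_const _))
        have hval' : ∫ ω', (s ω + (quad M (Y ω + w h ω').ofLp
            + noiseCost S P w H Θ (h + 1))) ∂P
            = s ω + (∫ ω', quad M (Y ω + w h ω').ofLp ∂P + noiseCost S P w H Θ (h + 1)) := by
          have e1 := integral_add (integrable_const (μ := P) (s ω))
            (hint.add (integrable_const (noiseCost S P w H Θ (h + 1))))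
          have e2 := integral_add hint (integrable_const (noiseCost S P w H Θ (h + 1)))
          simp only [Pi.add_apply, integral_const, probReal_univ, one_smul] at e1 e2
          rw [e1, e2]
        rw [← hval, ← hval', ofReal_integral_eq_lintegral_ofReal hint']
        · refine Filter.Eventually.of_forall fun ω' => ?_
          have h1 : 0 ≤ s ω := Finset.sum_nonneg fun i _ => hc0 i ω
          have h2 := quad_nonneg hMpsd (Y ω + w h ω').ofLp
          have h3 := noiseCost_nonneg (P := P) (w := w) (H := H) hQ hR Θ (h + 1)
          positivity
      rw [hinner]
      refine ENNReal.ofReal_le_ofReal ?_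
      have hidx : H - h = (H - (h + 1)) + 1 := by omega
      have hbell := riccati_succ_le Θ hQ hR (H - (h + 1)) (X h ω) (π h (X h ω))
      have hnc : noiseCost S P w H Θ h
          = ∫ ω', quad M (w h ω').ofLp ∂P + noiseCost S P w H Θ (h + 1) :=
        Finset.sum_eq_sum_Ico_succ_bot hlt _
      have hssum : s ω = ∑ i ∈ Finset.range h, c i ω + c h ω := Finset.sum_range_succ _ _
      rw [hidx, hnc, hssum]
      change quad (S.riccati Θ (H - (h + 1) + 1)) (X h ω).ofLp ≤ c h ω + quad M (Y ω).ofLp at hbell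
      linarith
  refine (main H le_rfl).trans (lintegral_mono fun ω => ?_)
  refine ENNReal.ofReal_le_ofReal (le_of_eq ?_)
  simp [noiseCost, LQSystem.riccati, quad, LQSystem.episodeCost, hc, hX]

/-- The trivial bound on the cost of an episode. -/
lemma expCost_star_le (hS : S.Bounded H C CA CB Cw γ) (hw : EpisodeNoise P 𝒢 w H Cw)
    {Θ : Param n d} (hΘ : Θ ∈ paramSet n d) {x : State n} (hx : ‖x‖ ≤ 1) :
    S.expCost P w H S.Θstar (S.gainPolicy H Θ) x ≤ ENNReal.ofReal (H * (C * (1 + γ ^ 2))) := by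
  refine (lintegral_mono_ae ?_).trans (by rw [lintegral_const, measure_univ, mul_one])
  filter_upwards [ae_episodeCost_le hS hw hΘ hx] with ω hω using ENNReal.ofReal_le_ofReal hω

/-- The cost of the true system under the gains of `Θ` exceeds the optimal cost of the model `Θ` by
at most the expected prediction error, times a constant of order `√H`. -/
theorem expCost_star_toReal_le (hS : S.Bounded H C CA CB Cw γ) (hw : EpisodeNoise P 𝒢 w H Cw)
    {Θ : Param n d} (hΘ : Θ ∈ paramSet n d) {x : State n} (hx : ‖x‖ ≤ 1) (hH : 0 < H) :
    (S.expCost P w H S.Θstar (S.gainPolicy H Θ) x).toReal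
      ≤ quad (S.riccati Θ H) x.ofLp + noiseCost S P w H Θ 0
        + √(H : ℝ) * (C + C * (1 + γ ^ 2) / Cw) * ∫ ω, predError S H Θ x (fun h => w h ω) ∂P := by
  set X : ℕ → Ω → State n :=
    fun h ω => trajectory S.Θstar (S.gainPolicy H Θ) x (fun i => w i ω) h with hX
  have hXm' : ∀ h ≤ H, Measurable[𝒢 h] (X h) := fun h hh =>
    @measurable_trajectory n d Ω (𝒢 h) S.Θstar _ (measurable_gainPolicy S H Θ) x w h
      (hw.measurable_before hh)
  have hXm : ∀ h ≤ H, Measurable (X h) := fun h hh => (hXm' h hh).mono (hw.le h) le_rfl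
  have hXb : ∀ h ≤ H, ∀ᵐ ω ∂P, ‖X h ω‖ ≤ 1 := fun h hh => by
    filter_upwards [hw.bound_all] with ω hω
    exact norm_trajectory_star_le hS hΘ hx hω hh
  set F : ℕ → Ω → ℝ := fun h ω => S.stageForm Θ (H - (h + 1)) (X h ω) (X h ω) with hF
  set TX : ℕ → Ω → State n := fun h ω => closedLoop S.Θstar (S.gain H Θ h) (X h ω) with hTX
  set D : ℕ → Ω → State n := fun h ω => TX h ω - closedLoop Θ (S.gain H Θ h) (X h ω) with hD
  have hTXm : ∀ h ≤ H, Measurable (TX h) := fun h hh =>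
    measurable_closedLoop (MeasurableEntries.const _) (MeasurableEntries.const _) (hXm h hh)
  have hTXm' : ∀ h ≤ H, Measurable[𝒢 h] (TX h) := fun h hh =>
    @measurable_closedLoop n d Ω (𝒢 h) _ _ _ (@MeasurableEntries.const Ω _ _ (𝒢 h) _)
      (@MeasurableEntries.const Ω _ _ (𝒢 h) _) (hXm' h hh)
  have hDm : ∀ h ≤ H, Measurable (D h) := fun h hh => (hTXm h hh).sub
    (measurable_closedLoop (MeasurableEntries.const _) (MeasurableEntries.const _) (hXm h hh))
  have hTXb : ∀ h < H, ∀ᵐ ω ∂P, ‖TX h ω‖ ≤ 1 := fun h hh => by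
    filter_upwards [hXb h hh.le] with ω hω
    refine (norm_closedLoop_star_le hS hΘ hh _).trans ?_
    have := hS.Cw_pos
    have := hS.Cw_lt_one
    have := norm_nonneg (X h ω)
    nlinarith
  have hDb : ∀ h < H, ∀ᵐ ω ∂P, ‖D h ω‖ ≤ 2 * (1 + γ ^ 2) := fun h hh => by
    filter_upwards [hXb h hh.le] with ω hω
    exact norm_closedLoop_sub_le hS hΘ hh hω
  have hFint : ∀ h < H, Integrable (F h) P := fun h hh =>
    integrable_bilinForm _ (hXm h hh.le) (hXm h hh.le) (hXb h hh.le) (hXb h hh.le)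
  have hDint : ∀ h < H, Integrable (fun ω => ‖D h ω‖) P := fun h hh =>
    (integrable_of_norm_le (hDm h hh.le) (hDb h hh)).norm
  set G := √(H : ℝ) * (C + C * (1 + γ ^ 2) / Cw) with hG
  -- the expected potential, which telescopes
  set a : ℕ → ℝ := fun h => ∫ ω, modelPotential S Θ (H - h) (X h ω) (X h ω) ∂P with ha
  have hstep : ∀ h < H, ∫ ω, F h ω ∂P ≤ (a h - a (h + 1))
      + ∫ ω, quad (S.riccati Θ (H - (h + 1))) (w h ω).ofLp ∂P + G * ∫ ω, ‖D h ω‖ ∂P := by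
    intro h hh
    set m := H - (h + 1) with hm
    have hidx : H - h = m + 1 := by omega
    have e1 : a (h + 1) = ∫ ω, modelPotential S Θ m (TX h ω) (TX h ω) ∂P
        + ∫ ω, modelPotential S Θ m (w h ω) (w h ω) ∂P := by
      exact integral_bilinForm_add _ (hTXm h hh.le) (hw.measurable' hh) (hTXb h hh)
        (hw.bound h hh) (indepFun_of_indep_comap (hw.indep h hh) (hTXm' h hh.le)) (hw.mean h hh)
    have e2 : ∀ ω, F h ω = modelPotential S Θ (H - h) (X h ω) (X h ω)
        - modelPotential S Θ m (TX h ω) (TX h ω)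
        + 2 * modelMixedCost S Θ m (D h ω) (TX h ω) := by
      intro ω
      have := potential_succ (F := S.stageForm Θ) (S := fun m => closedLoop Θ (S.gainAt Θ m))
        (T := fun m => closedLoop S.Θstar (S.gainAt Θ m)) m (X h ω)
      rw [hidx]
      change modelPotential S Θ (m + 1) (X h ω) (X h ω) = F h ω
        + modelPotential S Θ m (TX h ω) (TX h ω)
        - 2 * modelMixedCost S Θ m (D h ω) (TX h ω) at this
      linarith
    have i1 : Integrable (fun ω => modelPotential S Θ (H - h) (X h ω) (X h ω)) P :=
      integrable_bilinForm _ (hXm h hh.le) (hXm h hh.le) (hXb h hh.le) (hXb h hh.le)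
    have i2 : Integrable (fun ω => modelPotential S Θ m (TX h ω) (TX h ω)) P :=
      integrable_bilinForm _ (hTXm h hh.le) (hTXm h hh.le) (hTXb h hh) (hTXb h hh)
    have i3 : Integrable (fun ω => 2 * modelMixedCost S Θ m (D h ω) (TX h ω)) P :=
      (integrable_bilinForm _ (hDm h hh.le) (hTXm h hh.le) (hDb h hh) (hTXb h hh)).const_mul 2
    have e3 : ∫ ω, F h ω ∂P = a h - ∫ ω, modelPotential S Θ m (TX h ω) (TX h ω) ∂P
        + ∫ ω, 2 * modelMixedCost S Θ m (D h ω) (TX h ω) ∂P := by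
      have e4 := integral_add (i1.sub i2) i3
      simp only [Pi.sub_apply] at e4
      rw [integral_congr_ae (Filter.Eventually.of_forall e2), e4, integral_sub i1 i2]
    have h5 : ∫ ω, 2 * modelMixedCost S Θ m (D h ω) (TX h ω) ∂P ≤ G * ∫ ω, ‖D h ω‖ ∂P := by
      rw [← integral_const_mul]
      refine integral_mono_ae i3 ((hDint h hh).const_mul G) ?_
      filter_upwards [hTXb h hh] with ω hω
      exact two_mul_modelMixedCost_le hS hΘ (by omega) hH (D h ω) hω
    have h6 : ∫ ω, modelPotential S Θ m (w h ω) (w h ω) ∂P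
        ≤ ∫ ω, quad (S.riccati Θ m) (w h ω).ofLp ∂P := by
      refine integral_mono
        (integrable_bilinForm _ (hw.measurable' hh) (hw.measurable' hh) (hw.bound h hh)
          (hw.bound h hh))
        (integrable_bilinForm (matForm (S.riccati Θ m)) (hw.measurable' hh) (hw.measurable' hh)
          (hw.bound h hh) (hw.bound h hh)) fun ω => modelPotential_le hS Θ m _
    linarith
  have hcost : ∀ ω, S.episodeCost H S.Θstar (S.gainPolicy H Θ) x (fun h => w h ω)
      = ∑ h ∈ Finset.range H, F h ω := fun ω => rfl
  have hcostm : Measurable fun ω => ∑ h ∈ Finset.range H, F h ω :=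
    Finset.measurable_sum _ fun h hh =>
      measurable_bilinForm _ (hXm h (Finset.mem_range.1 hh).le) (hXm h (Finset.mem_range.1 hh).le)
  have e0 : (S.expCost P w H S.Θstar (S.gainPolicy H Θ) x).toReal
      = ∑ h ∈ Finset.range H, ∫ ω, F h ω ∂P := by
    rw [LQSystem.expCost, ← integral_finsetSum _ fun h hh => hFint h (Finset.mem_range.1 hh)]
    simp only [hcost]
    rw [integral_eq_lintegral_of_nonneg_ae _ hcostm.aestronglyMeasurable]
    refine Filter.Eventually.of_forall fun ω => Finset.sum_nonneg fun h _ => ?_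
    exact stageCost_nonneg hS.posDef_Q hS.posDef_R _ _
  rw [e0]
  refine (Finset.sum_le_sum fun h hh => hstep h (Finset.mem_range.1 hh)).trans ?_
  rw [Finset.sum_add_distrib, Finset.sum_add_distrib, Finset.sum_range_sub', ← Finset.mul_sum]
  have e5 : ∫ ω, predError S H Θ x (fun h => w h ω) ∂P
      = ∑ h ∈ Finset.range H, ∫ ω, ‖D h ω‖ ∂P :=
    integral_finsetSum _ fun h hh => hDint h (Finset.mem_range.1 hh)
  have e6 : a H = 0 := by
    simp [ha, modelPotential, potential_apply]
  have e7 : a 0 ≤ quad (S.riccati Θ H) x.ofLp := by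
    have : a 0 = modelPotential S Θ H x x := by simp [ha, hX, trajectory]
    rw [this]
    exact modelPotential_le hS Θ H x
  have e8 : noiseCost S P w H Θ 0
      = ∑ h ∈ Finset.range H, ∫ ω, quad (S.riccati Θ (H - (h + 1))) (w h ω).ofLp ∂P := by
    rw [noiseCost, Finset.range_eq_Ico]
  rw [e5, e6, e8]
  linarith

end Episode

/-! ### A multiplicative concentration inequality -/

section BlockConcentration

variable {Ω E α : Type*} [mΩ : MeasurableSpace Ω] {P : Measure Ω} [IsProbabilityMeasure P]
  [MeasurableSpace E] [MeasurableSpace α]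

lemma measurable_integral_freeze {W : Ω → E} (hW : Measurable W) {f : α × E → ℝ}
    (hf : Measurable f) : Measurable fun a => ∫ ω, f (a, W ω) ∂P := by
  have h : Measurable fun p : α × Ω => f (p.1, W p.2) :=
    hf.comp (measurable_fst.prodMk (hW.comp measurable_snd))
  exact (h.stronglyMeasurable.integral_prod_right' (ν := P)).measurable

lemma exp_neg_le_one_sub_half {u : ℝ} (h0 : 0 ≤ u) (h1 : u ≤ 1) : Real.exp (-u) ≤ 1 - u / 2 := by
  have h2 : 1 + u ≤ Real.exp u := by linarith [Real.add_one_le_exp u]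
  rw [Real.exp_neg, inv_le_iff_one_le_mul₀ (Real.exp_pos u)]
  nlinarith

/-- A sum of nonnegative bounded variables is, with high probability, at least half the sum of
their conditional expectations, up to a term of the size of one variable. The variable of block `k`
is a function `f k` of the information `𝒦 k` before the block and of the noise `W k` of the
block. -/
theorem measure_sum_integral_freeze_gt_le {𝒦 : ℕ → MeasurableSpace Ω} (hmono : Monotone 𝒦)
    (hle : ∀ k, 𝒦 k ≤ mΩ) {K : ℕ} {W : ℕ → Ω → E} (hW : ∀ k < K, Measurable[𝒦 (k + 1)] (W k))
    (hind : ∀ k < K, Indep (MeasurableSpace.comap (W k) inferInstance) (𝒦 k) P)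
    {f : ℕ → Ω × E → ℝ} (hf : ∀ k < K, Measurable[(𝒦 k).prod inferInstance] (f k))
    {b : ℝ} (hb : 0 < b) (hf0 : ∀ k < K, ∀ p, 0 ≤ f k p) (hfb : ∀ k < K, ∀ p, f k p ≤ b)
    {β : ℝ} (hβ : 0 < β) :
    P {ω | 2 * ∑ k ∈ Finset.range K, f k (ω, W k ω) + 2 * b * Real.log (1 / β)
      < ∑ k ∈ Finset.range K, ∫ ω', f k (ω, W k ω') ∂P} ≤ ENNReal.ofReal β := by
  set m : ℕ → Ω → ℝ := fun k ω => ∫ ω', f k (ω, W k ω') ∂P with hm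
  -- `exp (Z k)` has expectation at most `1`, as `E e⁻ᵘ ≤ 1 - E u / 2 ≤ e ^ (-E u / 2)` on `[0, 1]`
  set Z : ℕ → Ω → ℝ :=
    fun k ω => ∑ j ∈ Finset.range k, (m j ω / 2 - f j (ω, W j ω)) / b with hZ
  have hWm : ∀ k < K, Measurable (W k) := fun k hk => (hW k hk).mono (hle _) le_rfl
  have hmm : ∀ k < K, Measurable[𝒦 k] (m k) := fun k hk =>
    @measurable_integral_freeze Ω E Ω mΩ P _ _ (𝒦 k) (W k) (hWm k hk) (f k) (hf k hk)
  have hfm : ∀ k < K, Measurable[𝒦 (k + 1)] fun ω => f k (ω, W k ω) := fun k hk =>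
    (hf k hk).comp (@Measurable.prodMk _ (𝒦 (k + 1)) _ _ (𝒦 k) _ _ _
      (measurable_id'' (hmono (Nat.le_succ k))) (hW k hk))
  have hZm : ∀ k ≤ K, Measurable[𝒦 k] (Z k) := fun k hk =>
    Finset.measurable_sum _ fun j hj => by
      have hj := Finset.mem_range.1 hj
      exact ((((hmm j (by omega)).mono (hmono (by omega)) le_rfl).div_const 2).sub
        ((hfm j (by omega)).mono (hmono (by omega)) le_rfl)).div_const b
  have main : ∀ k ≤ K, ∫⁻ ω, ENNReal.ofReal (Real.exp (Z k ω)) ∂P ≤ 1 := by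
    intro k hk
    induction k with
    | zero => simp [hZ]
    | succ k ih =>
      refine le_trans ?_ (ih (by omega))
      have hk' : k < K := by omega
      let g : Ω × E → ENNReal := fun p => ENNReal.ofReal (Real.exp (Z k p.1 + m k p.1 / 2 / b))
        * ENNReal.ofReal (Real.exp (-(f k p / b)))
      have hg : Measurable[(𝒦 k).prod inferInstance] g := by
        have hfk := hf k hk'
        let _ : MeasurableSpace Ω := 𝒦 k
        have h1 : Measurable fun p : Ω × E => Z k p.1 := (hZm k hk'.le).comp measurable_fst
        have h2 : Measurable fun p : Ω × E => m k p.1 := (hmm k hk').comp measurable_fst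
        exact (ENNReal.measurable_ofReal.comp (Real.measurable_exp.comp
          (h1.add ((h2.div_const 2).div_const b)))).mul
          (ENNReal.measurable_ofReal.comp (Real.measurable_exp.comp (hfk.div_const b).neg))
      have hfr := lintegral_freeze (hle k) (hWm k hk') (hind k hk') hg
      calc ∫⁻ ω, ENNReal.ofReal (Real.exp (Z (k + 1) ω)) ∂P = ∫⁻ ω, g (ω, W k ω) ∂P := by
            refine lintegral_congr fun ω => ?_
            simp only [g]
            rw [← ENNReal.ofReal_mul (Real.exp_pos _).le, ← Real.exp_add]
            congr 2
            simp only [hZ, Finset.sum_range_succ]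
            ring
        _ = ∫⁻ ω, ∫⁻ ω', g (ω, W k ω') ∂P ∂P := hfr
        _ ≤ ∫⁻ ω, ENNReal.ofReal (Real.exp (Z k ω)) ∂P := by
            refine lintegral_mono fun ω => ?_
            simp only [g]
            have hfω : Measurable fun ω' => f k (ω, W k ω') := by
              have hfk := hf k hk'
              have h1 : @Measurable E (Ω × E) _ ((𝒦 k).prod inferInstance) (fun y => (ω, y)) :=
                @measurable_prodMk_left Ω E (𝒦 k) _ ω
              exact (hfk.comp h1).comp (hWm k hk')
            have hb0 : ∀ ω', 0 ≤ f k (ω, W k ω') / b := fun ω' => div_nonneg (hf0 k hk' _) hb.le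
            have hb1 : ∀ ω', f k (ω, W k ω') / b ≤ 1 := fun ω' =>
              (div_le_one hb).2 (hfb k hk' _)
            have hint : Integrable (fun ω' => f k (ω, W k ω')) P :=
              Integrable.of_bound hfω.aestronglyMeasurable b (Filter.Eventually.of_forall fun ω' =>
                by rw [Real.norm_of_nonneg (hf0 k hk' _)]; exact hfb k hk' _)
            have hexpm : Measurable fun ω' => Real.exp (-(f k (ω, W k ω') / b)) :=
              Real.measurable_exp.comp (hfω.div_const b).neg
            have hinte : Integrable (fun ω' => Real.exp (-(f k (ω, W k ω') / b))) P :=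
              Integrable.of_bound hexpm.aestronglyMeasurable 1 <|
                Filter.Eventually.of_forall fun ω' => by
                  rw [Real.norm_of_nonneg (Real.exp_pos _).le, Real.exp_le_one_iff]
                  linarith [hb0 ω']
            rw [lintegral_const_mul _ hexpm.ennreal_ofReal,
              ← ofReal_integral_eq_lintegral_ofReal hinte
                (Filter.Eventually.of_forall fun _ => (Real.exp_pos _).le),
              ← ENNReal.ofReal_mul (Real.exp_pos _).le]
            refine ENNReal.ofReal_le_ofReal ?_
            have hI : ∫ ω', Real.exp (-(f k (ω, W k ω') / b)) ∂P ≤ 1 - m k ω / 2 / b := by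
              have h1 : ∫ ω', (1 - f k (ω, W k ω') / b / 2) ∂P = 1 - m k ω / 2 / b := by
                rw [integral_sub (integrable_const _) ((hint.div_const b).div_const 2),
                  integral_div, integral_div]
                simp only [integral_const, probReal_univ, one_smul, hm]
                ring
              rw [← h1]
              exact integral_mono hinte ((integrable_const _).sub ((hint.div_const b).div_const 2))
                fun ω' => exp_neg_le_one_sub_half (hb0 ω') (hb1 ω')
            calc Real.exp (Z k ω + m k ω / 2 / b) * ∫ ω', Real.exp (-(f k (ω, W k ω') / b)) ∂P
                ≤ Real.exp (Z k ω + m k ω / 2 / b) * Real.exp (-(m k ω / 2 / b)) := by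
                  gcongr
                  refine hI.trans ?_
                  linarith [Real.add_one_le_exp (-(m k ω / 2 / b))]
              _ = Real.exp (Z k ω) := by rw [← Real.exp_add]; congr 1; ring
  have hZK : Measurable fun ω => ENNReal.ofReal (Real.exp (Z K ω)) :=
    ENNReal.measurable_ofReal.comp (Real.measurable_exp.comp ((hZm K le_rfl).mono (hle K) le_rfl))
  have hmarkov := mul_meas_ge_le_lintegral (μ := P) hZK (ENNReal.ofReal (1 / β))
  have hsub : {ω | 2 * ∑ k ∈ Finset.range K, f k (ω, W k ω) + 2 * b * Real.log (1 / β)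
      < ∑ k ∈ Finset.range K, m k ω}
      ⊆ {ω | ENNReal.ofReal (1 / β) ≤ ENNReal.ofReal (Real.exp (Z K ω))} := by
    intro ω hω
    have hω : 2 * ∑ k ∈ Finset.range K, f k (ω, W k ω) + 2 * b * Real.log (1 / β)
      < ∑ k ∈ Finset.range K, m k ω := hω
    refine ENNReal.ofReal_le_ofReal ?_
    rw [← Real.log_le_iff_le_exp (by positivity)]
    simp only [hZ]
    rw [← Finset.sum_div, Finset.sum_sub_distrib, ← Finset.sum_div, le_div_iff₀ hb]
    linarith
  refine (measure_mono hsub).trans ?_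
  rw [one_div, ENNReal.ofReal_inv_of_pos hβ] at hmarkov ⊢
  have hβne : ENNReal.ofReal β ≠ 0 := by simpa using hβ
  set A := {ω | (ENNReal.ofReal β)⁻¹ ≤ ENNReal.ofReal (Real.exp (Z K ω))}
  calc P A = ENNReal.ofReal β * ((ENNReal.ofReal β)⁻¹ * P A) := by
        rw [← mul_assoc, ENNReal.mul_inv_cancel hβne ENNReal.ofReal_ne_top, one_mul]
    _ ≤ ENNReal.ofReal β * 1 := by
        gcongr
        exact hmarkov.trans (main K le_rfl)
    _ = _ := mul_one _

end BlockConcentration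

/-! ### The elliptical potential -/

section EllipticalPotential

variable {ι : Type*} [Fintype ι] [DecidableEq ι]

lemma log_det_gram_mono {lam : ℝ} (hlam : 0 < lam) (z : ℕ → ι → ℝ) {s t : ℕ} (h : s ≤ t) :
    Real.log (gram lam z s).det ≤ Real.log (gram lam z t).det := by
  refine monotone_nat_of_le_succ (f := fun t => Real.log (gram lam z t).det) (fun t => ?_) h
  have h0 := leverage_nonneg hlam z t
  have := Real.log_nonneg (show 1 ≤ 1 + leverage lam z t by linarith)
  simp only [log_det_gram_succ hlam z t]
  linarith

/-- The inverse Gram norms at two times compare by the ratio of the determinants. -/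
lemma quad_inv_gram_le {lam : ℝ} (hlam : 0 < lam) (z : ℕ → ι → ℝ) (b j : ℕ) (y : ι → ℝ) :
    quad (gram lam z b)⁻¹ y ≤ Real.exp (Real.log (gram lam z (b + j)).det
      - Real.log (gram lam z b).det) * quad (gram lam z (b + j))⁻¹ y := by
  induction j with
  | zero => simp
  | succ j ih =>
    refine ih.trans ?_
    have h1 := quad_inv_le_mul_quad_inv_add_vecMulVec (posDef_gram hlam z (b + j)) (z (b + j)) y
    have h0 := leverage_nonneg hlam z (b + j)
    rw [← gram_succ] at h1
    rw [← add_assoc, log_det_gram_succ hlam]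
    have h2 : Real.exp (Real.log (gram lam z (b + j)).det + Real.log (1 + leverage lam z (b + j))
        - Real.log (gram lam z b).det)
        = Real.exp (Real.log (gram lam z (b + j)).det - Real.log (gram lam z b).det)
          * (1 + leverage lam z (b + j)) := by
      rw [add_sub_right_comm, Real.exp_add, Real.exp_log (by linarith)]
    rw [h2, mul_assoc]
    gcongr
    exact h1

/-- In a block over which the Gram determinant at most doubles, the norms frozen at the start of
the block are controlled by the increments of the logarithm of the determinant. -/
lemma quad_inv_gram_le_log {lam : ℝ} (hlam : 0 < lam) (z : ℕ → ι → ℝ) {b j H : ℕ} (hj : j < H)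
    (hgood : Real.log (gram lam z (b + H)).det - Real.log (gram lam z b).det ≤ Real.log 2) :
    quad (gram lam z b)⁻¹ (z (b + j)) ≤ 4 * Real.log (1 + leverage lam z (b + j)) := by
  set q := leverage lam z (b + j) with hq
  have hq0 : 0 ≤ q := leverage_nonneg hlam z (b + j)
  have h1 := quad_inv_gram_le hlam z b j (z (b + j))
  have h2 := log_det_gram_mono hlam z (show b ≤ b + j by omega)
  have h3 := log_det_gram_mono hlam z (show b + j + 1 ≤ b + H by omega)
  rw [log_det_gram_succ hlam, ← hq] at h3
  have h4 : Real.exp (Real.log (gram lam z (b + j)).det - Real.log (gram lam z b).det) ≤ 2 := by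
    rw [← Real.le_log_iff_exp_le (by norm_num)]
    have := Real.log_nonneg (show 1 ≤ 1 + q by linarith)
    linarith
  have h5 : q ≤ 1 := by
    have : Real.log (1 + q) ≤ Real.log 2 := by linarith
    have := (Real.log_le_log_iff (by positivity) (by norm_num)).1 this
    linarith
  have h6 : q / 2 ≤ Real.log (1 + q) := by
    have := Real.one_sub_inv_le_log_of_pos (x := 1 + q) (by positivity)
    refine le_trans ?_ this
    have h7 : 1 - (1 + q)⁻¹ = q / (1 + q) := by field_simp; ring
    rw [h7]
    gcongr
    linarith
  have h8 : quad (gram lam z (b + j))⁻¹ (z (b + j)) = q := rfl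
  rw [h8] at h1
  nlinarith

lemma log_det_gram_add {lam : ℝ} (hlam : 0 < lam) (z : ℕ → ι → ℝ) (b H : ℕ) :
    ∑ j ∈ Finset.range H, Real.log (1 + leverage lam z (b + j))
      = Real.log (gram lam z (b + H)).det - Real.log (gram lam z b).det := by
  induction H with
  | zero => simp
  | succ H ih => rw [Finset.sum_range_succ, ih, ← add_assoc, log_det_gram_succ hlam]; ring

lemma log_one_add_mul_le {L x : ℝ} (hL : 1 ≤ L) (hx : 0 ≤ x) :
    Real.log (1 + L * x) ≤ L * Real.log (1 + x) := by
  have h := one_add_mul_self_le_rpow_one_add (by linarith : -1 ≤ x) hL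
  rw [← Real.log_rpow (by positivity)]
  exact Real.log_le_log (by positivity) h

lemma log_det_gram_sub_le [Nonempty ι] {lam : ℝ} (hlam : 0 < lam) {z : ℕ → ι → ℝ} {T : ℕ} {L : ℝ}
    (hL : 1 ≤ L) (hz : ∀ t < T, z t ⬝ᵥ z t ≤ L) :
    Real.log (gram lam z T).det - Real.log (gram lam z 0).det
      ≤ L * (Fintype.card ι * Real.log (1 + T / (Fintype.card ι * lam))) := by
  have hN : (0 : ℝ) < Fintype.card ι := by exact_mod_cast Fintype.card_pos
  have htr : (gram lam z T).trace ≤ Fintype.card ι * (lam + T * L / Fintype.card ι) := by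
    rw [gram, Matrix.trace_add, Matrix.trace_smul, Matrix.trace_one, Matrix.trace_sum]
    simp only [Matrix.trace_vecMulVec, smul_eq_mul]
    have h1 : ∑ i ∈ Finset.range T, z i ⬝ᵥ z i ≤ T * L := by
      simpa using Finset.sum_le_sum fun i hi => hz i (Finset.mem_range.1 hi)
    have h2 : (Fintype.card ι : ℝ) * (lam + T * L / Fintype.card ι)
        = lam * Fintype.card ι + T * L := by
      field_simp
    rw [h2]
    linarith
  have h0 : Real.log (gram lam z 0).det = Fintype.card ι * Real.log lam := by
    simp [gram]
  have h1 := log_det_le_card_mul_log (posDef_gram hlam z T)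
    (c := lam + T * L / Fintype.card ι) (by positivity) htr
  have h2 : Real.log (lam + T * L / Fintype.card ι)
      = Real.log lam + Real.log (1 + L * (T / (Fintype.card ι * lam))) := by
    rw [← Real.log_mul hlam.ne' (by positivity)]
    congr 1
    field_simp
  rw [h2] at h1
  have h3 := log_one_add_mul_le hL (show 0 ≤ (T : ℝ) / (Fintype.card ι * lam) by positivity)
  rw [h0]
  have h4 := mul_le_mul_of_nonneg_left h3 hN.le
  linarith

/-- The elliptical potential argument with parameters that change only between blocks. A block over
which the Gram determinant more than doubles is bounded trivially by its length; there are few such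
blocks. -/
lemma sum_error_le {lam : ℝ} (hlam : 0 < lam) (z : ℕ → ι → ℝ) {K H : ℕ} {e : ℕ → ℕ → ℝ} {B b : ℝ}
    (hB : 0 ≤ B) (hb : 0 ≤ b) (heb : ∀ k < K, ∀ h < H, e k h ≤ b)
    (he : ∀ k < K, ∀ h < H, e k h ^ 2 ≤ B ^ 2 * quad (gram lam z (k * H))⁻¹ (z (k * H + h))) :
    ∑ k ∈ Finset.range K, ∑ h ∈ Finset.range H, e k h
      ≤ 2 * B * √((H : ℝ) * K * (Real.log (gram lam z (K * H)).det
            - Real.log (gram lam z 0).det))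
        + 2 * H * b * (Real.log (gram lam z (K * H)).det - Real.log (gram lam z 0).det) := by
  set ℓ : ℕ → ℝ := fun k => Real.log (gram lam z ((k + 1) * H)).det
    - Real.log (gram lam z (k * H)).det with hℓ
  have hℓ0 : ∀ k, 0 ≤ ℓ k := fun k =>
    sub_nonneg.2 (log_det_gram_mono hlam z (Nat.mul_le_mul_right H (Nat.le_succ k)))
  have hsum : ∑ k ∈ Finset.range K, ℓ k
      = Real.log (gram lam z (K * H)).det - Real.log (gram lam z 0).det := by
    have := Finset.sum_range_sub (fun k => Real.log (gram lam z (k * H)).det) K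
    simpa [hℓ] using this
  have hblock : ∀ k < K, ∑ h ∈ Finset.range H, e k h
      ≤ 2 * B * √(H * ℓ k) + 2 * H * b * ℓ k := by
    intro k hk
    have hidx : (k + 1) * H = k * H + H := by ring
    have hH0 : (0 : ℝ) ≤ H := Nat.cast_nonneg H
    by_cases hgood : ℓ k ≤ Real.log 2
    -- Cauchy-Schwarz within the block
    · have h1 : (∑ h ∈ Finset.range H, e k h) ^ 2 ≤ (2 * B * √(H * ℓ k)) ^ 2 := by
        have h2 := sq_sum_le_card_mul_sum_sq (s := Finset.range H) (f := fun h => e k h)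
        rw [Finset.card_range] at h2
        refine h2.trans ?_
        have h3 : ∑ h ∈ Finset.range H, e k h ^ 2 ≤ B ^ 2 * (4 * ℓ k) := by
          have h4 : ℓ k = ∑ j ∈ Finset.range H, Real.log (1 + leverage lam z (k * H + j)) := by
            rw [log_det_gram_add hlam, hℓ, ← hidx]
          rw [h4, Finset.mul_sum, Finset.mul_sum]
          refine Finset.sum_le_sum fun h hh => (he k hk h (Finset.mem_range.1 hh)).trans ?_
          gcongr
          refine quad_inv_gram_le_log hlam z (Finset.mem_range.1 hh) ?_
          rw [← hidx]
          exact hgood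
        rw [mul_pow, mul_pow, Real.sq_sqrt (mul_nonneg hH0 (hℓ0 k))]
        calc (H : ℝ) * ∑ h ∈ Finset.range H, e k h ^ 2 ≤ H * (B ^ 2 * (4 * ℓ k)) := by gcongr
          _ = _ := by ring
      have h5 := (abs_le.1 (abs_le_of_sq_le_sq h1 (by positivity))).2
      have := hℓ0 k
      have : 0 ≤ 2 * H * b * ℓ k := by positivity
      linarith
    -- the trivial bound is paid for by `ℓ k > log 2 ≥ 1 / 2`
    · have h1 : ∑ h ∈ Finset.range H, e k h ≤ H * b := by
        simpa using Finset.sum_le_sum fun h hh => heb k hk h (Finset.mem_range.1 hh)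
      have h2 : 1 / 2 ≤ ℓ k := by
        have := Real.log_two_gt_d9
        linarith
      have h3 : (H : ℝ) * b ≤ 2 * H * b * ℓ k := by nlinarith [mul_nonneg hH0 hb]
      have : 0 ≤ 2 * B * √(H * ℓ k) := by positivity
      linarith
  refine (Finset.sum_le_sum fun k hk => hblock k (Finset.mem_range.1 hk)).trans ?_
  rw [Finset.sum_add_distrib, ← Finset.mul_sum, ← Finset.mul_sum, hsum]
  gcongr
  rw [← hsum]
  refine Real.le_sqrt_of_sq_le ?_
  have h2 := sq_sum_le_card_mul_sum_sq (s := Finset.range K) (f := fun k => √(H * ℓ k))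
  rw [Finset.card_range] at h2
  refine h2.trans (le_of_eq ?_)
  have h3 : ∀ k ∈ Finset.range K, √(H * ℓ k) ^ 2 = H * ℓ k := fun k _ =>
    Real.sq_sqrt (mul_nonneg (Nat.cast_nonneg H) (hℓ0 k))
  rw [Finset.sum_congr rfl h3, ← Finset.mul_sum]
  ring

end EllipticalPotential

/-! ### Confidence sets -/

section ConfidenceSet

variable {n d : ℕ} {Ω : Type*} (I : Interaction n d Ω) (S : LQSystem n d) (H : ℕ)

/-- The state-control vectors of all episodes as one sequence. -/
def flatVec (t : ℕ) (ω : Ω) : Fin n ⊕ Fin d → ℝ :=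
  joinVec (I.state S H (t / H) (t % H) ω) (I.control S H (t / H) (t % H) ω)

/-- The noise of all episodes as one sequence. -/
def flatNoise (t : ℕ) (ω : Ω) : State n := I.noise (t / H) (t % H) ω

variable {H}

lemma flat_div_mod {k h : ℕ} (hh : h < H) : (k * H + h) / H = k ∧ (k * H + h) % H = h := by
  have hH : 0 < H := by omega
  constructor
  · rw [mul_comm, Nat.mul_add_div hH, Nat.div_eq_of_lt hh, add_zero]
  · rw [mul_comm, Nat.mul_add_mod, Nat.mod_eq_of_lt hh]

lemma sum_range_mul_eq {M : Type*} [AddCommMonoid M] (k : ℕ) (f : ℕ → ℕ → M) :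
    ∑ i ∈ Finset.range (k * H), f (i / H) (i % H) = ∑ p : Fin k × Fin H, f p.1 p.2 := by
  rw [Finset.sum_range]
  refine (Fintype.sum_equiv finProdFinEquiv _ _ fun p => ?_).symm
  have h := flat_div_mod (k := p.1) p.2.2
  have h2 : (finProdFinEquiv p : ℕ) = p.1 * H + p.2 := by
    rw [finProdFinEquiv_apply_val]; ring
  rw [h2, h.1, h.2]

lemma transpose_Z_mul_Z (k : ℕ) (ω : Ω) :
    (I.Z S H k ω)ᵀ * I.Z S H k ω = ∑ i ∈ Finset.range (k * H),
      Matrix.vecMulVec (flatVec I S H i ω) (flatVec I S H i ω) := by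
  have := sum_range_mul_eq (H := H) k fun a b => Matrix.vecMulVec
    (joinVec (I.state S H a b ω) (I.control S H a b ω))
    (joinVec (I.state S H a b ω) (I.control S H a b ω))
  unfold flatVec
  rw [this]
  ext a b
  rw [Matrix.mul_apply, Matrix.sum_apply]
  rfl

lemma transpose_Z_mul_Xnext (k : ℕ) (ω : Ω) :
    (I.Z S H k ω)ᵀ * I.Xnext S H k ω = (I.Z S H k ω)ᵀ * I.Z S H k ω * S.Θstar
      + crossGram (fun i => flatVec I S H i ω) (fun i => (flatNoise I H i ω).ofLp) (k * H) := by
  have := sum_range_mul_eq (H := H) k fun a b => Matrix.vecMulVec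
    (joinVec (I.state S H a b ω) (I.control S H a b ω)) (I.noise a b ω).ofLp
  unfold crossGram flatVec flatNoise
  rw [this, Matrix.mul_assoc]
  ext a j
  rw [Matrix.add_apply, Matrix.mul_apply, Matrix.mul_apply, Matrix.sum_apply,
    ← Finset.sum_add_distrib]
  refine Finset.sum_congr rfl fun p _ => ?_
  have h1 : I.Xnext S H k ω p j = (I.Z S H k ω * S.Θstar) p j + (I.noise p.1 p.2 ω).ofLp j := by
    have h2 := dyn_apply S.Θstar (I.state S H p.1 p.2 ω) (I.control S H p.1 p.2 ω) j
    have h3 : I.Xnext S H k ω p j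
        = (Matrix.toEuclideanLin (dynA S.Θstar) (I.state S H p.1 p.2 ω)
          + Matrix.toEuclideanLin (dynB S.Θstar) (I.control S H p.1 p.2 ω)).ofLp j
          + (I.noise p.1 p.2 ω).ofLp j := rfl
    rw [h3, h2, dotProduct_comm]
    rfl
  rw [h1, mul_add]
  rfl

/-- The logarithm of the Gram determinant relative to its initial value. -/
def logDetRatio (lam : ℝ) (t : ℕ) (ω : Ω) : ℝ :=
  Real.log (gram lam (fun i => flatVec I S H i ω) t).det
    - Real.log (gram lam (fun i => flatVec I S H i ω) 0).det

lemma gram_flatVec (lam : ℝ) (k : ℕ) (ω : Ω) :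
    gram lam (fun i => flatVec I S H i ω) (k * H)
      = lam • 1 + (I.Z S H k ω)ᵀ * I.Z S H k ω := by
  rw [gram, transpose_Z_mul_Z]

lemma log_det_one_add_eq {lam : ℝ} (hlam : 0 < lam) (k : ℕ) (ω : Ω) :
    Real.log (1 + lam⁻¹ • ((I.Z S H k ω)ᵀ * I.Z S H k ω)).det
      = logDetRatio I S (H := H) lam (k * H) ω := by
  have h1 : (1 + lam⁻¹ • ((I.Z S H k ω)ᵀ * I.Z S H k ω))
      = lam⁻¹ • gram lam (fun i => flatVec I S H i ω) (k * H) := by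
    rw [gram_flatVec, smul_add, smul_smul, inv_mul_cancel₀ hlam.ne', one_smul]
  have hp := posDef_gram hlam (fun i => flatVec I S H i ω) (k * H)
  rw [h1, Matrix.det_smul, Real.log_mul (by positivity) hp.det_pos.ne', Real.log_pow, Real.log_inv,
    logDetRatio]
  simp [gram]
  ring

variable {I S}

lemma mul_dotProduct_le_quad_of_opNormZ_inv_le {M : Matrix (Fin n ⊕ Fin d) (Fin n ⊕ Fin d) ℝ}
    (hM : M.PosDef) {lam : ℝ} (hlam : 0 < lam) (h : opNormZ M⁻¹ ≤ 1 / lam)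
    (x : Fin n ⊕ Fin d → ℝ) : lam * (x ⬝ᵥ x) ≤ quad M x := by
  have h1 := sq_dotProduct_le_quad_mul_quad_inv hM x x
  have hx0 : 0 ≤ x ⬝ᵥ x := Finset.sum_nonneg fun i _ => mul_self_nonneg (x i)
  have h2 : quad M⁻¹ x ≤ 1 / lam * (x ⬝ᵥ x) :=
    (quad_le_opNormZ _ x).trans (mul_le_mul_of_nonneg_right h hx0)
  have h3 := quad_nonneg hM.posSemidef x
  rcases hx0.eq_or_lt with h0 | h0
  · rw [← h0, mul_zero]; exact h3
  · have h4 : (x ⬝ᵥ x) ^ 2 ≤ quad M x * (1 / lam * (x ⬝ᵥ x)) :=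
      h1.trans (mul_le_mul_of_nonneg_left h2 h3)
    have h5 : quad M x * (1 / lam * (x ⬝ᵥ x)) = quad M x / lam * (x ⬝ᵥ x) := by ring
    rw [h5, sq] at h4
    have h6 := le_of_mul_le_mul_right h4 h0
    rw [le_div_iff₀ hlam] at h6
    linarith

variable {K : ℕ} {lamMax lamMin ν : ℝ} {ω : Ω}

lemma quad_gram_le_quad_V (hlam : 0 < lamMin) (hreg : I.RegularAt K lamMax lamMin ν ω)
    {k : ℕ} (hk : k < K) (x : Fin n ⊕ Fin d → ℝ) :
    quad (gram lamMin (fun i => flatVec I S H i ω) (k * H)) x ≤ quad (I.V S H k ω) x := by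
  obtain ⟨h1, -, h3, -⟩ := hreg k hk
  rw [gram_flatVec, Interaction.V, quad_add_matrix, quad_add_matrix]
  have := mul_dotProduct_le_quad_of_opNormZ_inv_le h1 hlam h3 x
  have h4 : quad (lamMin • 1) x = lamMin * (x ⬝ᵥ x) := by
    simp [quad, Matrix.smul_mulVec]
  rw [h4]
  linarith

lemma posDef_V (hreg : I.RegularAt K lamMax lamMin ν ω) {k : ℕ} (hk : k < K) :
    (I.V S H k ω).PosDef := by
  have h1 := (hreg k hk).1
  unfold Interaction.V
  exact h1.posSemidef_add
    (by simpa using Matrix.posSemidef_conjTranspose_mul_self (I.Z S H k ω))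

lemma quad_inv_V_le (hlam : 0 < lamMin) (hreg : I.RegularAt K lamMax lamMin ν ω)
    {k : ℕ} (hk : k < K) (x : Fin n ⊕ Fin d → ℝ) :
    quad (I.V S H k ω)⁻¹ x
      ≤ quad (gram lamMin (fun i => flatVec I S H i ω) (k * H))⁻¹ x := by
  have := quad_inv_le_of_quad_le (posDef_V (S := S) (H := H) hreg hk)
    (posDef_gram hlam (fun i => flatVec I S H i ω) (k * H)) (c := 1)
    (fun x => by rw [one_mul]; exact quad_gram_le_quad_V hlam hreg hk x) x
  rwa [one_mul] at this

/-- Unless the self-normalized process is large, the true parameter lies in the confidence set. -/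
lemma star_mem_confSet (hn : 0 < n) (hlam : 0 < lamMin) {Cw α : ℝ} (hCw : 0 < Cw)
    (hstar : S.Θstar ∈ paramSet n d)
    (hreg : I.RegularAt K lamMax lamMin ν ω) {k : ℕ} (hk : k < K)
    (hself : selfNormLog Cw lamMin (fun i => flatVec I S H i ω)
      (fun i => (flatNoise I H i ω).ofLp) (k * H) < 2 * Real.log (2 / α)) :
    S.Θstar ∈ I.confSet S H Cw lamMax lamMin ν α k ω := by
  obtain ⟨h1, h2, h3, h4⟩ := hreg k hk
  have hV := posDef_V (S := S) (H := H) hreg hk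
  set V := I.V S H k ω with hVdef
  set N := crossGram (fun i => flatVec I S H i ω) (fun i => (flatNoise I H i ω).ofLp) (k * H)
    with hN
  set G := gram lamMin (fun i => flatVec I S H i ω) (k * H) with hG
  have hGpd : G.PosDef := posDef_gram hlam _ _
  have hdet := (Matrix.isUnit_iff_isUnit_det _).1 hV.isUnit
  -- the estimation error is `V⁻¹ (H Θ_* - Zᵀ W - L)`
  have hdiff : S.Θstar - I.estimate S H k ω
      = V⁻¹ * (I.regH k ω * S.Θstar + (-N + -I.regL k ω)) := by
    have e1 : V⁻¹ * (V * S.Θstar) = S.Θstar := by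
      rw [← Matrix.mul_assoc, Matrix.nonsing_inv_mul _ hdet, Matrix.one_mul]
    have e2 : I.U S H k ω = V * S.Θstar - I.regH k ω * S.Θstar + N + I.regL k ω := by
      rw [Interaction.U, transpose_Z_mul_Xnext, hVdef, Interaction.V, Matrix.add_mul]
      abel
    have e3 : I.estimate S H k ω = V⁻¹ * I.U S H k ω := rfl
    calc S.Θstar - I.estimate S H k ω = V⁻¹ * (V * S.Θstar) - V⁻¹ * I.U S H k ω := by rw [e1, e3]
      _ = V⁻¹ * (V * S.Θstar - I.U S H k ω) := by rw [Matrix.mul_sub]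
      _ = _ := by rw [e2]; congr 1; abel
  have hVH : ∀ x, quad (I.regH k ω) x ≤ 1 * quad V x := fun x => by
    rw [one_mul, hVdef, Interaction.V, quad_add_matrix]
    have := quad_nonneg (M := (I.Z S H k ω)ᵀ * I.Z S H k ω)
      (by simpa using Matrix.posSemidef_conjTranspose_mul_self (I.Z S H k ω)) x
    linarith
  have hVHinv : ∀ x, quad V⁻¹ x ≤ quad (I.regH k ω)⁻¹ x := fun x => by
    simpa using quad_inv_le_of_quad_le hV h1 hVH x
  have hVG : ∀ x, quad V⁻¹ x ≤ quad G⁻¹ x := fun x => quad_inv_V_le hlam hreg hk x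
  have b1 : weightedNorm V⁻¹ (I.regH k ω * S.Θstar) ≤ √lamMax := by
    refine (weightedNorm_le_of_quad_le hVHinv _).trans ?_
    rw [weightedNorm_inv_self_mul h1]
    unfold weightedNorm
    refine Real.sqrt_le_sqrt ?_
    rw [trace_transpose_mul_mul_eq_sum_quad]
    have h5 : ∀ j ∈ Finset.univ, quad (I.regH k ω) (fun i => S.Θstar i j)
        ≤ lamMax * ∑ i, S.Θstar i j ^ 2 := fun j _ => by
      refine (quad_le_opNormZ _ _).trans ?_
      have h6 : (fun i => S.Θstar i j) ⬝ᵥ (fun i => S.Θstar i j) = ∑ i, S.Θstar i j ^ 2 := by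
        simp [dotProduct, sq]
      rw [h6]
      have : 0 ≤ ∑ i, S.Θstar i j ^ 2 := Finset.sum_nonneg fun i _ => sq_nonneg _
      gcongr
    refine (Finset.sum_le_sum h5).trans ?_
    rw [← Finset.mul_sum, ← frobNorm_sq]
    have h7 : 0 ≤ lamMax := by
      refine le_trans ?_ h2
      open scoped Matrix.Norms.L2Operator in exact norm_nonneg (I.regH k ω)
    have h8 := hstar.1
    have h9 := frobNorm_nonneg S.Θstar
    exact mul_le_of_le_one_right h7 (pow_le_one₀ h9 h8)
  have b2 : weightedNorm V⁻¹ (-I.regL k ω) ≤ ν := by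
    rw [weightedNorm_neg]
    exact (weightedNorm_le_of_quad_le hVHinv _).trans h4
  have b3 : weightedNorm V⁻¹ (-N) ≤ Cw * √(2 * Real.log (2 / α)
      + n * Real.log (1 + lamMin⁻¹ • ((I.Z S H k ω)ᵀ * I.Z S H k ω)).det) := by
    rw [weightedNorm_neg, log_det_one_add_eq I S hlam]
    refine (weightedNorm_le_of_quad_le hVG _).trans ?_
    set ℓ := logDetRatio I S (H := H) lamMin (k * H) ω with hℓ
    have hℓ0 : 0 ≤ ℓ := sub_nonneg.2 (log_det_gram_mono hlam _ (Nat.zero_le _))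
    have h5 : (Nᵀ * G⁻¹ * N).trace / Cw ^ 2 - ℓ < 2 * Real.log (2 / α) := hself
    have h6 : (Nᵀ * G⁻¹ * N).trace ≤ Cw ^ 2 * (2 * Real.log (2 / α) + n * ℓ) := by
      have h7 : (Nᵀ * G⁻¹ * N).trace / Cw ^ 2 ≤ 2 * Real.log (2 / α) + ℓ := by linarith
      rw [div_le_iff₀ (by positivity)] at h7
      have h8 : (1 : ℝ) ≤ n := by exact_mod_cast hn
      have h9 : ℓ ≤ n * ℓ := le_mul_of_one_le_left hℓ0 h8
      have h10 := mul_le_mul_of_nonneg_left h9 (sq_nonneg Cw)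
      nlinarith
    unfold weightedNorm
    calc √((Nᵀ * G⁻¹ * N).trace) ≤ √(Cw ^ 2 * (2 * Real.log (2 / α) + n * ℓ)) :=
          Real.sqrt_le_sqrt h6
      _ = _ := by rw [Real.sqrt_mul (sq_nonneg Cw), Real.sqrt_sq hCw.le]
  change weightedNorm V (S.Θstar - I.estimate S H k ω) ≤ I.radius S H Cw lamMax lamMin ν α k ω
  rw [hdiff, weightedNorm_inv_mul hV]
  have t1 := weightedNorm_add_le hV.posSemidef.inv (I.regH k ω * S.Θstar) (-N + -I.regL k ω)
  have t2 := weightedNorm_add_le hV.posSemidef.inv (-N) (-I.regL k ω)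
  unfold Interaction.radius
  linarith

/-- Two parameters in the confidence set predict similar next states. -/
lemma norm_closedLoop_sub_sq_le_of_mem_confSet (hlam : 0 < lamMin)
    (hreg : I.RegularAt K lamMax lamMin ν ω) {k : ℕ} (hk : k < K) {Cw α B : ℝ}
    (hB : I.radius S H Cw lamMax lamMin ν α k ω ≤ B) {Θ Θ' : Param n d}
    (hΘ : Θ ∈ I.confSet S H Cw lamMax lamMin ν α k ω)
    (hΘ' : Θ' ∈ I.confSet S H Cw lamMax lamMin ν α k ω)
    (M : Matrix (Fin d) (Fin n) ℝ) (x : State n) :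
    ‖closedLoop Θ M x - closedLoop Θ' M x‖ ^ 2
      ≤ (2 * B) ^ 2 * quad (gram lamMin (fun i => flatVec I S H i ω) (k * H))⁻¹
          (joinVec x (Matrix.toEuclideanLin M x)) := by
  have hV := posDef_V (S := S) (H := H) hreg hk
  rw [norm_closedLoop_sub_sq]
  refine (sum_sq_dotProduct_le hV _ _).trans ?_
  have h1 := quad_inv_V_le (S := S) (H := H) hlam hreg hk (joinVec x (Matrix.toEuclideanLin M x))
  have h2 : weightedNorm (I.V S H k ω) (Θ - Θ') ≤ 2 * B := by
    have h3 := weightedNorm_add_le hV.posSemidef (Θ - I.estimate S H k ω)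
      (-(Θ' - I.estimate S H k ω))
    rw [weightedNorm_neg] at h3
    have h4 : Θ - I.estimate S H k ω + -(Θ' - I.estimate S H k ω) = Θ - Θ' := by abel
    rw [h4] at h3
    have h5 : weightedNorm (I.V S H k ω) (Θ - I.estimate S H k ω)
      ≤ I.radius S H Cw lamMax lamMin ν α k ω := hΘ
    have h6 : weightedNorm (I.V S H k ω) (Θ' - I.estimate S H k ω)
      ≤ I.radius S H Cw lamMax lamMin ν α k ω := hΘ'
    linarith
  have h3 := weightedNorm_nonneg (I.V S H k ω) (Θ - Θ')
  have h4 := quad_nonneg hV.posSemidef.inv (joinVec x (Matrix.toEuclideanLin M x))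
  gcongr

end ConfidenceSet

lemma div_lt_and_mod_lt {K H t : ℕ} (ht : t < K * H) :
    t / H < K ∧ t % H < H ∧ t / H * H + t % H = t := by
  have hH : 0 < H := Nat.pos_of_ne_zero (by rintro rfl; simp at ht)
  exact ⟨(Nat.div_lt_iff_lt_mul hH).2 ht, Nat.mod_lt _ hH, Nat.div_add_mod' t H⟩

/-! ### The realized prediction errors -/

section RealizedError

variable {n d : ℕ} {Ω : Type*} {I : Interaction n d Ω} {S : LQSystem n d} {H K : ℕ}
  {C CA CB Cw γ : ℝ}

variable (I S H) in
/-- The prediction error of the parameter of episode `k`, as a function of the information before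
the episode and of a realization of the noise, truncated at `b`. -/
def truncPredError (b : ℝ) (k : ℕ) (p : Ω × (ℕ → State n)) : ℝ :=
  min b (predError S H (I.param k p.1) (I.init k p.1) p.2)

lemma truncPredError_eq (hS : S.Bounded H C CA CB Cw γ) {k : ℕ} {ω : Ω}
    (hparam : I.param k ω ∈ paramSet n d) (hinit : ‖I.init k ω‖ ≤ 1) {ω' : Ω}
    (hnoise : ∀ h < H, ‖I.noise k h ω'‖ ≤ Cw) :
    truncPredError I S H (H * (2 * (1 + γ ^ 2))) k (ω, truncSeq (I.noise k) H ω')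
      = predError S H (I.param k ω) (I.init k ω) (fun h => I.noise k h ω') := by
  have h1 : predError S H (I.param k ω) (I.init k ω) (truncSeq (I.noise k) H ω')
      = predError S H (I.param k ω) (I.init k ω) (fun h => I.noise k h ω') :=
    predError_congr H _ _ fun i hi => by simp [truncSeq, hi]
  unfold truncPredError
  simp only [h1]
  exact min_eq_right (predError_le hS hparam hinit hnoise)

/-- The total realized prediction error. -/
lemma sum_predError_le (hS : S.Bounded H C CA CB Cw γ) {lamMax lamMin ν α : ℝ}
    (hlam : 0 < lamMin) (hCw : 0 ≤ Cw) (hν : 0 ≤ ν) {ω : Ω}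
    (hreg : I.RegularAt K lamMax lamMin ν ω)
    (hstar : ∀ k < K, S.Θstar ∈ I.confSet S H Cw lamMax lamMin ν α k ω)
    (hparam : ∀ k < K, I.param k ω ∈ I.confSet S H Cw lamMax lamMin ν α k ω ∩ paramSet n d)
    (hinit : ∀ k < K, ‖I.init k ω‖ ≤ 1) (hnoise : ∀ k < K, ∀ h < H, ‖I.noise k h ω‖ ≤ Cw) :
    ∑ k ∈ Finset.range K, predError S H (I.param k ω) (I.init k ω) (fun h => I.noise k h ω)
      ≤ 4 * (Cw * √(2 * Real.log (2 / α) + n * logDetRatio I S (H := H) lamMin (K * H) ω)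
            + √lamMax + ν) * √((H : ℝ) * K * logDetRatio I S (H := H) lamMin (K * H) ω)
        + 4 * H * (1 + γ ^ 2) * logDetRatio I S (H := H) lamMin (K * H) ω := by
  set z : ℕ → Fin n ⊕ Fin d → ℝ := fun i => flatVec I S H i ω with hz
  set B := Cw * √(2 * Real.log (2 / α) + n * logDetRatio I S (H := H) lamMin (K * H) ω)
    + √lamMax + ν with hB
  have hB0 : 0 ≤ B := by positivity
  have hrad : ∀ k < K, I.radius S H Cw lamMax lamMin ν α k ω ≤ B := by
    intro k hk
    unfold Interaction.radius
    rw [log_det_one_add_eq I S hlam, hB]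
    have : logDetRatio I S (H := H) lamMin (k * H) ω ≤ logDetRatio I S (H := H) lamMin (K * H) ω :=
      sub_le_sub_right (log_det_gram_mono hlam _ (Nat.mul_le_mul_right H hk.le)) _
    gcongr
  set e : ℕ → ℕ → ℝ := fun k h =>
    ‖closedLoop S.Θstar (S.gain H (I.param k ω) h) (I.state S H k h ω)
      - closedLoop (I.param k ω) (S.gain H (I.param k ω) h) (I.state S H k h ω)‖ with he
  have h1 := sum_error_le hlam z (K := K) (H := H) (e := e) (B := 2 * B)
    (b := 2 * (1 + γ ^ 2)) (by positivity) (by positivity)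
    (fun k hk h hh => norm_closedLoop_sub_le hS (hparam k hk).2 hh
      (norm_trajectory_star_le hS (hparam k hk).2 (hinit k hk) (hnoise k hk) hh.le))
    (fun k hk h hh => by
      have h2 := norm_closedLoop_sub_sq_le_of_mem_confSet hlam hreg hk (hrad k hk) (hstar k hk)
        (hparam k hk).1 (S.gain H (I.param k ω) h) (I.state S H k h ω)
      have h3 : z (k * H + h) = joinVec (I.state S H k h ω)
          (Matrix.toEuclideanLin (S.gain H (I.param k ω) h) (I.state S H k h ω)) := by
        have h4 := flat_div_mod (k := k) hh
        simp only [hz, flatVec, h4.1, h4.2]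
        rfl
      rw [h3]
      exact h2)
  have h2 : ∑ k ∈ Finset.range K, predError S H (I.param k ω) (I.init k ω)
      (fun h => I.noise k h ω) = ∑ k ∈ Finset.range K, ∑ h ∈ Finset.range H, e k h := rfl
  rw [h2]
  refine h1.trans (le_of_eq ?_)
  have h3 : logDetRatio I S (H := H) lamMin (K * H) ω
    = Real.log (gram lamMin z (K * H)).det - Real.log (gram lamMin z 0).det := rfl
  rw [← h3]
  ring

lemma logDetRatio_le (hn : 0 < n) (hS : S.Bounded H C CA CB Cw γ) {lamMin : ℝ}
    (hlam : 0 < lamMin) {ω : Ω} (hparam : ∀ k < K, I.param k ω ∈ paramSet n d)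
    (hinit : ∀ k < K, ‖I.init k ω‖ ≤ 1) (hnoise : ∀ k < K, ∀ h < H, ‖I.noise k h ω‖ ≤ Cw) :
    logDetRatio I S (H := H) lamMin (K * H) ω
      ≤ (1 + γ ^ 2) * (((n : ℝ) + d) * logFactor n d H K lamMin) := by
  have : Nonempty (Fin n ⊕ Fin d) := ⟨Sum.inl ⟨0, hn⟩⟩
  have h1 := log_det_gram_sub_le hlam (z := fun i => flatVec I S H i ω) (T := K * H)
    (L := 1 + γ ^ 2) (by nlinarith [sq_nonneg γ]) (fun t ht => by
      obtain ⟨h1, h2, -⟩ := div_lt_and_mod_lt ht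
      exact joinVec_gain_le hS (hparam _ h1) h2
        (norm_trajectory_star_le hS (hparam _ h1) (hinit _ h1) (hnoise _ h1) h2.le))
  simp only [Fintype.card_sum, Fintype.card_fin, Nat.cast_add, Nat.cast_mul] at h1
  rw [mul_comm (K : ℝ) H] at h1
  exact h1

end RealizedError

/-! ### Adaptedness and the regret of an episode -/

section Regret

variable {n d : ℕ} {Ω : Type*} [mΩ : MeasurableSpace Ω] {P : Measure Ω} {ℱ : Filtration ℕ mΩ}
  {I : Interaction n d Ω} {S : LQSystem n d} {H K : ℕ} {C CA CB Cw γ : ℝ}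

lemma Interaction.Adapted.episodeNoise (hA : I.Adapted H P ℱ K Cw) {k : ℕ} (hk : k < K) :
    EpisodeNoise P (fun h => ℱ (k * H + h)) (I.noise k) H Cw where
  mono := fun _ _ h => ℱ.mono (by omega)
  le := fun _ => ℱ.le _
  measurable := fun h hh => hA.noise_measurable k hk h hh
  indep := hA.noise_indep k hk
  mean := hA.noise_mean k hk
  bound := hA.noise_le k hk

lemma measurable_state (hA : I.Adapted H P ℱ K Cw) {k : ℕ} (hk : k < K) {h : ℕ} (hh : h ≤ H) :
    Measurable[ℱ (k * H + h)] (I.state S H k h) :=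
  @measurable_trajectory_gainPolicy n d S Ω (ℱ (k * H + h)) S.Θstar H (I.param k)
    (fun i j => (hA.param_measurable k hk i j).mono (ℱ.mono (by omega)) le_rfl) (I.init k)
    ((hA.init_measurable k hk).mono (ℱ.mono (by omega)) le_rfl) (I.noise k) h
    ((hA.episodeNoise hk).measurable_before hh)

lemma measurable_control (hA : I.Adapted H P ℱ K Cw) {k : ℕ} (hk : k < K) {h : ℕ} (hh : h ≤ H) :
    Measurable[ℱ (k * H + h)] (I.control S H k h) :=
  @measurable_toEuclideanLin Ω (ℱ (k * H + h)) _ _ _ _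
    (@measurableEntries_gain n d S Ω (ℱ (k * H + h)) (I.param k)
      (fun i j => (hA.param_measurable k hk i j).mono (ℱ.mono (by omega)) le_rfl) H h)
    (measurable_state hA hk hh)

lemma measurable_joinVec {α : Type*} [MeasurableSpace α] {x : α → State n} {u : α → Control d}
    (hx : Measurable x) (hu : Measurable u) : Measurable fun a => joinVec (x a) (u a) := by
  refine measurable_pi_lambda _ fun i => ?_
  rcases i with i | i
  · exact (measurable_pi_apply i).comp ((WithLp.measurable_ofLp 2 _).comp hx)
  · exact (measurable_pi_apply i).comp ((WithLp.measurable_ofLp 2 _).comp hu)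

lemma measurable_flatVec (hA : I.Adapted H P ℱ K Cw) {t : ℕ} (ht : t < K * H) :
    Measurable[ℱ t] (flatVec I S H t) := by
  obtain ⟨h1, h2, h3⟩ := div_lt_and_mod_lt ht
  have h4 := @measurable_joinVec n d Ω (ℱ (t / H * H + t % H)) _ _
    (measurable_state (S := S) hA h1 h2.le) (measurable_control (S := S) hA h1 h2.le)
  rw [h3] at h4
  exact h4

/-- With high probability, the self-normalized process stays below the level that defines the
confidence sets. -/
lemma measure_selfNormLog_ge_le [IsProbabilityMeasure P] (hA : I.Adapted H P ℱ K Cw)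
    (hCw : 0 < Cw) {lam : ℝ} (hlam : 0 < lam) {α : ℝ} (hα : 0 < α) :
    P {ω | ∃ t ≤ K * H, 2 * Real.log (2 / α) ≤ selfNormLog Cw lam (fun i => flatVec I S H i ω)
      (fun i => (flatNoise I H i ω).ofLp) t} ≤ ENNReal.ofReal (α / 2) := by
  have h := measure_exists_selfNormLog_le (P := P) ℱ (T := K * H) (z := flatVec I S H)
    (w := flatNoise I H) hCw hlam (fun t ht => measurable_flatVec hA ht)
    (fun t ht => by
      obtain ⟨h1, h2, h3⟩ := div_lt_and_mod_lt ht
      have := hA.noise_measurable _ h1 _ h2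
      rwa [h3] at this)
    (fun t ht => by
      obtain ⟨h1, h2, h3⟩ := div_lt_and_mod_lt ht
      have := hA.noise_indep _ h1 _ h2
      rwa [h3] at this)
    (fun t ht => by
      obtain ⟨h1, h2, -⟩ := div_lt_and_mod_lt ht
      exact hA.noise_mean _ h1 _ h2)
    (fun t ht => by
      obtain ⟨h1, h2, -⟩ := div_lt_and_mod_lt ht
      exact hA.noise_le _ h1 _ h2) (b := α / 2) (by positivity)
  rwa [one_div_div] at h

/-- With high probability, the expected prediction errors are controlled by the realized ones. -/
lemma measure_integral_truncPredError_gt_le [IsProbabilityMeasure P]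
    (hA : I.Adapted H P ℱ K Cw) {b : ℝ} (hb : 0 < b) {α : ℝ} (hα : 0 < α) :
    P {ω | 2 * ∑ k ∈ Finset.range K, truncPredError I S H b k (ω, truncSeq (I.noise k) H ω)
        + 2 * b * Real.log (2 / α)
      < ∑ k ∈ Finset.range K,
          ∫ ω', truncPredError I S H b k (ω, truncSeq (I.noise k) H ω') ∂P}
      ≤ ENNReal.ofReal (α / 2) := by
  have h := measure_sum_integral_freeze_gt_le (P := P) (𝒦 := fun k => ℱ (k * H))
    (fun _ _ h => ℱ.mono (Nat.mul_le_mul_right H h)) (fun k => ℱ.le _) (K := K)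
    (W := fun k => truncSeq (I.noise k) H)
    (fun k hk => @measurable_truncSeq Ω _ (ℱ ((k + 1) * H)) _ _ _ _ fun i hi =>
      (hA.noise_measurable k hk i hi).mono (ℱ.mono (by rw [add_mul]; omega)) le_rfl)
    (fun k hk => by
      have hE := hA.episodeNoise hk
      exact indep_comap_truncSeq hE.mono hE.le hE.measurable hE.indep H le_rfl)
    (f := truncPredError I S H b) (fun k hk => by
      have hp := hA.param_measurable k hk
      have hi := hA.init_measurable k hk
      let _ : MeasurableSpace Ω := ℱ (k * H)
      refine measurable_const.min ?_
      exact measurable_predError (α := Ω × (ℕ → State n)) H (p := fun q => I.param k q.1)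
        (fun i j => (hp i j).comp measurable_fst) (hi.comp measurable_fst)
        (w := fun i q => q.2 i) fun i _ => (measurable_pi_apply i).comp measurable_snd)
    hb (fun k _ p => le_min hb.le (predError_nonneg _ _ _ _)) (fun k _ p => min_le_left _ _)
    (β := α / 2) (by positivity)
  rwa [one_div_div] at h

/-- Regret of one episode under an optimistic parameter. -/
lemma episode_regret_le [IsProbabilityMeasure P] (hS : S.Bounded H C CA CB Cw γ)
    (hA : I.Adapted H P ℱ K Cw) (hH : 0 < H) {k : ℕ} (hk : k < K) {ω : Ω}
    (hparam : I.param k ω ∈ paramSet n d) (hinit : ‖I.init k ω‖ ≤ 1) {ε : ℝ} (hε : 0 ≤ ε)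
    (hopt : S.optCost P (I.noise k) H (I.param k ω) (I.init k ω)
      ≤ S.optCost P (I.noise k) H S.Θstar (I.init k ω) + ENNReal.ofReal ε) :
    (S.expCost P (I.noise k) H S.Θstar (I.policy S H k ω) (I.init k ω)).toReal
      - (S.optCost P (I.noise k) H S.Θstar (I.init k ω)).toReal
      ≤ √(H : ℝ) * (C + C * (1 + γ ^ 2) / Cw)
        * ∫ ω', truncPredError I S H (H * (2 * (1 + γ ^ 2))) k
            (ω, truncSeq (I.noise k) H ω') ∂P + ε := by
  have hE := hA.episodeNoise hk
  have h1 := expCost_star_toReal_le hS hE hparam hinit hH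
  have h2 : ∫ ω', truncPredError I S H (H * (2 * (1 + γ ^ 2))) k
      (ω, truncSeq (I.noise k) H ω') ∂P
      = ∫ ω', predError S H (I.param k ω) (I.init k ω) (fun h => I.noise k h ω') ∂P := by
    refine integral_congr_ae ?_
    filter_upwards [hE.bound_all] with ω' h' using truncPredError_eq hS hparam hinit h'
  set v := quad (S.riccati (I.param k ω) H) (I.init k ω).ofLp
    + noiseCost S P (I.noise k) H (I.param k ω) 0 with hv
  have hlow : ENNReal.ofReal v ≤ S.optCost P (I.noise k) H (I.param k ω) (I.init k ω) :=
    le_iInf fun π => le_expCost hS.posDef_Q hS.posDef_R hE _ π.2 _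
  -- finiteness, without which `toReal` of the optimal cost would be `0`
  have hfin : S.optCost P (I.noise k) H S.Θstar (I.init k ω) ≠ ⊤ := by
    have h3 : S.optCost P (I.noise k) H S.Θstar (I.init k ω)
        ≤ S.expCost P (I.noise k) H S.Θstar (S.gainPolicy H (I.param k ω)) (I.init k ω) :=
      iInf_le (fun π : {π : Policy n d // ∀ h, Measurable (π h)} =>
        S.expCost P (I.noise k) H S.Θstar π.1 (I.init k ω))
        ⟨S.gainPolicy H (I.param k ω), measurable_gainPolicy S H _⟩
    exact ne_top_of_le_ne_top ENNReal.ofReal_ne_top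
      (h3.trans (expCost_star_le hS hE hparam hinit))
  have h4 : v ≤ (S.optCost P (I.noise k) H S.Θstar (I.init k ω)).toReal + ε := by
    have h5 := hlow.trans hopt
    rw [ENNReal.ofReal_le_iff_le_toReal (ENNReal.add_ne_top.2 ⟨hfin, ENNReal.ofReal_ne_top⟩),
      ENNReal.toReal_add hfin ENNReal.ofReal_ne_top, ENNReal.toReal_ofReal hε] at h5
    exact h5
  rw [h2]
  change (S.expCost P (I.noise k) H S.Θstar (I.policy S H k ω) (I.init k ω)).toReal ≤ _ at h1
  linarith

end Regret

/-- The arithmetic behind the rate: `ℓ` is the logarithm of the determinant ratio, `Λ` stands for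
`log (2 / α)`, `y` for `n (n + d) ψ`, and `M` for the total prediction error. -/
lemma rate_le {g L h κ n' ℓ y Λ a Cw ρ E M : ℝ} (hg : 0 ≤ g) (hL : 1 ≤ L) (hh : 0 ≤ h)
    (hκ : h ≤ κ) (hn : 1 ≤ n') (hℓ : 0 ≤ ℓ) (hℓy : n' * ℓ ≤ L * y) (hy : 0 ≤ y)
    (ha : 0 ≤ a) (hΛ0 : 0 ≤ Λ) (hh1 : 1 ≤ h) (hΛ : Λ ≤ 1 + a) (hCw1 : Cw ≤ 1)
    (hρ : 0 ≤ ρ) (hE : E ≤ κ)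
    (hM : M ≤ 4 * (Cw * √(2 * Λ + n' * ℓ) + ρ) * √(h ^ 2 * κ ^ 2 * ℓ) + 4 * h ^ 2 * L * ℓ) :
    h * g * (2 * M + 2 * (h ^ 2 * (2 * L)) * Λ) + E
      ≤ (20 * g * L ^ 2 + 1) * (h ^ 2 * κ * (h + y + a) + h ^ 2 * κ * ρ * √y) := by
  have hκ0 : 0 ≤ κ := hh.trans hκ
  have hsq : √(h ^ 2 * κ ^ 2 * ℓ) = h * κ * √ℓ := by
    rw [← mul_pow, Real.sqrt_mul (by positivity), Real.sqrt_sq (by positivity)]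
  rw [hsq] at hM
  have hℓn : ℓ ≤ n' * ℓ := le_mul_of_one_le_left hℓ hn
  have hs1 : √(2 * Λ + n' * ℓ) * √ℓ ≤ Λ + L * y := by
    have h1 := Real.sq_sqrt (show 0 ≤ 2 * Λ + n' * ℓ by positivity)
    have h2 := Real.sq_sqrt hℓ
    have h3 := two_mul_le_add_sq (√(2 * Λ + n' * ℓ)) (√ℓ)
    nlinarith
  have hL0 : 0 ≤ L := by linarith
  have hs2 : √ℓ ≤ L * √y := by
    rw [Real.sqrt_le_iff]
    refine ⟨by positivity, ?_⟩
    rw [mul_pow, Real.sq_sqrt hy]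
    have : L * y ≤ L ^ 2 * y := by
      have : L ≤ L ^ 2 := by nlinarith
      gcongr
    linarith
  have hs3 : Cw * (√(2 * Λ + n' * ℓ) * √ℓ) ≤ Λ + L * y :=
    (mul_le_of_le_one_left (by positivity) hCw1).trans hs1
  have hs4 : ρ * √ℓ ≤ ρ * (L * √y) := mul_le_mul_of_nonneg_left hs2 hρ
  have hM2 : M ≤ 4 * (h * κ) * (Λ + L * y + ρ * (L * √y)) + 4 * h ^ 2 * L * (L * y) := by
    refine hM.trans ?_
    have e1 : 4 * (Cw * √(2 * Λ + n' * ℓ) + ρ) * (h * κ * √ℓ)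
        = 4 * (h * κ) * (Cw * (√(2 * Λ + n' * ℓ) * √ℓ) + ρ * √ℓ) := by ring
    rw [e1]
    have e2 : Cw * (√(2 * Λ + n' * ℓ) * √ℓ) + ρ * √ℓ ≤ Λ + L * y + ρ * (L * √y) := by linarith
    have e3 : ℓ ≤ L * y := hℓn.trans hℓy
    gcongr
  have hLL : L ≤ L ^ 2 := by nlinarith
  have hL1 : 1 ≤ L ^ 2 := by nlinarith
  have hp : 0 ≤ g * (h ^ 2 * κ) := by positivity
  -- the term from blocks with a large determinant and the concentration term have a factor
  -- `h ^ 3`, which is at most `h ^ 2 * κ`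
  have hcube : h * h ^ 2 ≤ h ^ 2 * κ := by nlinarith [sq_nonneg h]
  have hΛh : Λ ≤ h + a := by linarith
  set ry := ρ * √y with hry
  have hry0 : 0 ≤ ry := by positivity
  have main : h * g * (2 * M + 2 * (h ^ 2 * (2 * L)) * Λ)
      ≤ g * (h ^ 2 * κ) * (20 * L ^ 2 * (h + y + a + ry)) := by
    have s1 : h * g * (2 * M + 2 * (h ^ 2 * (2 * L)) * Λ)
        ≤ h * g * (2 * (4 * (h * κ) * (Λ + L * y + ρ * (L * √y)) + 4 * h ^ 2 * L * (L * y))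
          + 2 * (h ^ 2 * (2 * L)) * Λ) := by gcongr
    have s2 : h * g * (2 * (4 * (h * κ) * (Λ + L * y + ρ * (L * √y)) + 4 * h ^ 2 * L * (L * y))
          + 2 * (h ^ 2 * (2 * L)) * Λ)
        = g * (h ^ 2 * κ) * (8 * Λ + 8 * L * y + 8 * L * ry)
          + (h * h ^ 2) * (g * (8 * L ^ 2 * y + 4 * L * Λ)) := by rw [hry]; ring
    have s4 : 8 * Λ + 8 * L * y + 8 * L * ry + (8 * L ^ 2 * y + 4 * L * Λ)
        ≤ 20 * L ^ 2 * (h + y + a + ry) := by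
      have t0 : 0 ≤ h + a := by positivity
      have t1 : Λ ≤ L ^ 2 * (h + a) := hΛh.trans (le_mul_of_one_le_left t0 hL1)
      have t2 : L * y ≤ L ^ 2 * y := by gcongr
      have t3 : L * ry ≤ L ^ 2 * ry := by gcongr
      have t4 : L * Λ ≤ L ^ 2 * (h + a) := by gcongr
      have t5 : 0 ≤ L ^ 2 * ry := by positivity
      have t6 : 0 ≤ L ^ 2 * y := by positivity
      have t7 : 0 ≤ L ^ 2 * (h + a) := by positivity
      have t8 : 20 * L ^ 2 * (h + y + a + ry)
          = 20 * (L ^ 2 * (h + a)) + 20 * (L ^ 2 * y) + 20 * (L ^ 2 * ry) := by ring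
      linarith
    calc _ ≤ _ := s1
      _ = _ := s2
      _ ≤ g * (h ^ 2 * κ) * (8 * Λ + 8 * L * y + 8 * L * ry)
          + (h ^ 2 * κ) * (g * (8 * L ^ 2 * y + 4 * L * Λ)) := by gcongr
      _ = g * (h ^ 2 * κ)
          * (8 * Λ + 8 * L * y + 8 * L * ry + (8 * L ^ 2 * y + 4 * L * Λ)) := by ring
      _ ≤ _ := mul_le_mul_of_nonneg_left s4 hp
  have hEE : E ≤ h ^ 2 * κ * (h + y + a + ry) := by
    have h2 : 1 ≤ h ^ 2 := by nlinarith
    calc E ≤ 1 * κ * 1 := by linarith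
      _ ≤ h ^ 2 * κ * (h + y + a + ry) := by
        gcongr
        linarith
  have hfin : (20 * g * L ^ 2 + 1) * (h ^ 2 * κ * (h + y + a) + h ^ 2 * κ * ρ * √y)
      = g * (h ^ 2 * κ) * (20 * L ^ 2 * (h + y + a + ry)) + h ^ 2 * κ * (h + y + a + ry) := by
    rw [hry]; ring
  rw [hfin]
  exact add_le_add main hEE

/-! ### The regret bound -/

section RegretBound

variable {n d : ℕ} {Ω : Type*} [mΩ : MeasurableSpace Ω] {P : Measure Ω} {ℱ : Filtration ℕ mΩ}
  {I : Interaction n d Ω} {S : LQSystem n d} {H K : ℕ} {C CA CB Cw γ : ℝ}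

/-- The regret bound, for an outcome at which the true parameter lies in all confidence sets and the
expected prediction errors are controlled by the realized ones. -/
lemma regret_le_of_good [IsProbabilityMeasure P] (hn : 0 < n) (hH : 0 < H) (hK : 0 < K)
    (hS : S.Bounded H C CA CB Cw γ) (hA : I.Adapted H P ℱ K Cw) {α lamMax lamMin ν ε : ℝ}
    (hα : 0 < α) (hα1 : α ≤ 1) (hlam : 0 < lamMin) (hε : 0 ≤ ε) (hεK : ε ≤ 1 / √(K : ℝ)) {ω : Ω}
    (hreg : I.RegularAt K lamMax lamMin ν ω)
    (hopt : ∀ k < K, (I.confSet S H Cw lamMax lamMin ν α k ω ∩ paramSet n d).Nonempty →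
      I.param k ω ∈ I.confSet S H Cw lamMax lamMin ν α k ω ∩ paramSet n d ∧
      ∀ Θ ∈ I.confSet S H Cw lamMax lamMin ν α k ω ∩ paramSet n d,
        S.optCost P (I.noise k) H (I.param k ω) (I.init k ω)
          ≤ S.optCost P (I.noise k) H Θ (I.init k ω) + ENNReal.ofReal ε)
    (hinit : ∀ k < K, ‖I.init k ω‖ ≤ 1) (hnoise : ∀ k < K, ∀ h < H, ‖I.noise k h ω‖ ≤ Cw)
    (hself : ∀ t ≤ K * H, selfNormLog Cw lamMin (fun i => flatVec I S H i ω)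
      (fun i => (flatNoise I H i ω).ofLp) t < 2 * Real.log (2 / α))
    (hconc : ∑ k ∈ Finset.range K, ∫ ω', truncPredError I S H (H * (2 * (1 + γ ^ 2))) k
          (ω, truncSeq (I.noise k) H ω') ∂P
      ≤ 2 * ∑ k ∈ Finset.range K, truncPredError I S H (H * (2 * (1 + γ ^ 2))) k
          (ω, truncSeq (I.noise k) H ω) + 2 * (H * (2 * (1 + γ ^ 2))) * Real.log (2 / α)) :
    I.regret S H P K ω ≤ (20 * |C + C * (1 + γ ^ 2) / Cw| * (1 + γ ^ 2) ^ 2 + 1)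
      * (H * √(K : ℝ) * (√(H : ℝ) + n * ((n : ℝ) + d) * logFactor n d H K lamMin
                + Real.log (1 / α))
            + H * √(K : ℝ) * (√lamMax + ν)
                * √(n * ((n : ℝ) + d) * logFactor n d H K lamMin)) := by
  have hC := hS.C_nonneg
  have hCw := hS.Cw_pos
  have hCw1 := hS.Cw_lt_one
  set g := C + C * (1 + γ ^ 2) / Cw with hg
  have hg0 : 0 ≤ g := by positivity
  rw [abs_of_nonneg hg0]
  set L := 1 + γ ^ 2 with hL
  have hL1 : 1 ≤ L := by nlinarith [sq_nonneg γ]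
  have hν : 0 ≤ ν := (weightedNorm_nonneg _ _).trans (hreg 0 hK).2.2.2
  have hstar : ∀ k < K, S.Θstar ∈ I.confSet S H Cw lamMax lamMin ν α k ω := fun k hk =>
    star_mem_confSet hn hlam hCw hS.star_mem hreg hk (hself _ (Nat.mul_le_mul_right H hk.le))
  have hmem : ∀ k < K, I.param k ω ∈ I.confSet S H Cw lamMax lamMin ν α k ω ∩ paramSet n d :=
    fun k hk => (hopt k hk ⟨S.Θstar, hstar k hk, hS.star_mem⟩).1
  have hH1 : (1 : ℝ) ≤ H := by exact_mod_cast hH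
  have hK1 : (1 : ℝ) ≤ K := by exact_mod_cast hK
  set h := √(H : ℝ) with hh
  set κ := √(K : ℝ) with hκ
  have hh2 : h ^ 2 = H := Real.sq_sqrt (by positivity)
  have hκ2 : κ ^ 2 = K := Real.sq_sqrt (by positivity)
  have hh1 : 1 ≤ h := Real.one_le_sqrt.2 hH1
  have hκ1 : 1 ≤ κ := Real.one_le_sqrt.2 hK1
  set a := Real.log (1 / α) with ha
  have ha0 : 0 ≤ a := Real.log_nonneg (by rw [le_div_iff₀ hα]; linarith)
  have hψ0 : 0 ≤ logFactor n d H K lamMin := by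
    refine Real.log_nonneg ?_
    have : (0 : ℝ) ≤ (H : ℝ) * K / (((n : ℝ) + d) * lamMin) := by positivity
    linarith
  set y := n * ((n : ℝ) + d) * logFactor n d H K lamMin with hy
  have hy0 : 0 ≤ y := by positivity
  have hHκ : (H : ℝ) = h ^ 2 := hh2.symm
  rcases lt_or_ge K H with hKH | hKH
  -- short interaction: the cost of an episode is at most `H * C * L`
  · have hκh : κ ≤ h := Real.sqrt_le_sqrt (by exact_mod_cast hKH.le)
    have h1 : I.regret S H P K ω ≤ ∑ k ∈ Finset.range K, (H * (C * L) : ℝ) := by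
      refine Finset.sum_le_sum fun k hk => ?_
      have hk := Finset.mem_range.1 hk
      have h2 := expCost_star_le hS (hA.episodeNoise hk) (hmem k hk).2 (hinit k hk)
      have h3 := ENNReal.toReal_mono ENNReal.ofReal_ne_top h2
      rw [ENNReal.toReal_ofReal (by positivity)] at h3
      have h4 : 0 ≤ (S.optCost P (I.noise k) H S.Θstar (I.init k ω)).toReal :=
        ENNReal.toReal_nonneg
      change (S.expCost P (I.noise k) H S.Θstar (I.policy S H k ω) (I.init k ω)).toReal
        ≤ H * (C * L) at h3
      linarith
    rw [Finset.sum_const, Finset.card_range, nsmul_eq_mul] at h1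
    refine h1.trans ?_
    have h5 : C * L ≤ 20 * g * L ^ 2 + 1 := by
      have h6 : C ≤ g := le_add_of_nonneg_right (by positivity)
      have h7 : C * L ≤ g * L ^ 2 := by
        have : L ≤ L ^ 2 := by nlinarith
        gcongr
      have : 0 ≤ g * L ^ 2 := by positivity
      linarith
    have h8 : 0 ≤ H * κ * (√lamMax + ν) * √y := by positivity
    calc (K : ℝ) * (H * (C * L)) = (C * L) * (H * κ * κ) := by rw [← hκ2]; ring
      _ ≤ (20 * g * L ^ 2 + 1) * (H * κ * h) := by gcongr
      _ ≤ _ := by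
        refine mul_le_mul_of_nonneg_left ?_ (by positivity)
        have : H * κ * h ≤ H * κ * (h + y + a) := by
          gcongr
          linarith
        linarith
  · have hhκ : h ≤ κ := Real.sqrt_le_sqrt (by exact_mod_cast hKH)
    set ℓ := logDetRatio I S (H := H) lamMin (K * H) ω with hℓ
    have hℓ0 : 0 ≤ ℓ := sub_nonneg.2 (log_det_gram_mono hlam _ (Nat.zero_le _))
    have hℓy : (n : ℝ) * ℓ ≤ L * y := by
      have h1 := logDetRatio_le (I := I) hn hS hlam (fun k hk => (hmem k hk).2) hinit hnoise
      have h2 := mul_le_mul_of_nonneg_left h1 (Nat.cast_nonneg (α := ℝ) n)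
      rw [hy]
      linarith
    have hM := sum_predError_le hS hlam hCw.le hν hreg hstar hmem hinit hnoise
    set M := ∑ k ∈ Finset.range K, predError S H (I.param k ω) (I.init k ω)
      (fun h => I.noise k h ω) with hMdef
    have hMtr : ∑ k ∈ Finset.range K, truncPredError I S H (H * (2 * L)) k
        (ω, truncSeq (I.noise k) H ω) = M :=
      Finset.sum_congr rfl fun k hk => truncPredError_eq hS (hmem k (Finset.mem_range.1 hk)).2
        (hinit k (Finset.mem_range.1 hk)) (hnoise k (Finset.mem_range.1 hk))
    rw [hMtr] at hconc
    have hΛ : Real.log (2 / α) ≤ 1 + a := by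
      have : Real.log (2 / α) = Real.log 2 + a := by
        rw [ha, ← Real.log_mul (by norm_num) (by positivity), mul_one_div]
      have := Real.log_two_lt_d9
      linarith
    have hΛ0 : 0 ≤ Real.log (2 / α) :=
      Real.log_nonneg (by rw [le_div_iff₀ hα]; linarith)
    have hregret : I.regret S H P K ω ≤ h * g * (2 * M + 2 * (H * (2 * L)) * Real.log (2 / α))
        + K * ε := by
      have h1 : I.regret S H P K ω ≤ ∑ k ∈ Finset.range K, (h * g
          * ∫ ω', truncPredError I S H (H * (2 * L)) k (ω, truncSeq (I.noise k) H ω') ∂P + ε) :=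
        Finset.sum_le_sum fun k hk => by
          have hk := Finset.mem_range.1 hk
          exact episode_regret_le hS hA hH hk (hmem k hk).2 (hinit k hk) hε
            ((hopt k hk ⟨S.Θstar, hstar k hk, hS.star_mem⟩).2 S.Θstar ⟨hstar k hk, hS.star_mem⟩)
      rw [Finset.sum_add_distrib, ← Finset.mul_sum, Finset.sum_const, Finset.card_range,
        nsmul_eq_mul] at h1
      refine h1.trans ?_
      gcongr
    have hKε : K * ε ≤ κ := by
      calc (K : ℝ) * ε ≤ K * (1 / κ) := by gcongr
        _ = κ := by rw [← hκ2]; field_simp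
    refine hregret.trans ?_
    have hn1 : (1 : ℝ) ≤ n := by exact_mod_cast hn
    rw [hHκ]
    rw [hHκ, ← hκ2, add_assoc] at hM
    exact rate_le hg0 hL1 (by positivity) hhκ hn1 hℓ0 hℓy hy0 ha0 hΛ0 hh1 hΛ hCw1.le
      (by positivity) hKε hM

end RegretBound

end LQControl

end

theorem mainTheorem1 (C CA CB Cw γ : ℝ) :
    ∃ c : ℝ, 0 < c ∧
      ∀ (n d H K : ℕ), 0 < n → 0 < d → 0 < H → 0 < K →
      ∀ (S : LQControl.LQSystem n d), S.Bounded H C CA CB Cw γ →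
      ∀ (Ω : Type*) [mΩ : MeasurableSpace Ω] (P : MeasureTheory.Measure Ω)
        [MeasureTheory.IsProbabilityMeasure P] (ℱ : MeasureTheory.Filtration ℕ mΩ)
        (I : LQControl.Interaction n d Ω), I.Adapted H P ℱ K Cw →
      ∀ (α δ lamMax lamMin ν ε : ℝ), 0 < α → α ≤ 1 → 0 ≤ δ → 0 < lamMin →
        0 ≤ ε → ε ≤ 1 / √(K : ℝ) →
        1 - δ ≤ P.real {ω | I.RegularAt K lamMax lamMin ν ω} →
        I.Optimistic S H P K Cw lamMax lamMin ν α ε →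
        1 - (α + δ) ≤ P.real {ω | I.regret S H P K ω ≤
          c * (H * √(K : ℝ) * (√(H : ℝ) + n * ((n : ℝ) + d) * LQControl.logFactor n d H K lamMin
                + Real.log (1 / α))
            + H * √(K : ℝ) * (√lamMax + ν)
                * √(n * ((n : ℝ) + d) * LQControl.logFactor n d H K lamMin))} := by
  refine ⟨20 * |C + C * (1 + γ ^ 2) / Cw| * (1 + γ ^ 2) ^ 2 + 1, by positivity, ?_⟩
  intro n d H K hn _ hH hK S hS Ω mΩ P _ ℱ I hA α δ lamMax lamMin ν ε hα hα1 _ hlam hε hεK hreg hopt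
  set Good : Set Ω := {ω | I.regret S H P K ω ≤ (20 * |C + C * (1 + γ ^ 2) / Cw|
    * (1 + γ ^ 2) ^ 2 + 1) * (H * √(K : ℝ) * (√(H : ℝ) + n * ((n : ℝ) + d)
      * LQControl.logFactor n d H K lamMin + Real.log (1 / α))
      + H * √(K : ℝ) * (√lamMax + ν)
          * √(n * ((n : ℝ) + d) * LQControl.logFactor n d H K lamMin))} with hGood
  set b : ℝ := H * (2 * (1 + γ ^ 2)) with hb
  have hH0 : (0 : ℝ) < H := by exact_mod_cast hH
  have hb0 : 0 < b := by positivity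
  set Bad1 : Set Ω := {ω | ∃ t ≤ K * H, 2 * Real.log (2 / α) ≤ LQControl.selfNormLog Cw lamMin
    (fun i => LQControl.flatVec I S H i ω) (fun i => (LQControl.flatNoise I H i ω).ofLp) t}
    with hBad1
  set Bad2 : Set Ω := {ω | 2 * ∑ k ∈ Finset.range K,
        LQControl.truncPredError I S H b k (ω, LQControl.truncSeq (I.noise k) H ω)
        + 2 * b * Real.log (2 / α)
      < ∑ k ∈ Finset.range K, ∫ ω', LQControl.truncPredError I S H b k
          (ω, LQControl.truncSeq (I.noise k) H ω') ∂P} with hBad2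
  have h1 : P.real Bad1 ≤ α / 2 :=
    ENNReal.toReal_le_of_le_ofReal (by positivity)
      (LQControl.measure_selfNormLog_ge_le hA hS.Cw_pos hlam hα)
  have h2 : P.real Bad2 ≤ α / 2 :=
    ENNReal.toReal_le_of_le_ofReal (by positivity)
      (LQControl.measure_integral_truncPredError_gt_le hA hb0 hα)
  have hinit : ∀ᵐ ω ∂P, ∀ k < K, ‖I.init k ω‖ ≤ 1 := by
    refine MeasureTheory.ae_all_iff.2 fun k => ?_
    by_cases hk : k < K
    · filter_upwards [hA.init_le k hk] with ω hω _ using hω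
    · exact Filter.Eventually.of_forall fun ω h => absurd h hk
  have hnoise : ∀ᵐ ω ∂P, ∀ k < K, ∀ h < H, ‖I.noise k h ω‖ ≤ Cw := by
    refine MeasureTheory.ae_all_iff.2 fun k => ?_
    by_cases hk : k < K
    · filter_upwards [(hA.episodeNoise hk).bound_all] with ω hω _ using hω
    · exact Filter.Eventually.of_forall fun ω h => absurd h hk
  -- The events need not be measurable: outer subadditivity is enough.
  have hsub : {ω | I.RegularAt K lamMax lamMin ν ω} ≤ᵐ[P] (Good ∪ Bad1 ∪ Bad2 : Set Ω) := by
    filter_upwards [hinit, hnoise, hopt] with ω hi hw ho hr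
    by_cases hb1 : ω ∈ Bad1
    · exact Or.inl (Or.inr hb1)
    by_cases hb2 : ω ∈ Bad2
    · exact Or.inr hb2
    refine Or.inl (Or.inl ?_)
    have hb1' : ∀ t ≤ K * H, LQControl.selfNormLog Cw lamMin
        (fun i => LQControl.flatVec I S H i ω) (fun i => (LQControl.flatNoise I H i ω).ofLp) t
        < 2 * Real.log (2 / α) := fun t ht => lt_of_not_ge fun hle => hb1 ⟨t, ht, hle⟩
    exact LQControl.regret_le_of_good hn hH hK hS hA hα hα1 hlam hε hεK hr ho hi hw hb1'
      (not_lt.1 hb2)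
  have h3 : P.real {ω | I.RegularAt K lamMax lamMin ν ω} ≤ P.real (Good ∪ Bad1 ∪ Bad2) :=
    ENNReal.toReal_mono (MeasureTheory.measure_ne_top P _) (MeasureTheory.measure_mono_ae hsub)
  have h4 := MeasureTheory.measureReal_union_le (μ := P) (Good ∪ Bad1) Bad2
  have h5 := MeasureTheory.measureReal_union_le (μ := P) Good Bad1
  linarith
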